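/- **Setting.** Let $\varphi:[0,1]\to[0,1]$ be continuous, strictly increasing and absolutely continuous, with $\varphi(0)=0$, $\varphi(1)=1$ (an absolutely continuous warping function). Let $\theta>0$, $p\in(0,1)$, $t\in(0,1)$, $n\ge 1$, and write $c=\frac1{1+\theta}$. Let $U_1^\ast\le\dots\le U_n^\ast$ be the sorted values of $n$ independent uniform variables on $[0,1]$, and put $U_0^\ast=0$, $U_{n+1}^\ast=1$. *BK process.* Conditionally on $U^\ast$, let $(\alpha_1,\dots,\alpha_{n+1})$ be Dirichlet distributed with parameters $\theta(\varphi(U_j^\ast)-\varphi(U_{j-1}^\ast))$, $1\le j\le n+1$. Then $w_n^{\mathrm{BK}}(\cdot;\theta)$ is the piecewise linear interpolation of the points $(U_j^\ast,\alpha_1+\dots+\alpha_j)$, $0\le j\le n+1$. *CDF process.* Let $(\beta_1,\dots,\beta_n)$ be Dirichlet distributed with parameters $(\theta/n,\dots,\theta/n)$, independent of $U^\ast$, let $\beta_{-1}=\beta_0=\beta_{n+1}=0$ and $\gamma_j=(1-p)\beta_j+p\beta_{j-1}$ for $0\le j\le n+1$. Then $w_n^{\mathrm{CDF}}(\cdot;\theta,p)$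 is the piecewise linear interpolation of the points $(\varphi^{-1}(U_j^\ast),\gamma_0+\dots+\gamma_j)$, $0\le j\le n+1$. For $1\le j\le n-1$ let $f_j(u,v)=\frac{n!}{(j-1)!\,(n-j-1)!}u^{j-1}(1-v)^{n-j-1}$, and $$D_j[g]=\int_t^1\!\int_0^t g(u,v)f_j(u,v)\,du\,dv,\qquad \rho=\frac{t-u}{v-u},$$ $$Q_{j,k}=\int_0^{\varphi(t)}\!\int_{\varphi(t)}^1\Big(\frac{t-\varphi^{-1}(u)}{\varphi^{-1}(v)-\varphi^{-1}(u)}\Big)^k f_j(u,v)\,dv\,du .$$ Empty sums are $0$. **Proposition 1.** (i) For every $n\ge1$, $w_n^{\mathrm{BK}}(t;\theta)$ and $w_n^{\mathrm{CDF}}(t;\theta,p)$ are integrable, with $\mathbb E[w_n^{\mathrm{BK}}(t;\theta)]=\mathcal E_n^{\mathrm{BK}}(t)$ and $\mathbb E[w_n^{\mathrm{CDF}}(t;\theta,p)]=\mathcal E_n^{\mathrm{CDF}}(t;p)$, where $$\mathcal E_n^{\mathrm{BK}}(t)=\int_t^1\frac tu\varphi(u)\,n(1-u)^{n-1}du+\sum_{j=1}^{n-1}D_j\big[\varphi(u)+\rho(\varphi(v)-\varphi(u))\big]+\int_0^t\Big(1-(1-\varphi(v))\frac{1-t}{1-v}\Big)nv^{n-1}dv,$$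 $$\begin{aligned}\mathcal E_n^{\mathrm{CDF}}(t;p)=&\ \frac{1-p}n\int_{\varphi(t)}^1\frac t{\varphi^{-1}(u)}n(1-u)^{n-1}du+\frac1n\Big[n\varphi(t)-n\varphi(t)^n-p\big(1-\varphi(t)^n-(1-\varphi(t))^n\big)\Big]\\&+\frac1n\sum_{j=1}^{n-1}Q_{j,1}+\int_0^{\varphi(t)}\Big(1-\frac pn\,\frac{1-t}{1-\varphi^{-1}(v)}\Big)nv^{n-1}dv.\end{aligned}$$ As $n\to\infty$, $\mathbb E[w_n^{\mathrm{CDF}}(t;\theta,p)]-\varphi(t)=O(1/n)$; and if moreover $\|\varphi'\|_\infty=\sup\{\varphi'(x): x\in(0,1),\ \varphi\text{ differentiable at }x\}<\infty$, then $\mathbb E[w_n^{\mathrm{BK}}(t;\theta)]-\varphi(t)=O(1/n)$. (ii) For every $n\ge1$ both variables are square integrable, with $\operatorname{Var}[w_n^{\mathrm{BK}}(t;\theta)]=\mathcal V_n^{\mathrm{BK}}(t;\theta)$ and $\operatorname{Var}[w_n^{\mathrm{CDF}}(t;\theta,p)]=\mathcal V_n^{\mathrm{CDF}}(t;\theta,p)$,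 where $$\begin{aligned}\mathcal V_n^{\mathrm{BK}}(t;\theta)=&\ \int_t^1\Big(\frac tu\Big)^2\big(c\,\varphi(u)+(1-c)\varphi(u)^2\big)n(1-u)^{n-1}du\\ &+\sum_{j=1}^{n-1}\Big(c\,D_j[\varphi(u)]+(1-c)D_j[\varphi(u)^2]+2(1-c)D_j[\rho(\varphi(v)-\varphi(u))\varphi(u)]\\ &\qquad\quad+c\,D_j[(\varphi(v)-\varphi(u))\rho^2]+(1-c)D_j[(\varphi(v)-\varphi(u))^2\rho^2]\Big)\\ &+t^n-2\int_0^t\frac{1-t}{1-v}(1-\varphi(v))nv^{n-1}dv\\ &+\int_0^t\Big(\frac{1-t}{1-v}\Big)^2\big(c(1-\varphi(v))+(1-c)(1-\varphi(v))^2\big)nv^{n-1}dv-\mathcal E_n^{\mathrm{BK}}(t)^2,\end{aligned}$$ $$\begin{aligned}\mathcal V_n^{\mathrm{CDF}}(t;\theta,p)=&\ (1-p)^2\Big(\frac cn+\frac{1-c}{n^2}\Big)\int_{\varphi(t)}^1\frac{t^2}{\varphi^{-1}(u)^2}n(1-u)^{n-1}du\\ &+\frac cn\Big[n\varphi(t)-n\varphi(t)^n-(2p-p^2)\big(1-\varphi(t)^n-(1-\varphi(t))^n\big)\Big]\\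 &+\frac{1-c}{n^2}\Big[n(n-1)\varphi(t)^2-(n-p)^2\varphi(t)^n+n(1-2p)\varphi(t)+p^2-p^2(1-\varphi(t))^n\Big]\\ &+\frac{2c}n(p-p^2)\sum_{j=1}^{n-1}Q_{j,1}+\frac{2(1-c)}{n^2}\sum_{j=1}^{n-1}(j-p)Q_{j,1}\\ &+\Big(\frac cn(1-2p+2p^2)+\frac{1-c}{n^2}\Big)\sum_{j=1}^{n-1}Q_{j,2}\\ &+\varphi(t)^n-\frac{2p}n\int_0^{\varphi(t)}\frac{1-t}{1-\varphi^{-1}(v)}nv^{n-1}dv\\ &+p^2\Big(\frac cn+\frac{1-c}{n^2}\Big)\int_0^{\varphi(t)}\Big(\frac{1-t}{1-\varphi^{-1}(v)}\Big)^2nv^{n-1}dv-\mathcal E_n^{\mathrm{CDF}}(t;p)^2.\end{aligned}$$ As $n\to\infty$, $\operatorname{Var}[w_n^{\mathrm{CDF}}(t;\theta,p)]-\frac{\varphi(t)(1-\varphi(t))}{1+\theta}=O(1/n)$; and if moreover $\|\varphi'\|_\infty<\infty$, then $\operatorname{Var}[w_n^{\mathrm{BK}}(t;\theta)]-\frac{\varphi(t)(1-\varphi(t))}{1+\theta}=O(1/n)$.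 -/

import Mathlib

open MeasureTheory ProbabilityTheory Set

noncomputable section

namespace Warping

/-- An absolutely continuous warping function: a (strictly) increasing continuous bijection of
`[0,1]` onto itself fixing `0` and `1`, and absolutely continuous on `[0,1]`. It is given by a
function on `ℝ` of which only the values on `[0,1]` matter. -/
structure IsACWarping (φ : ℝ → ℝ) : Prop where
  map_zero : φ 0 = 0
  map_one : φ 1 = 1
  strictMonoOn : StrictMonoOn φ (Icc 0 1)
  continuousOn : ContinuousOn φ (Icc 0 1)
  absolutelyContinuous : AbsolutelyContinuousOnInterval φ 0 1

/-- The supremum of the derivative of `φ`, over the points of `(0,1)` at which `φ` is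
differentiable, is finite. -/
def HasBoundedDeriv (φ : ℝ → ℝ) : Prop :=
  BddAbove (deriv φ '' {x | x ∈ Ioo (0 : ℝ) 1 ∧ DifferentiableAt ℝ φ x})

/-- The inverse `φ⁻¹ : [0,1] → [0,1]` of a warping function. -/
def warpInv (φ : ℝ → ℝ) : ℝ → ℝ := Function.invFunOn φ (Icc 0 1)

/-- The Dirichlet distribution with parameters `a i > 0`: the law of
`(G i / ∑ k, G k)_i`, where the `G i` are independent and `G i` is Gamma distributed with
shape `a i` and rate `1`. -/
def dirichlet {ι : Type*} [Fintype ι] (a : ι → ℝ) : Measure (ι → ℝ) :=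
  (Measure.pi fun i => gammaMeasure (a i) 1).map fun g i => g i / ∑ k, g k

/-- The sorted sample: the entries of `u` in nondecreasing order. -/
def sorted {n : ℕ} (u : Fin n → ℝ) : Fin n → ℝ := u ∘ Tuple.sort u

/-- From `s = (s₁, …, sₙ)` the sequence of knots `0, s₁, …, sₙ, 1` at the places `0, …, n + 1`. -/
def knots {n : ℕ} (s : Fin n → ℝ) (j : ℕ) : ℝ :=
  if j = 0 then 0 else if h : j - 1 < n then s ⟨j - 1, h⟩ else 1

/-- From `a = (a₁, …, aₘ)` the sequence with entry `a_j` at the places `1 ≤ j ≤ m`, and `0` at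
all other places. -/
def extendZero {m : ℕ} (a : Fin m → ℝ) (j : ℕ) : ℝ :=
  if j = 0 then 0 else if h : j - 1 < m then a ⟨j - 1, h⟩ else 0

/-- The path on `[0,1]` that interpolates linearly the points `(x_j, c_0 + ⋯ + c_j)`,
`j = 0, …, n + 1`, with `x_0 = 0` and `x_{n+1} = 1`; its value at `1` is `1`. -/
def interpolate (n : ℕ) (x c : ℕ → ℝ) (t : ℝ) : ℝ :=
  if t = 1 then 1 else
    ∑ j ∈ Finset.range (n + 1),
      (Ico (x j) (x (j + 1))).indicator
        (fun r => (∑ i ∈ Finset.range (j + 1), c i)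
          + c (j + 1) * ((r - x j) / (x (j + 1) - x j))) t

/-! ### The BK process -/

/-- The Dirichlet parameters `θ (φ(U*_j) - φ(U*_{j-1}))`, `j = 1, …, n + 1`, as a function of the
sorted sample `s = (U*_1, …, U*_n)`. -/
def bkParam {n : ℕ} (θ : ℝ) (φ : ℝ → ℝ) (s : Fin n → ℝ) (i : Fin (n + 1)) : ℝ :=
  θ * (φ (knots s ((i : ℕ) + 1)) - φ (knots s (i : ℕ)))

/-- The random input of the BK algorithm: `U` is a sample of `n` independent uniform variables
on `[0,1]`, and the conditional law of `α = (α_1, …, α_{n+1})` given the sorted sample `U*` is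
the Dirichlet distribution with parameters `θ (φ(U*_j) - φ(U*_{j-1}))`. -/
structure IsBKSample {Ω : Type*} [MeasurableSpace Ω] (n : ℕ) (θ : ℝ) (φ : ℝ → ℝ)
    (U : Ω → Fin n → ℝ) (α : Ω → Fin (n + 1) → ℝ) (P : Measure Ω) [IsFiniteMeasure P] :
    Prop where
  measurable_U : Measurable U
  measurable_weights : Measurable α
  iIndep : iIndepFun (fun i ω => U ω i) P
  uniform : ∀ i, pdf.IsUniform (fun ω => U ω i) (Icc 0 1) P
  condLaw : ∀ᵐ s ∂(P.map fun ω => sorted (U ω)),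
    condDistrib α (fun ω => sorted (U ω)) P s = dirichlet (bkParam θ φ s)

/-- The BK process at time `t`, as a function of the sample `u` and the weights `a`. -/
def bkPath {n : ℕ} (u : Fin n → ℝ) (a : Fin (n + 1) → ℝ) (t : ℝ) : ℝ :=
  interpolate n (knots (sorted u)) (extendZero a) t

/-! ### The CDF process -/

/-- The random input of the CDF algorithm: `U` is a sample of `n` independent uniform variables
on `[0,1]`, and `β = (β_1, …, β_n)` is independent of the sorted sample and has the Dirichlet
distribution with parameters `(θ/n, …, θ/n)`. -/
structure IsCDFSample {Ω : Type*} [MeasurableSpace Ω] (n : ℕ) (θ : ℝ)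
    (U : Ω → Fin n → ℝ) (β : Ω → Fin n → ℝ) (P : Measure Ω) : Prop where
  measurable_U : Measurable U
  measurable_weights : Measurable β
  iIndep : iIndepFun (fun i ω => U ω i) P
  uniform : ∀ i, pdf.IsUniform (fun ω => U ω i) (Icc 0 1) P
  law : P.map β = dirichlet fun _ : Fin n => θ / n
  indep : IndepFun (fun ω => sorted (U ω)) β P

/-- The increments `γ_j = (1 - p) β_j + p β_{j-1}`, `j = 0, …, n + 1`, where
`β_{-1} = β_0 = β_{n+1} = 0`. -/
def cdfIncrement {n : ℕ} (p : ℝ) (b : Fin n → ℝ) (j : ℕ) : ℝ :=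
  if j = 0 then 0 else (1 - p) * extendZero b j + p * extendZero b (j - 1)

/-- The CDF process at time `t`, as a function of the sample `u` and the weights `b`. -/
def cdfPath {n : ℕ} (φ : ℝ → ℝ) (p : ℝ) (u b : Fin n → ℝ) (t : ℝ) : ℝ :=
  interpolate n (fun j => warpInv φ (knots (sorted u) j)) (cdfIncrement p b) t

/-! ### The closed forms -/

/-- The joint density of `(U*_j, U*_{j+1})` at `u < v`, for `1 ≤ j ≤ n - 1`. -/
def pairDensity (n j : ℕ) (u v : ℝ) : ℝ :=
  (n.factorial : ℝ) / ((j - 1).factorial * (n - j - 1).factorial)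
    * u ^ (j - 1) * (1 - v) ^ (n - j - 1)

/-- The closed form of the mean of the BK process. -/
def bkMean (n : ℕ) (φ : ℝ → ℝ) (t : ℝ) : ℝ :=
  (∫ u in t..1, t / u * φ u * (n * (1 - u) ^ (n - 1)))
  + (∑ j ∈ Finset.Icc 1 (n - 1), ∫ v in t..1, ∫ u in (0 : ℝ)..t,
      (φ u + (t - u) / (v - u) * (φ v - φ u)) * pairDensity n j u v)
  + (∫ v in (0 : ℝ)..t, (1 - (1 - φ v) * ((1 - t) / (1 - v))) * (n * v ^ (n - 1)))

/-- The closed form of the variance of the BK process. -/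
def bkVar (n : ℕ) (φ : ℝ → ℝ) (θ t : ℝ) : ℝ :=
  1 / (1 + θ) * (∫ u in t..1, (t / u) ^ 2 * φ u * (n * (1 - u) ^ (n - 1)))
  + (1 - 1 / (1 + θ)) * (∫ u in t..1, (t / u) ^ 2 * φ u ^ 2 * (n * (1 - u) ^ (n - 1)))
  + 1 / (1 + θ) * (∑ j ∈ Finset.Icc 1 (n - 1), ∫ v in t..1, ∫ u in (0 : ℝ)..t,
      φ u * pairDensity n j u v)
  + (1 - 1 / (1 + θ)) * (∑ j ∈ Finset.Icc 1 (n - 1), ∫ v in t..1, ∫ u in (0 : ℝ)..t,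
      φ u ^ 2 * pairDensity n j u v)
  + 2 * (1 - 1 / (1 + θ)) * (∑ j ∈ Finset.Icc 1 (n - 1), ∫ v in t..1, ∫ u in (0 : ℝ)..t,
      (t - u) / (v - u) * (φ v - φ u) * φ u * pairDensity n j u v)
  + 1 / (1 + θ) * (∑ j ∈ Finset.Icc 1 (n - 1), ∫ v in t..1, ∫ u in (0 : ℝ)..t,
      (φ v - φ u) * ((t - u) / (v - u)) ^ 2 * pairDensity n j u v)
  + (1 - 1 / (1 + θ)) * (∑ j ∈ Finset.Icc 1 (n - 1), ∫ v in t..1, ∫ u in (0 : ℝ)..t,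
      (φ v - φ u) ^ 2 * ((t - u) / (v - u)) ^ 2 * pairDensity n j u v)
  + t ^ n
  - 2 * (∫ v in (0 : ℝ)..t, (1 - t) / (1 - v) * (1 - φ v) * (n * v ^ (n - 1)))
  + 1 / (1 + θ)
    * (∫ v in (0 : ℝ)..t, ((1 - t) / (1 - v)) ^ 2 * (1 - φ v) * (n * v ^ (n - 1)))
  + (1 - 1 / (1 + θ))
    * (∫ v in (0 : ℝ)..t, ((1 - t) / (1 - v)) ^ 2 * (1 - φ v) ^ 2 * (n * v ^ (n - 1)))
  - bkMean n φ t ^ 2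

/-- The integral of the `k`-th power of the interpolation ratio of the CDF process on the event
that `t` lies in the `j`-th interval, for `1 ≤ j ≤ n - 1`. -/
def cdfRatio (n : ℕ) (φ : ℝ → ℝ) (t : ℝ) (j k : ℕ) : ℝ :=
  ∫ u in (0 : ℝ)..φ t, ∫ v in φ t..1,
    ((t - warpInv φ u) / (warpInv φ v - warpInv φ u)) ^ k * pairDensity n j u v

/-- The closed form of the mean of the CDF process. -/
def cdfMean (n : ℕ) (φ : ℝ → ℝ) (p t : ℝ) : ℝ :=
  (1 - p) / n * (∫ u in φ t..1, t / warpInv φ u * (n * (1 - u) ^ (n - 1)))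
  + 1 / n * (n * φ t - n * φ t ^ n - p * (1 - φ t ^ n - (1 - φ t) ^ n))
  + 1 / n * (∑ j ∈ Finset.Icc 1 (n - 1), cdfRatio n φ t j 1)
  + (∫ v in (0 : ℝ)..φ t, (1 - p / n * ((1 - t) / (1 - warpInv φ v))) * (n * v ^ (n - 1)))

/-- The closed form of the variance of the CDF process. -/
def cdfVar (n : ℕ) (φ : ℝ → ℝ) (θ p t : ℝ) : ℝ :=
  (1 - p) ^ 2 * (1 / n) * (1 / (1 + θ))
    * (∫ u in φ t..1, t ^ 2 / warpInv φ u ^ 2 * (n * (1 - u) ^ (n - 1)))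
  + ((1 - p) / n) ^ 2 * (1 - 1 / (1 + θ))
    * (∫ u in φ t..1, t ^ 2 / warpInv φ u ^ 2 * (n * (1 - u) ^ (n - 1)))
  + 1 / n * (1 / (1 + θ))
    * (n * φ t - n * φ t ^ n - (2 * p - p ^ 2) * (1 - φ t ^ n - (1 - φ t) ^ n))
  + 1 / n ^ 2 * (1 - 1 / (1 + θ))
    * (n * (n - 1) * φ t ^ 2 - (n - p) ^ 2 * φ t ^ n + n * (1 - 2 * p) * φ t
      + p ^ 2 - p ^ 2 * (1 - φ t) ^ n)
  + 2 * (1 / n) * (1 / (1 + θ)) * (p - p ^ 2)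
    * (∑ j ∈ Finset.Icc 1 (n - 1), cdfRatio n φ t j 1)
  + 2 * (1 / n ^ 2) * (1 - 1 / (1 + θ))
    * (∑ j ∈ Finset.Icc 1 (n - 1), ((j : ℝ) - p) * cdfRatio n φ t j 1)
  + 1 / n * (1 / (1 + θ)) * (1 - 2 * p + 2 * p ^ 2)
    * (∑ j ∈ Finset.Icc 1 (n - 1), cdfRatio n φ t j 2)
  + 1 / n ^ 2 * (1 - 1 / (1 + θ))
    * (∑ j ∈ Finset.Icc 1 (n - 1), cdfRatio n φ t j 2)
  + φ t ^ n
  - 2 * p * (1 / n)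
    * (∫ v in (0 : ℝ)..φ t, (1 - t) / (1 - warpInv φ v) * (n * v ^ (n - 1)))
  + p ^ 2 * (1 / n * (1 / (1 + θ)) + 1 / n ^ 2 * (1 - 1 / (1 + θ)))
    * (∫ v in (0 : ℝ)..φ t, ((1 - t) / (1 - warpInv φ v)) ^ 2 * (n * v ^ (n - 1)))
  - cdfMean n φ p t ^ 2

end Warping

end

noncomputable section

namespace Warping

/-! ### Moments of the Dirichlet distribution -/

/-! Fix the sorted sample. The path value at `t` is then a linear form `∑ w i * x i` in a Dirichlet
vector with parameters `θ * μ i`, `∑ μ i = 1`. The coefficients `w` depend only on the index `j` of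
the knot interval around `t` and on its end points `u`, `v`. The mean of such a form is `M = ∑ w i *
μ i`, and its second moment is `c * N + (1 - c) * M ^ 2` with `N = ∑ w i ^ 2 * μ i` and `c = 1 / (1
+ θ)` (`integral_linear_sq_dirichlet`). For BK the `μ i` are increments of `φ` between knots, so `M`
and `N` telescope to functions of `u` and `v`. For CDF `μ i = 1 / n`, and they are functions of `j`
and of the interpolation ratio.

It remains to average over the sample. Let `τ = t` for BK and `τ = φ t` for CDF, since `t` lies
between two points `φ⁻¹(U*)` exactly when `φ t` lies between the points `U*`. Suppose that `j`
sample points lie in `[0, τ]` and the others beyond. Up to the factor `n.choose j`, the joint law of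
the largest of the former and the smallest of the latter is then a product measure
(`map_knots_restrict_straddle`). Hence each moment is a sum over `j`, called `knotMean`. Its terms
with `1 ≤ j ≤ n - 1` are double integrals against `pairDensity`; in its two end terms one knot is
fixed at `0` or at `1`. Expanding the integrands gives the closed forms.

The rates are read off the same sums (`abs_knotMean_sub_countMean_le`). For BK, `M`, `N` and `φ t`
all lie in `[φ u, φ v]`. If the derivative is bounded, absolute continuity bounds the length of this
interval by `L * (v - u)`, and the mean gap is at most `2 / (n + 1)`. For CDF, `M` and `N` are
within `1 / n` of `j / n`, where `j` is binomial with parameters `n` and `φ t`; no regularity of `φ`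
is used. With `a = φ t` the second moment tends to `c * a + (1 - c) * a ^ 2`, and subtracting `a ^
2` leaves `c * a * (1 - a)`. -/

lemma integrable_and_integral_pow_mul_exp_gammaMeasure {a l : ℝ} (ha : 0 < a) (hl : 0 ≤ l)
    (m : ℕ) :
    Integrable (fun x : ℝ => x ^ m * Real.exp (-(l * x))) (gammaMeasure a 1) ∧
    ∫ x, x ^ m * Real.exp (-(l * x)) ∂(gammaMeasure a 1)
      = Real.Gamma (a + m) / Real.Gamma a * (1 / (1 + l)) ^ (a + m) := by
  have hΓ := Real.Gamma_pos_of_pos ha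
  have ham : 0 < a + m := by positivity
  have hmeas : Measurable (gammaPDF a 1) :=
    (measurable_gammaPDFReal a 1).ennreal_ofReal
  have hfin : ∀ᵐ x : ℝ, gammaPDF a 1 x < ⊤ := by
    filter_upwards with x
    simp [gammaPDF]
  -- The factor `exp (-(l * x))` only changes the rate of the Gamma density from `1` to `1 + l`. The
  -- null point `0` is discarded because `Real.rpow_add` needs a positive base.
  have heq : (fun x : ℝ => (gammaPDF a 1 x).toReal • (x ^ m * Real.exp (-(l * x))))
      =ᵐ[volume] (Ioi (0 : ℝ)).indicator
        (fun x => 1 / Real.Gamma a * (x ^ (a + m - 1) * Real.exp (-((1 + l) * x)))) := by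
    have h0 : ∀ᵐ x : ℝ, x ≠ 0 := by simp [ae_iff]
    filter_upwards [h0] with x hx
    rcases lt_or_gt_of_ne hx with h | h
    · rw [gammaPDF_of_neg h, indicator_of_notMem (by simp [h.le])]
      simp
    · rw [gammaPDF_of_nonneg h.le, indicator_of_mem (by simpa using h),
        ENNReal.toReal_ofReal (by positivity), smul_eq_mul]
      have e1 : a + m - 1 = (a - 1) + m := by ring
      have e2 : -((1 + l) * x) = -(1 * x) + -(l * x) := by ring
      rw [e1, Real.rpow_add h, Real.rpow_natCast, e2, Real.exp_add, Real.one_rpow]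
      ring
  have hint : Integrable ((Ioi (0 : ℝ)).indicator
        (fun x => 1 / Real.Gamma a * (x ^ (a + m - 1) * Real.exp (-((1 + l) * x))))) := by
    rw [integrable_indicator_iff measurableSet_Ioi]
    apply Integrable.const_mul
    have := integrableOn_rpow_mul_exp_neg_mul_rpow (p := 1) (s := a + m - 1) (b := 1 + l)
      (by linarith [(Nat.cast_nonneg m : (0:ℝ) ≤ m)]) one_pos (by linarith)
    simp only [Real.rpow_one, neg_mul] at this
    exact this
  constructor
  · rw [gammaMeasure, integrable_withDensity_iff_integrable_smul' hmeas hfin]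
    exact hint.congr heq.symm
  · rw [gammaMeasure, integral_withDensity_eq_integral_toReal_smul hmeas hfin,
      integral_congr_ae heq, integral_indicator measurableSet_Ioi, integral_const_mul,
      Real.integral_rpow_mul_exp_neg_mul_Ioi ham (by linarith)]
    ring

variable {ι : Type*} [Fintype ι]

lemma ae_pos_pi_gammaMeasure {a : ι → ℝ} (ha : ∀ i, 0 < a i) :
    ∀ᵐ g ∂(Measure.pi fun i => gammaMeasure (a i) 1), ∀ i, 0 < g i := by
  have hprob : ∀ i, IsProbabilityMeasure (gammaMeasure (a i) 1) :=
    fun i => isProbabilityMeasure_gammaMeasure (ha i) one_pos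
  rw [ae_all_iff]
  intro i
  have : ∀ᵐ x ∂(gammaMeasure (a i) 1), 0 < x := by
    rw [ae_iff, gammaMeasure, withDensity_apply _ (by measurability)]
    simp only [not_lt]
    change ∫⁻ y in Iic (0 : ℝ), gammaPDF (a i) 1 y = 0
    rw [← restrict_Iio_eq_restrict_Iic]
    exact lintegral_gammaPDF_of_nonpos (a := a i) (r := 1) (x := 0) le_rfl
  exact (Measure.tendsto_eval_ae_ae (i := i)).eventually this

/-- Monomial and exponential both factor over the independent coordinates. The power of `1 / (1 +
l)` depends on `m` only through its total degree. -/
lemma lintegral_prod_pow_mul_exp {a : ι → ℝ} (ha : ∀ i, 0 < a i) {l : ℝ} (hl : 0 ≤ l)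
    (m : ι → ℕ) :
    ∫⁻ g : ι → ℝ, ENNReal.ofReal ((∏ i, g i ^ m i) * Real.exp (-(l * ∑ i, g i)))
        ∂(Measure.pi fun i => gammaMeasure (a i) 1)
      = ENNReal.ofReal ((∏ i, Real.Gamma (a i + m i) / Real.Gamma (a i))
          * (1 / (1 + l)) ^ (∑ i, a i + ∑ i, (m i : ℝ))) := by
  have hprob : ∀ i, IsProbabilityMeasure (gammaMeasure (a i) 1) :=
    fun i => isProbabilityMeasure_gammaMeasure (ha i) one_pos
  have hfun : (fun g : ι → ℝ => (∏ i, g i ^ m i) * Real.exp (-(l * ∑ i, g i)))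
      = fun g => ∏ i, (g i ^ m i * Real.exp (-(l * g i))) := by
    ext g
    rw [Finset.prod_mul_distrib, ← Real.exp_sum, Finset.sum_neg_distrib, Finset.mul_sum]
  have hpos := ae_pos_pi_gammaMeasure ha
  rw [← ofReal_integral_eq_lintegral_ofReal]
  · congr 1
    rw [hfun, integral_fintype_prod_eq_prod (fun i x => x ^ m i * Real.exp (-(l * x)))]
    simp_rw [fun i => (integrable_and_integral_pow_mul_exp_gammaMeasure (ha i) hl (m i)).2]
    rw [Finset.prod_mul_distrib, ← Real.rpow_sum_of_pos (by positivity), Finset.sum_add_distrib]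
  · rw [hfun]
    exact Integrable.fintype_prod_dep (f := fun i x => x ^ m i * Real.exp (-(l * x)))
      fun i => (integrable_and_integral_pow_mul_exp_gammaMeasure (ha i) hl (m i)).1
  · filter_upwards [hpos] with g hg
    have := Finset.prod_nonneg (s := Finset.univ) fun i _ => pow_nonneg (hg i).le (m i)
    exact mul_nonneg this (Real.exp_pos _).le


/-- The mixed moments of a Dirichlet vector, up to a factor that depends only on the order of the
moment. -/
lemma exists_lintegral_prod_pow_dirichlet [Nonempty ι] {a : ι → ℝ} (ha : ∀ i, 0 < a i) {k : ℕ}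
    (hk : 0 < k) :
    ∃ K : ENNReal, ∀ m : ι → ℕ, ∑ i, m i = k →
      ∫⁻ x, ENNReal.ofReal (∏ i, x i ^ m i) ∂(dirichlet a)
        = ENNReal.ofReal (∏ i, Real.Gamma (a i + m i) / Real.Gamma (a i)) * K := by
  have hprob : ∀ i, IsProbabilityMeasure (gammaMeasure (a i) 1) :=
    fun i => isProbabilityMeasure_gammaMeasure (ha i) one_pos
  have hΓ : 0 < Real.Gamma k := Real.Gamma_pos_of_pos (by exact_mod_cast hk)
  refine ⟨∫⁻ l in Ioi (0 : ℝ), ENNReal.ofReal (1 / Real.Gamma k * l ^ ((k : ℝ) - 1)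
    * (1 / (1 + l)) ^ (∑ i, a i + (k : ℝ))), fun m hm => ?_⟩
  have hm' : ∑ i, (m i : ℝ) = k := by exact_mod_cast hm
  have hC : 0 ≤ ∏ i, Real.Gamma (a i + m i) / Real.Gamma (a i) :=
    Finset.prod_nonneg fun i _ => div_nonneg
      (Real.Gamma_pos_of_pos (by have := ha i; positivity)).le (Real.Gamma_pos_of_pos (ha i)).le
  rw [dirichlet, lintegral_map (by fun_prop) (by fun_prop)]
  -- The denominator `S ^ k`, with `S = ∑ g j`, is removed by Euler's integral `S ^ (-k) = Γ(k)⁻¹ ∫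
  -- l ^ (k - 1) exp (-l S) dl`. After Tonelli the inner integral is a product, and the remaining
  -- integral over `l` is the common constant `K`.
  have h1 : ∀ᵐ g ∂(Measure.pi fun i => gammaMeasure (a i) 1),
      ENNReal.ofReal (∏ i, (g i / ∑ j, g j) ^ m i)
        = ∫⁻ l in Ioi (0 : ℝ), ENNReal.ofReal (1 / Real.Gamma k * l ^ ((k : ℝ) - 1)) *
            ENNReal.ofReal ((∏ i, g i ^ m i) * Real.exp (-(l * ∑ i, g i))) := by
    filter_upwards [ae_pos_pi_gammaMeasure ha] with g hg
    have hS : 0 < ∑ i, g i := Finset.sum_pos (fun i _ => hg i) Finset.univ_nonempty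
    have hP : 0 ≤ ∏ i, g i ^ m i := Finset.prod_nonneg fun i _ => pow_nonneg (hg i).le _
    have h2 : ∫ l in Ioi (0 : ℝ), (1 / Real.Gamma k * (∏ i, g i ^ m i)) *
        (l ^ ((k : ℝ) - 1) * Real.exp (-((∑ i, g i) * l))) = ∏ i, (g i / ∑ j, g j) ^ m i := by
      rw [integral_const_mul, Real.integral_rpow_mul_exp_neg_mul_Ioi (by exact_mod_cast hk) hS]
      simp_rw [div_pow]
      rw [Finset.prod_div_distrib, Finset.prod_pow_eq_pow_sum, hm, Real.rpow_natCast]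
      rw [one_div_pow]
      field_simp
    rw [← h2, ofReal_integral_eq_lintegral_ofReal]
    · refine setLIntegral_congr_fun measurableSet_Ioi fun l hl => ?_
      have : 0 ≤ l ^ ((k : ℝ) - 1) := Real.rpow_nonneg (le_of_lt hl) _
      rw [← ENNReal.ofReal_mul (by positivity), mul_comm l]
      congr 1
      ring
    · apply Integrable.const_mul
      have := integrableOn_rpow_mul_exp_neg_mul_rpow (p := 1) (s := (k : ℝ) - 1) (b := ∑ i, g i)
        (by linarith [(Nat.cast_pos.2 hk : (0:ℝ) < k)]) one_pos hS
      simp only [Real.rpow_one, neg_mul] at this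
      exact this
    · filter_upwards [ae_restrict_mem measurableSet_Ioi] with l hl
      have : 0 ≤ l ^ ((k : ℝ) - 1) := Real.rpow_nonneg (le_of_lt hl) _
      positivity
  rw [lintegral_congr_ae h1, lintegral_lintegral_swap (by fun_prop),
    ← lintegral_const_mul' _ _ ENNReal.ofReal_ne_top]
  refine setLIntegral_congr_fun measurableSet_Ioi fun l hl => ?_
  have : 0 ≤ l ^ ((k : ℝ) - 1) := Real.rpow_nonneg (le_of_lt hl) _
  rw [lintegral_const_mul' _ _ ENNReal.ofReal_ne_top,
    lintegral_prod_pow_mul_exp ha (le_of_lt hl), hm', ← ENNReal.ofReal_mul (by positivity),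
    ← ENNReal.ofReal_mul hC]
  congr 1
  ring

lemma ae_mem_stdSimplex_dirichlet [Nonempty ι] {a : ι → ℝ} (ha : ∀ i, 0 < a i) :
    ∀ᵐ x ∂(dirichlet a), (∀ i, 0 ≤ x i) ∧ ∑ i, x i = 1 := by
  rw [dirichlet, ae_map_iff (by fun_prop) (by measurability)]
  filter_upwards [ae_pos_pi_gammaMeasure ha] with g hg
  have hS : 0 < ∑ i, g i := Finset.sum_pos (fun i _ => hg i) Finset.univ_nonempty
  refine ⟨fun i => div_nonneg (hg i).le hS.le, ?_⟩
  rw [← Finset.sum_div, div_self hS.ne']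

lemma isProbabilityMeasure_dirichlet {a : ι → ℝ} (ha : ∀ i, 0 < a i) :
    IsProbabilityMeasure (dirichlet a) := by
  have hprob : ∀ i, IsProbabilityMeasure (gammaMeasure (a i) 1) :=
    fun i => isProbabilityMeasure_gammaMeasure (ha i) one_pos
  exact Measure.isProbabilityMeasure_map (by fun_prop)

section Moments

variable {θ : ℝ} {μ : ι → ℝ}

/-- The ratios of Gamma values come from `Γ(x + 1) = x Γ(x)`; the extra `1` for `i = k` is that of
`Γ(x + 2) = (x + 1) x Γ(x)`. -/
lemma integral_mul_eq_of_dirichlet (hθ : 0 < θ) (hμ : ∀ i, 0 < μ i) (hsum : ∑ i, μ i = 1)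
    (i k : ι) [DecidableEq ι] :
    ∫ x, x i * x k ∂(dirichlet fun i => θ * μ i)
      = μ i * (θ * μ k + if i = k then 1 else 0) / (θ + 1) := by
  have ha : ∀ i, 0 < θ * μ i := fun i => mul_pos hθ (hμ i)
  have : Nonempty ι := ⟨i⟩
  have := isProbabilityMeasure_dirichlet ha
  obtain ⟨K, hK⟩ := exists_lintegral_prod_pow_dirichlet ha (k := 2) two_pos
  have key : ∀ i k : ι, ∫⁻ x, ENNReal.ofReal (x i * x k) ∂(dirichlet fun i => θ * μ i)
      = ENNReal.ofReal (θ * μ i * (θ * μ k + if i = k then 1 else 0)) * K := by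
    intro i k
    have h := hK (Pi.single i 1 + Pi.single k 1) (by simp [Finset.sum_add_distrib])
    have e1 : ∀ x : ι → ℝ, ∏ l, x l ^ (Pi.single i 1 + Pi.single k 1 : ι → ℕ) l = x i * x k := by
      intro x
      simp only [Pi.add_apply, pow_add, Finset.prod_mul_distrib]
      simp [Pi.single_apply, pow_ite]
    have e2 : ∏ l, Real.Gamma (θ * μ l + ((Pi.single i 1 + Pi.single k 1 : ι → ℕ) l : ℕ))
        / Real.Gamma (θ * μ l) = θ * μ i * (θ * μ k + if i = k then 1 else 0) := by
      have hΓ : ∀ l, Real.Gamma (θ * μ l) ≠ 0 := fun l => (Real.Gamma_pos_of_pos (ha l)).ne'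
      have hG : ∀ l, Real.Gamma (θ * μ l + 1) / Real.Gamma (θ * μ l) = θ * μ l := fun l => by
        rw [Real.Gamma_add_one (ha l).ne', mul_div_cancel_right₀ _ (hΓ l)]
      by_cases hik : i = k
      · subst hik
        rw [Finset.prod_eq_single i]
        · have : θ * μ i + 2 = θ * μ i + 1 + 1 := by ring
          simp only [Pi.add_apply, Pi.single_eq_same, Nat.reduceAdd, Nat.cast_ofNat, if_true]
          rw [this, Real.Gamma_add_one (by have := ha i; positivity), mul_div_assoc, hG]
          ring
        · intro l _ hl
          simp [hl, div_self (hΓ l)]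
        · simp
      · rw [Finset.prod_eq_mul i k hik]
        · simp [hG, hik]
        · intro l _ hl
          simp [hl.1, hl.2, div_self (hΓ l)]
        · simp
        · simp
    rw [e2] at h
    rw [← h]
    simp_rw [e1]
  have hmean := ae_mem_stdSimplex_dirichlet ha
  -- The constant `K` needs no Beta integral: the products `x i * x k` sum to `(∑ x i) ^ 2 = 1`,
  -- which fixes it.
  have htot : ENNReal.ofReal (θ * (θ + 1)) * K = 1 := by
    have h1 : ∑ i, ∑ k, ∫⁻ x, ENNReal.ofReal (x i * x k) ∂(dirichlet fun i => θ * μ i) = 1 := by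
      have : ∀ i, ∑ k, ∫⁻ x, ENNReal.ofReal (x i * x k) ∂(dirichlet fun i => θ * μ i)
          = ∫⁻ x, ∑ k, ENNReal.ofReal (x i * x k) ∂(dirichlet fun i => θ * μ i) := fun i =>
        (lintegral_finsetSum _ (by fun_prop)).symm
      simp_rw [this]
      rw [← lintegral_finsetSum _ (by fun_prop)]
      have : ∀ᵐ x ∂(dirichlet fun i => θ * μ i),
          ∑ i, ∑ k, ENNReal.ofReal (x i * x k) = 1 := by
        filter_upwards [hmean] with x hx
        have : ∀ i, ∑ k, ENNReal.ofReal (x i * x k) = ENNReal.ofReal (∑ k, x i * x k) := fun i =>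
          (ENNReal.ofReal_sum_of_nonneg fun k _ => mul_nonneg (hx.1 i) (hx.1 k)).symm
        simp_rw [this]
        rw [← ENNReal.ofReal_sum_of_nonneg fun i _ =>
          Finset.sum_nonneg fun k _ => mul_nonneg (hx.1 i) (hx.1 k),
          ← Finset.sum_mul_sum, hx.2]
        simp
      rw [lintegral_congr_ae this]
      simp
    simp_rw [key] at h1
    simp_rw [← Finset.sum_mul] at h1
    rw [← h1]
    congr 1
    have hnn : ∀ i k : ι, 0 ≤ θ * μ i * (θ * μ k + if i = k then (1 : ℝ) else 0) := fun i k => by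
      have := ha i
      have := ha k
      positivity
    have : ∀ i, ∑ k, ENNReal.ofReal (θ * μ i * (θ * μ k + if i = k then 1 else 0))
        = ENNReal.ofReal (∑ k, θ * μ i * (θ * μ k + if i = k then 1 else 0)) := fun i =>
      (ENNReal.ofReal_sum_of_nonneg fun k _ => hnn i k).symm
    simp_rw [this]
    rw [← ENNReal.ofReal_sum_of_nonneg fun i _ => Finset.sum_nonneg fun k _ => hnn i k]
    congr 1
    simp only [← Finset.mul_sum, Finset.sum_add_distrib, hsum, Finset.sum_ite_eq,
      Finset.mem_univ, if_true, ← Finset.sum_mul]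
    ring
  have hK1 : K = ENNReal.ofReal (1 / (θ * (θ + 1))) := by
    rw [one_div, ENNReal.ofReal_inv_of_pos (by positivity)]
    exact ENNReal.eq_inv_of_mul_eq_one_left (by rw [mul_comm]; exact htot)
  rw [integral_eq_lintegral_of_nonneg_ae _ (by fun_prop), key, hK1,
    ← ENNReal.ofReal_mul (by have := ha i; have := ha k; positivity), ENNReal.toReal_ofReal]
  · field_simp
  · have := ha i
    have := ha k
    positivity
  · filter_upwards [hmean] with x hx using mul_nonneg (hx.1 i) (hx.1 k)

/-- The law sits on the compact simplex, where a continuous function is bounded. -/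
lemma integrable_dirichlet_of_continuous (hθ : 0 < θ) (hμ : ∀ i, 0 < μ i) [Nonempty ι]
    {f : (ι → ℝ) → ℝ} (hf : Continuous f) : Integrable f (dirichlet fun i => θ * μ i) := by
  have ha : ∀ i, 0 < θ * μ i := fun i => mul_pos hθ (hμ i)
  have := isProbabilityMeasure_dirichlet ha
  obtain ⟨C, hC⟩ := (isCompact_stdSimplex ℝ ι).exists_bound_of_continuousOn hf.continuousOn
  refine Integrable.of_bound hf.aestronglyMeasurable C ?_
  filter_upwards [ae_mem_stdSimplex_dirichlet ha] with x hx using hC x hx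

lemma integral_apply_dirichlet (hθ : 0 < θ) (hμ : ∀ i, 0 < μ i) (hsum : ∑ i, μ i = 1) (i : ι) :
    ∫ x, x i ∂(dirichlet fun i => θ * μ i) = μ i := by
  classical
  have ha : ∀ i, 0 < θ * μ i := fun i => mul_pos hθ (hμ i)
  have : Nonempty ι := ⟨i⟩
  -- First moments reduce to second moments through `x i = ∑ k, x i * x k` on the simplex.
  have h : ∫ x, x i ∂(dirichlet fun i => θ * μ i)
      = ∫ x, ∑ k, x i * x k ∂(dirichlet fun i => θ * μ i) := by
    refine integral_congr_ae ?_
    filter_upwards [ae_mem_stdSimplex_dirichlet ha] with x hx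
    rw [← Finset.mul_sum, hx.2, mul_one]
  rw [h, integral_finsetSum _ fun k _ => integrable_dirichlet_of_continuous hθ hμ (by fun_prop)]
  simp_rw [integral_mul_eq_of_dirichlet hθ hμ hsum]
  rw [← Finset.sum_div, ← Finset.mul_sum, Finset.sum_add_distrib, ← Finset.mul_sum, hsum]
  simp only [Finset.sum_ite_eq, Finset.mem_univ, if_true, mul_one]
  field_simp

lemma integral_linear_dirichlet (hθ : 0 < θ) (hμ : ∀ i, 0 < μ i) (hsum : ∑ i, μ i = 1)
    (w : ι → ℝ) : ∫ x, ∑ i, w i * x i ∂(dirichlet fun i => θ * μ i) = ∑ i, w i * μ i := by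
  have hne : Nonempty ι := by
    by_contra h
    rw [not_nonempty_iff] at h
    simp at hsum
  rw [integral_finsetSum _ fun k _ => integrable_dirichlet_of_continuous hθ hμ (by fun_prop)]
  simp_rw [integral_const_mul, integral_apply_dirichlet hθ hμ hsum]

/-- In the double sum the diagonal correction has weight `1 / (1 + θ)` and yields `∑ w i ^ 2 * μ i`.
The product part has weight `θ / (1 + θ)` and yields the squared mean. -/
lemma integral_linear_sq_dirichlet (hθ : 0 < θ) (hμ : ∀ i, 0 < μ i) (hsum : ∑ i, μ i = 1)
    (w : ι → ℝ) : ∫ x, (∑ i, w i * x i) ^ 2 ∂(dirichlet fun i => θ * μ i)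
      = 1 / (1 + θ) * ∑ i, w i ^ 2 * μ i + (1 - 1 / (1 + θ)) * (∑ i, w i * μ i) ^ 2 := by
  classical
  have hne : Nonempty ι := by
    by_contra h
    rw [not_nonempty_iff] at h
    simp at hsum
  have hexp : ∀ x : ι → ℝ, (∑ i, w i * x i) ^ 2 = ∑ i, ∑ k, w i * w k * (x i * x k) := by
    intro x
    rw [sq, Finset.sum_mul_sum]
    exact Finset.sum_congr rfl fun i _ => Finset.sum_congr rfl fun k _ => by ring
  rw [integral_congr_ae (Filter.Eventually.of_forall hexp)]
  rw [integral_finsetSum _ fun k _ => integrable_dirichlet_of_continuous hθ hμ (by fun_prop)]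
  have hM : ∑ k, w k * (θ * μ k) = θ * ∑ k, w k * μ k := by
    rw [Finset.mul_sum]
    exact Finset.sum_congr rfl fun k _ => by ring
  have : ∀ i, ∫ x, ∑ k, w i * w k * (x i * x k) ∂(dirichlet fun i => θ * μ i)
      = 1 / (1 + θ) * (w i ^ 2 * μ i)
        + (1 - 1 / (1 + θ)) * (∑ k, w k * μ k) * (w i * μ i) := by
    intro i
    rw [integral_finsetSum _ fun k _ => integrable_dirichlet_of_continuous hθ hμ (by fun_prop)]
    simp_rw [integral_const_mul, integral_mul_eq_of_dirichlet hθ hμ hsum]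
    have h2 : ∀ k, w i * w k * (μ i * (θ * μ k + if i = k then 1 else 0) / (θ + 1))
        = w i * μ i / (θ + 1) * (w k * (θ * μ k) + if i = k then w k else 0) := fun k => by
      split_ifs <;> ring
    simp_rw [h2]
    rw [← Finset.mul_sum, Finset.sum_add_distrib, hM, Finset.sum_ite_eq, if_pos (Finset.mem_univ i)]
    field_simp
    ring
  simp_rw [this]
  rw [Finset.sum_add_distrib, ← Finset.mul_sum, ← Finset.mul_sum]
  ring

end Moments

/-! ### The knots around a fixed time -/

/-- On `(-∞, τ]`, the law of the largest of `j` independent uniform variables (of `0` if `j = 0`). -/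
def lowLaw (τ : ℝ) (j : ℕ) : Measure ℝ :=
  if j = 0 then Measure.dirac 0 else
    (volume.restrict (Ioc 0 τ)).withDensity fun u => ENNReal.ofReal (j * u ^ (j - 1))

/-- On `(τ, ∞)`, the law of the smallest of `k` independent uniform variables (of `1` if
`k = 0`). -/
def highLaw (τ : ℝ) (k : ℕ) : Measure ℝ :=
  if k = 0 then Measure.dirac 1 else
    (volume.restrict (Ioc τ 1)).withDensity fun v => ENNReal.ofReal (k * (1 - v) ^ (k - 1))

lemma lowLaw_zero (τ : ℝ) : lowLaw τ 0 = Measure.dirac 0 := if_pos rfl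

lemma highLaw_zero (τ : ℝ) : highLaw τ 0 = Measure.dirac 1 := if_pos rfl

lemma integral_lowLaw {τ : ℝ} (hτ : 0 ≤ τ) {j : ℕ} (hj : j ≠ 0) (f : ℝ → ℝ) :
    ∫ u, f u ∂(lowLaw τ j) = ∫ u in (0 : ℝ)..τ, f u * (j * u ^ (j - 1)) := by
  rw [lowLaw, if_neg hj, integral_withDensity_eq_integral_toReal_smul (by fun_prop)
    (Filter.Eventually.of_forall fun _ => ENNReal.ofReal_lt_top),
    intervalIntegral.integral_of_le hτ]
  refine setIntegral_congr_fun measurableSet_Ioc fun u hu => ?_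
  have := hu.1.le
  simp only [smul_eq_mul]
  rw [ENNReal.toReal_ofReal (by positivity), mul_comm]

lemma integral_highLaw {τ : ℝ} (hτ : τ ≤ 1) {k : ℕ} (hk : k ≠ 0) (f : ℝ → ℝ) :
    ∫ v, f v ∂(highLaw τ k) = ∫ v in τ..1, f v * (k * (1 - v) ^ (k - 1)) := by
  rw [highLaw, if_neg hk, integral_withDensity_eq_integral_toReal_smul (by fun_prop)
    (Filter.Eventually.of_forall fun _ => ENNReal.ofReal_lt_top),
    intervalIntegral.integral_of_le hτ]
  refine setIntegral_congr_fun measurableSet_Ioc fun u hu => ?_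
  have : 0 ≤ 1 - u := sub_nonneg.2 hu.2
  simp only [smul_eq_mul]
  rw [ENNReal.toReal_ofReal (by positivity), mul_comm]

lemma ae_lowLaw {τ : ℝ} (hτ : 0 ≤ τ) (j : ℕ) : ∀ᵐ u ∂(lowLaw τ j), u ∈ Icc 0 τ := by
  unfold lowLaw
  split_ifs with h
  · rw [ae_dirac_eq]
    exact ⟨le_rfl, hτ⟩
  · refine (withDensity_absolutelyContinuous _ _).ae_le ?_
    filter_upwards [ae_restrict_mem measurableSet_Ioc] with u hu using Ioc_subset_Icc_self hu

lemma ae_highLaw {τ : ℝ} (hτ : τ < 1) (k : ℕ) : ∀ᵐ v ∂(highLaw τ k), v ∈ Ioc τ 1 := by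
  unfold highLaw
  split_ifs with h
  · rw [ae_dirac_eq]
    exact ⟨hτ, le_rfl⟩
  · refine (withDensity_absolutelyContinuous _ _).ae_le ?_
    exact ae_restrict_mem measurableSet_Ioc

lemma integral_mul_pow_pred {j : ℕ} (hj : j ≠ 0) (x : ℝ) :
    ∫ u in (0 : ℝ)..x, (j : ℝ) * u ^ (j - 1) = x ^ j := by
  rw [intervalIntegral.integral_eq_sub_of_hasDerivAt (fun u _ => hasDerivAt_pow j u)
    (Continuous.intervalIntegrable (by fun_prop) _ _)]
  simp [hj]

lemma integral_mul_one_sub_pow_pred {k : ℕ} (hk : k ≠ 0) (y : ℝ) :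
    ∫ v in y..1, (k : ℝ) * (1 - v) ^ (k - 1) = (1 - y) ^ k := by
  rw [intervalIntegral.integral_comp_sub_left (fun u => (k : ℝ) * u ^ (k - 1)) 1, sub_self,
    integral_mul_pow_pred hk]

/-- For `j = 0` the convention `x ^ 0 = 1` agrees with the Dirac mass at `0`, so later arguments
treat the boundary index like the others. The same holds for `highLaw_Ioi` and the mass at `1`. -/
lemma lowLaw_Iic {τ x : ℝ} (hx : 0 ≤ x) (hxτ : x ≤ τ) (j : ℕ) :
    lowLaw τ j (Iic x) = ENNReal.ofReal (x ^ j) := by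
  unfold lowLaw
  split_ifs with h
  · simp [h, hx]
  · rw [withDensity_apply _ measurableSet_Iic, Measure.restrict_restrict measurableSet_Iic,
      ← integral_mul_pow_pred h x, intervalIntegral.integral_of_le hx,
      ofReal_integral_eq_lintegral_ofReal]
    · congr 2
      ext u
      simp only [mem_inter_iff, mem_Iic, mem_Ioc]
      constructor
      · rintro ⟨h1, h2, h3⟩; exact ⟨h2, h1⟩
      · rintro ⟨h1, h2⟩; exact ⟨h2, h1, h2.trans hxτ⟩
    · exact (Continuous.intervalIntegrable (by fun_prop) 0 x).1
    · filter_upwards [ae_restrict_mem measurableSet_Ioc] with u hu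
      have := hu.1.le
      positivity

lemma highLaw_Ioi {τ y : ℝ} (hy : y < 1) (hyτ : τ ≤ y) (k : ℕ) :
    highLaw τ k (Ioi y) = ENNReal.ofReal ((1 - y) ^ k) := by
  unfold highLaw
  split_ifs with h
  · simp [h, hy]
  · rw [withDensity_apply _ measurableSet_Ioi, Measure.restrict_restrict measurableSet_Ioi,
      ← integral_mul_one_sub_pow_pred h y, intervalIntegral.integral_of_le hy.le,
      ofReal_integral_eq_lintegral_ofReal]
    · congr 2
      ext u
      simp only [mem_inter_iff, mem_Ioi, mem_Ioc]
      constructor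
      · rintro ⟨h1, h2, h3⟩; exact ⟨h1, h3⟩
      · rintro ⟨h1, h2⟩; exact ⟨h1, hyτ.trans_lt h1, h2⟩
    · exact (Continuous.intervalIntegrable (by fun_prop) y 1).1
    · filter_upwards [ae_restrict_mem measurableSet_Ioc] with u hu
      have : 0 ≤ 1 - u := sub_nonneg.2 hu.2
      positivity

lemma lowLaw_Iic_eq_min {τ : ℝ} (hτ : 0 ≤ τ) (x : ℝ) (j : ℕ) :
    lowLaw τ j (Iic x) = lowLaw τ j (Iic (min x τ)) := by
  refine measure_congr ?_
  filter_upwards [ae_lowLaw hτ j] with u hu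
  simp only [eq_iff_iff]
  exact ⟨fun h => le_min h hu.2, fun h => le_trans h (min_le_left _ _)⟩

lemma highLaw_Ioi_eq_max {τ : ℝ} (hτ : τ < 1) (y : ℝ) (k : ℕ) :
    highLaw τ k (Ioi y) = highLaw τ k (Ioi (max y τ)) := by
  refine measure_congr ?_
  filter_upwards [ae_highLaw hτ k] with u hu
  simp only [eq_iff_iff]
  exact ⟨fun h => max_lt h hu.1, fun h => lt_of_le_of_lt (le_max_left _ _) h⟩

lemma lowLaw_univ {τ : ℝ} (hτ : 0 ≤ τ) (j : ℕ) :
    lowLaw τ j univ = ENNReal.ofReal (τ ^ j) := by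
  rw [← lowLaw_Iic hτ le_rfl j]
  refine measure_congr ?_
  filter_upwards [ae_lowLaw hτ j] with u hu
  exact propext ⟨fun _ => hu.2, fun _ => trivial⟩

lemma highLaw_univ {τ : ℝ} (hτ : τ < 1) (k : ℕ) :
    highLaw τ k univ = ENNReal.ofReal ((1 - τ) ^ k) := by
  rw [← highLaw_Ioi hτ le_rfl k]
  refine measure_congr ?_
  filter_upwards [ae_highLaw hτ k] with u hu
  exact propext ⟨fun _ => hu.1, fun _ => trivial⟩

lemma isFiniteMeasure_lowLaw {τ : ℝ} (hτ : 0 ≤ τ) (j : ℕ) : IsFiniteMeasure (lowLaw τ j) :=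
  ⟨by rw [lowLaw_univ hτ]; exact ENNReal.ofReal_lt_top⟩

lemma isFiniteMeasure_highLaw {τ : ℝ} (hτ : τ < 1) (k : ℕ) : IsFiniteMeasure (highLaw τ k) :=
  ⟨by rw [highLaw_univ hτ]; exact ENNReal.ofReal_lt_top⟩

/-! ### Sorted samples -/

variable {n : ℕ}

lemma monotone_sorted (u : Fin n → ℝ) : Monotone (sorted u) := Tuple.monotone_sort u

lemma card_sorted_le (u : Fin n → ℝ) (a : ℝ) :
    (Finset.univ.filter fun i => sorted u i ≤ a).card
      = (Finset.univ.filter fun i => u i ≤ a).card := by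
  refine Finset.card_bij (fun i _ => Tuple.sort u i) ?_ ?_ ?_
  · intro i hi
    rw [Finset.mem_filter] at hi ⊢
    exact ⟨Finset.mem_univ _, hi.2⟩
  · intro i _ j _ h
    exact (Tuple.sort u).injective h
  · intro i hi
    refine ⟨(Tuple.sort u).symm i, ?_, by simp⟩
    rw [Finset.mem_filter] at hi ⊢
    exact ⟨Finset.mem_univ _, by simpa [sorted] using hi.2⟩

/-- The bridge from order statistics to counting: events about sorted values become events about how
many of the original independent values lie below a level. -/
lemma sorted_le_iff (u : Fin n → ℝ) (i : Fin n) (a : ℝ) :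
    sorted u i ≤ a ↔ (i : ℕ) < (Finset.univ.filter fun i => u i ≤ a).card := by
  rw [← card_sorted_le]
  exact (Tuple.lt_card_le_iff_apply_le_of_monotone (monotone_sorted u)).symm

/-- The sorting permutation varies with `u`, so measurability is checked on half-lines, where it
reduces to that of a count. -/
lemma measurable_sorted : Measurable (sorted : (Fin n → ℝ) → Fin n → ℝ) := by
  refine measurable_pi_lambda _ fun i => measurable_of_Iic fun a => ?_
  have : (fun u : Fin n → ℝ => sorted u i) ⁻¹' Iic a
      = (fun u : Fin n → ℝ => (Finset.univ.filter fun i => u i ≤ a).card) ⁻¹' Ioi (i : ℕ) := by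
    ext u
    exact sorted_le_iff u i a
  rw [this]
  have hc : Measurable fun u : Fin n → ℝ => (Finset.univ.filter fun i => u i ≤ a).card := by
    simp_rw [Finset.card_filter]
    exact Finset.measurable_sum _ fun i _ => Measurable.ite
      (measurableSet_le (measurable_pi_apply i) measurable_const) measurable_const measurable_const
  exact hc measurableSet_Ioi

lemma knots_zero (s : Fin n → ℝ) : knots s 0 = 0 := if_pos rfl

lemma knots_succ (s : Fin n → ℝ) (i : Fin n) : knots s (i + 1) = s i := by
  simp [knots]

lemma knots_last (s : Fin n → ℝ) : knots s (n + 1) = 1 := by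
  simp [knots]

lemma measurable_knots (j : ℕ) : Measurable fun s : Fin n → ℝ => knots s j := by
  unfold knots
  split_ifs <;> fun_prop

lemma monotone_knots {s : Fin n → ℝ} (hs : Monotone s) (h01 : ∀ i, s i ∈ Icc (0 : ℝ) 1) :
    Monotone (knots s) := by
  refine monotone_nat_of_le_succ fun j => ?_
  unfold knots
  rcases j with _ | j
  · simp only [if_true, zero_add, one_ne_zero, if_false]
    split_ifs
    · exact (h01 _).1
    · exact zero_le_one
  · simp only [Nat.add_eq_zero_iff, one_ne_zero, and_false, if_false, add_tsub_cancel_right]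
    split_ifs with h1 h2
    · exact hs (by simp)
    · exact (h01 _).2
    · omega
    · exact le_rfl

lemma knots_mem_Icc {s : Fin n → ℝ} (h01 : ∀ i, s i ∈ Icc (0 : ℝ) 1) (j : ℕ) :
    knots s j ∈ Icc (0 : ℝ) 1 := by
  unfold knots
  split_ifs
  · simp
  · exact h01 _
  · simp

/-- The law of `n` independent uniform variables. -/
def uniformSample (n : ℕ) : Measure (Fin n → ℝ) :=
  Measure.pi fun _ => volume.restrict (Icc 0 1)

/-- The law of the sorted values of `n` independent uniform variables. -/
def sortedLaw (n : ℕ) : Measure (Fin n → ℝ) := (uniformSample n).map sorted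

instance : IsProbabilityMeasure (volume.restrict (Icc (0 : ℝ) 1)) := ⟨by simp⟩

instance : IsProbabilityMeasure (uniformSample n) := by
  unfold uniformSample
  infer_instance

instance : IsProbabilityMeasure (sortedLaw n) :=
  Measure.isProbabilityMeasure_map measurable_sorted.aemeasurable

lemma map_sorted_eq {Ω : Type*} [MeasurableSpace Ω] {P : Measure Ω} [IsProbabilityMeasure P]
    {U : Ω → Fin n → ℝ} (hU : Measurable U) (hind : iIndepFun (fun i ω => U ω i) P)
    (hunif : ∀ i, pdf.IsUniform (fun ω => U ω i) (Icc 0 1) P) :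
    P.map (fun ω => sorted (U ω)) = sortedLaw n := by
  have h1 : P.map U = uniformSample n := by
    have := (iIndepFun_iff_map_fun_eq_pi_map (fun i => by fun_prop)).1 hind
    rw [show (fun ω i => U ω i) = U from rfl] at this
    rw [this, uniformSample]
    congr 1
    ext1 i
    rw [hunif i, ProbabilityTheory.cond]
    simp
  rw [sortedLaw, ← h1, Measure.map_map measurable_sorted hU]
  rfl

/-- Absence of ties is what makes the Dirichlet parameters of the BK process strictly positive. -/
lemma ae_sortedLaw : ∀ᵐ s ∂(sortedLaw n), StrictMono s ∧ ∀ i, s i ∈ Ioo (0 : ℝ) 1 := by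
  have hvol : uniformSample n = volume.restrict (Set.pi univ fun _ => Icc (0 : ℝ) 1) := by
    rw [uniformSample, ← Measure.restrict_pi_pi, ← volume_pi]
  have hne : ∀ a b : Fin n, a ≠ b → ∀ᵐ u ∂(uniformSample n), u a ≠ u b := by
    intro a b hab
    rw [hvol]
    refine ae_restrict_of_ae ?_
    -- A tie between `a` and `b` means lying in the kernel of a nonzero linear functional, a proper
    -- subspace and hence a null set.
    let L : (Fin n → ℝ) →ₗ[ℝ] ℝ :=
      (LinearMap.proj a : (Fin n → ℝ) →ₗ[ℝ] ℝ) - LinearMap.proj b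
    have hL : LinearMap.ker L ≠ ⊤ := by
      intro h
      have h1 : Pi.single a (1 : ℝ) ∈ LinearMap.ker L := h ▸ Submodule.mem_top
      simp [L, Pi.single_eq_of_ne hab.symm] at h1
    have h0 := Measure.addHaar_submodule volume (LinearMap.ker L) hL
    rw [ae_iff]
    refine measure_mono_null (fun u hu => ?_) h0
    simp only [ne_eq, not_not, mem_ofPred_eq] at hu
    simp [L, hu]
  have h01 : ∀ i : Fin n, ∀ᵐ u ∂(uniformSample n), u i ∈ Ioo (0 : ℝ) 1 := by
    intro i
    have : ∀ᵐ x ∂(volume.restrict (Icc (0 : ℝ) 1)), x ∈ Ioo (0 : ℝ) 1 := by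
      rw [← restrict_Ioo_eq_restrict_Icc]
      exact ae_restrict_mem measurableSet_Ioo
    exact (Measure.tendsto_eval_ae_ae (i := i)).eventually this
  have hall : ∀ᵐ u ∂(uniformSample n), Function.Injective u ∧ ∀ i, u i ∈ Ioo (0 : ℝ) 1 := by
    filter_upwards [ae_all_iff.2 fun a => ae_all_iff.2 fun b => ae_all_iff.2 fun h => hne a b h,
      ae_all_iff.2 h01] with u h1 h2
    exact ⟨fun a b hab => by_contra fun h => h1 a b h hab, h2⟩
  have hA : ∀ i j : Fin n, i < j → ∀ᵐ s ∂(sortedLaw n), s i < s j := by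
    intro i j hij
    rw [sortedLaw, ae_map_iff measurable_sorted.aemeasurable
      (measurableSet_lt (measurable_pi_apply i) (measurable_pi_apply j))]
    filter_upwards [hall] with u hu
    refine lt_of_le_of_ne (monotone_sorted u hij.le) fun h => hij.ne ?_
    exact (Tuple.sort u).injective (hu.1 h)
  have hB : ∀ i : Fin n, ∀ᵐ s ∂(sortedLaw n), s i ∈ Ioo (0 : ℝ) 1 := by
    intro i
    rw [sortedLaw, ae_map_iff measurable_sorted.aemeasurable
      (measurable_pi_apply i measurableSet_Ioo)]
    filter_upwards [hall] with u hu using hu.2 _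
  filter_upwards [ae_all_iff.2 fun i => ae_all_iff.2 fun j => ae_all_iff.2 fun h => hA i j h,
    ae_all_iff.2 hB] with s h1 h2
  exact ⟨fun i j hij => h1 i j hij, h2⟩

/-- The event that `τ` lies in the interval `[U*_j, U*_{j+1})`. -/
def straddle (n : ℕ) (τ : ℝ) (j : ℕ) : Set (Fin n → ℝ) :=
  {s | knots s j ≤ τ ∧ τ < knots s (j + 1)}

lemma measurableSet_straddle (τ : ℝ) (j : ℕ) : MeasurableSet (straddle n τ j) :=
  (measurableSet_le (measurable_knots j) measurable_const).inter
    (measurableSet_lt measurable_const (measurable_knots (j + 1)))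

lemma knots_sorted_le_iff {u : Fin n → ℝ} {j : ℕ} (hj : j ≤ n) {x : ℝ} (hx : 0 ≤ x) :
    knots (sorted u) j ≤ x ↔ j ≤ (Finset.univ.filter fun i => u i ≤ x).card := by
  rcases j with _ | j
  · simp [knots_zero, hx]
  · rw [knots_succ (sorted u) ⟨j, hj⟩, sorted_le_iff]
    rfl

lemma lt_knots_sorted_iff {u : Fin n → ℝ} {j : ℕ} (hj : j ≤ n) {y : ℝ} (hy : y < 1) :
    y < knots (sorted u) (j + 1) ↔ (Finset.univ.filter fun i => u i ≤ y).card ≤ j := by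
  rcases hj.lt_or_eq with h | h
  · rw [← not_le, knots_succ (sorted u) ⟨j, h⟩, sorted_le_iff, not_lt]
  · subst h
    rw [knots_last]
    simp only [hy, true_iff]
    exact (Finset.card_le_univ _).trans (by simp)

/-- The event says that exactly `j` points are at most `x` and all others exceed `y`. It is a
disjoint union of boxes, one for each choice `A` of the `j` low points, all of the same volume. -/
lemma sortedLaw_le_lt {j : ℕ} (hj : j ≤ n) {x y : ℝ} (hx : 0 ≤ x) (hxy : x ≤ y) (hy : y < 1) :
    sortedLaw n {s | knots s j ≤ x ∧ y < knots s (j + 1)}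
      = n.choose j * (ENNReal.ofReal (x ^ j) * ENNReal.ofReal ((1 - y) ^ (n - j))) := by
  have hm : MeasurableSet {s : Fin n → ℝ | knots s j ≤ x ∧ y < knots s (j + 1)} :=
    (measurableSet_le (measurable_knots j) measurable_const).inter
      (measurableSet_lt measurable_const (measurable_knots (j + 1)))
  rw [sortedLaw, Measure.map_apply measurable_sorted hm]
  have hset : sorted ⁻¹' {s : Fin n → ℝ | knots s j ≤ x ∧ y < knots s (j + 1)}
      = ⋃ A ∈ (Finset.univ : Finset (Fin n)).powersetCard j,
          Set.pi univ fun i => if i ∈ A then Iic x else Ioi y := by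
    ext u
    simp only [mem_preimage, mem_ofPred_eq, knots_sorted_le_iff hj hx, lt_knots_sorted_iff hj hy,
      mem_iUnion, Finset.mem_powersetCard, Finset.subset_univ, true_and, mem_univ_pi, exists_prop]
    constructor
    · rintro ⟨h1, h2⟩
      -- At least `j` points are `≤ x` and at most `j` are `≤ y`; by inclusion the two sets
      -- coincide, and no point lies in `(x, y]`.
      have hsub : (Finset.univ.filter fun i => u i ≤ x) ⊆ Finset.univ.filter fun i => u i ≤ y :=
        Finset.monotone_filter_right _ fun i _ hi => hi.trans hxy
      have heq := Finset.eq_of_subset_of_card_le hsub (h2.trans h1)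
      refine ⟨_, le_antisymm (heq ▸ h2) h1, fun i => ?_⟩
      split_ifs with hi
      · simpa using hi
      · rw [heq] at hi
        simpa using hi
    · rintro ⟨A, rfl, hA⟩
      constructor
      · refine Finset.card_le_card fun i hi => ?_
        simpa [hi] using hA i
      · refine Finset.card_le_card fun i hi => ?_
        by_contra hiA
        have h1 := hA i
        simp only [hiA, if_false, mem_Ioi] at h1
        simp only [Finset.mem_filter, Finset.mem_univ, true_and] at hi
        exact absurd hi (not_le.2 h1)
  rw [hset, measure_biUnion_finset]
  · have : ∀ A ∈ (Finset.univ : Finset (Fin n)).powersetCard j,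
        uniformSample n (Set.pi univ fun i => if i ∈ A then Iic x else Ioi y)
          = ENNReal.ofReal (x ^ j) * ENNReal.ofReal ((1 - y) ^ (n - j)) := by
      intro A hA
      rw [uniformSample, Measure.pi_pi]
      have h1 : ∀ i : Fin n, (volume.restrict (Icc (0 : ℝ) 1)) (if i ∈ A then Iic x else Ioi y)
          = if i ∈ A then ENNReal.ofReal x else ENNReal.ofReal (1 - y) := by
        intro i
        split_ifs
        · rw [Measure.restrict_apply measurableSet_Iic]
          have : Iic x ∩ Icc 0 1 = Icc 0 x := by
            ext z
            simp only [mem_inter_iff, mem_Iic, mem_Icc]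
            constructor
            · rintro ⟨h1, h2, h3⟩; exact ⟨h2, h1⟩
            · rintro ⟨h1, h2⟩; exact ⟨h2, h1, by linarith⟩
          rw [this, Real.volume_Icc, sub_zero]
        · rw [Measure.restrict_apply measurableSet_Ioi]
          have : Ioi y ∩ Icc 0 1 = Ioc y 1 := by
            ext z
            simp only [mem_inter_iff, mem_Ioi, mem_Icc, mem_Ioc]
            constructor
            · rintro ⟨h1, h2, h3⟩; exact ⟨h1, h3⟩
            · rintro ⟨h1, h2⟩; exact ⟨h1, by linarith, h2⟩
          rw [this, Real.volume_Ioc]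
      simp_rw [h1]
      rw [Finset.prod_ite]
      simp only [Finset.prod_const, Finset.filter_mem_eq_inter, Finset.univ_inter]
      have h2 : (Finset.univ.filter fun i => i ∉ A).card = n - j := by
        rw [Finset.filter_not, Finset.filter_mem_eq_inter, Finset.univ_inter,
          Finset.card_sdiff_of_subset (Finset.subset_univ _), (Finset.mem_powersetCard.1 hA).2]
        simp
      rw [h2, (Finset.mem_powersetCard.1 hA).2, ENNReal.ofReal_pow hx,
        ENNReal.ofReal_pow (by linarith)]
    rw [Finset.sum_congr rfl this]
    simp
  · intro A hA B hB hAB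
    refine Set.disjoint_left.2 fun u hu hv => hAB ?_
    ext i
    have h1 := hu i (mem_univ i)
    have h2 := hv i (mem_univ i)
    by_cases hiA : i ∈ A <;> by_cases hiB : i ∈ B <;>
      simp only [hiA, hiB, if_true, if_false, mem_Iic, mem_Ioi] at h1 h2 ⊢ <;> linarith
  · intro A _
    refine MeasurableSet.univ_pi fun i => ?_
    split_ifs
    exacts [measurableSet_Iic, measurableSet_Ioi]

lemma ae_knots : ∀ᵐ s ∂(sortedLaw n), Monotone (knots s) ∧ ∀ j, knots s j ∈ Icc (0 : ℝ) 1 := by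
  filter_upwards [ae_sortedLaw] with s hs
  have h01 : ∀ i, s i ∈ Icc (0 : ℝ) 1 := fun i => Ioo_subset_Icc_self (hs.2 i)
  exact ⟨monotone_knots hs.1.monotone h01, knots_mem_Icc h01⟩

/-- On the event that `τ` lies between the `j`-th and the next knot, the two knots are
distributed according to a product measure. -/
theorem map_knots_restrict_straddle {τ : ℝ} (hτ : τ ∈ Ioo (0 : ℝ) 1) {j : ℕ} (hj : j ≤ n) :
    ((sortedLaw n).restrict (straddle n τ j)).map (fun s => (knots s j, knots s (j + 1)))
      = (n.choose j : ENNReal) • (lowLaw τ j).prod (highLaw τ (n - j)) := by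
  have := isFiniteMeasure_lowLaw hτ.1.le j
  have := isFiniteMeasure_highLaw hτ.2 (n - j)
  have hpair : Measurable fun s : Fin n → ℝ => (knots s j, knots s (j + 1)) :=
    (measurable_knots j).prodMk (measurable_knots (j + 1))
  have hfin : IsFiniteMeasure ((n.choose j : ENNReal) • lowLaw τ j) :=
    Measure.smul_finite _ (by simp)
  -- The binomial factor is moved into the first measure so that uniqueness of product measures
  -- applies. It is enough to compare both sides on rectangles `Iic x ×ˢ Ioi y`, where they are
  -- given by `sortedLaw_le_lt` and by the distribution functions of the two factors.
  rw [← Measure.prod_smul_left]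
  symm
  refine Measure.prod_eq_generateFrom (C := range Iic) (D := range Ioi)
    (by rw [← borel_eq_generateFrom_Iic]; exact (BorelSpace.measurable_eq (α := ℝ)).symm)
    (by rw [← borel_eq_generateFrom_Ioi]; exact (BorelSpace.measurable_eq (α := ℝ)).symm)
    isPiSystem_Iic isPiSystem_Ioi
    ⟨fun k => Iic (k : ℝ), fun k => mem_range_self _, fun k => measure_lt_top _ _, ?_⟩
    ⟨fun k => Ioi (-k : ℝ), fun k => mem_range_self _, fun k => measure_lt_top _ _, ?_⟩ ?_
  · rw [iUnion_eq_univ_iff]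
    exact fun x => exists_nat_ge x
  · rw [iUnion_eq_univ_iff]
    intro x
    obtain ⟨k, hk⟩ := exists_nat_gt (-x)
    exact ⟨k, by simp only [mem_Ioi]; linarith⟩
  rintro _ ⟨x, rfl⟩ _ ⟨y, rfl⟩
  rw [Measure.map_apply hpair (measurableSet_Iic.prod measurableSet_Ioi),
    Measure.restrict_apply (hpair (measurableSet_Iic.prod measurableSet_Ioi)),
    Measure.smul_apply, lowLaw_Iic_eq_min hτ.1.le, highLaw_Ioi_eq_max hτ.2]
  have hset : (fun s : Fin n → ℝ => (knots s j, knots s (j + 1))) ⁻¹' (Iic x ×ˢ Ioi y)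
      ∩ straddle n τ j = {s | knots s j ≤ min x τ ∧ max y τ < knots s (j + 1)} := by
    ext s
    simp only [mem_inter_iff, mem_preimage, mem_prod, mem_Iic, mem_Ioi, straddle, mem_ofPred_eq,
      le_min_iff, max_lt_iff]
    tauto
  rw [hset]
  -- For a level below `0`, or from `1` on, both sides vanish; `sortedLaw_le_lt` covers only the
  -- remaining case.
  rcases lt_or_ge (min x τ) 0 with hx | hx
  · have h1 : sortedLaw n {s | knots s j ≤ min x τ ∧ max y τ < knots s (j + 1)} = 0 := by
      rw [measure_eq_zero_iff_ae_notMem]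
      filter_upwards [ae_knots] with s hs h
      exact absurd (h.1.trans_lt hx) (not_lt.2 (hs.2 j).1)
    have h2 : lowLaw τ j (Iic (min x τ)) = 0 := by
      rw [measure_eq_zero_iff_ae_notMem]
      filter_upwards [ae_lowLaw hτ.1.le j] with u hu h
      exact absurd (lt_of_le_of_lt h hx) (not_lt.2 hu.1)
    rw [h1, h2]
    simp
  rcases le_or_gt 1 (max y τ) with hy | hy
  · have h1 : sortedLaw n {s | knots s j ≤ min x τ ∧ max y τ < knots s (j + 1)} = 0 := by
      rw [measure_eq_zero_iff_ae_notMem]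
      filter_upwards [ae_knots] with s hs h
      exact absurd (lt_of_le_of_lt hy h.2) (not_lt.2 (hs.2 _).2)
    have h2 : highLaw τ (n - j) (Ioi (max y τ)) = 0 := by
      rw [measure_eq_zero_iff_ae_notMem]
      filter_upwards [ae_highLaw hτ.2 (n - j)] with u hu h
      exact absurd (lt_of_le_of_lt hy h) (not_lt.2 hu.2)
    rw [h1, h2]
    simp
  rw [sortedLaw_le_lt hj hx ((min_le_right _ _).trans (le_max_right _ _)) hy,
    lowLaw_Iic hx (min_le_right _ _), highLaw_Ioi hy (le_max_right _ _), smul_eq_mul, mul_assoc]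

/-- The index `j` precedes the first knot beyond `τ`. No monotonicity of the knots is needed, so
this holds for every `s`. -/
lemma exists_mem_straddle {τ : ℝ} (hτ : τ ∈ Ioo (0 : ℝ) 1) (s : Fin n → ℝ) :
    ∃ j ≤ n, s ∈ straddle n τ j := by
  classical
  have hex : ∃ k, τ < knots s k := ⟨n + 1, by rw [knots_last]; exact hτ.2⟩
  have hpos : Nat.find hex ≠ 0 := fun h => by
    have := Nat.find_spec hex
    rw [h, knots_zero] at this
    linarith [hτ.1]
  obtain ⟨j, hj⟩ := Nat.exists_eq_succ_of_ne_zero hpos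
  refine ⟨j, ?_, not_lt.1 (Nat.find_min hex (by omega)), ?_⟩
  · have : Nat.find hex ≤ n + 1 := Nat.find_min' hex (by rw [knots_last]; exact hτ.2)
    omega
  · have := Nat.find_spec hex
    rwa [hj] at this

/-- A function of the sample that depends, on each of the events `straddle n τ j`, only on the two
knots around `τ`. -/
theorem integral_sortedLaw_eq {τ : ℝ} (hτ : τ ∈ Ioo (0 : ℝ) 1) {F : (Fin n → ℝ) → ℝ}
    {G : ℕ → ℝ × ℝ → ℝ} (hG : ∀ j ≤ n, Measurable (G j)) {C : ℝ}
    (hC : ∀ j ≤ n, ∀ u ∈ Icc 0 τ, ∀ v ∈ Ioc τ 1, |G j (u, v)| ≤ C)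
    (hF : ∀ᵐ s ∂(sortedLaw n), ∀ j ≤ n, s ∈ straddle n τ j →
      F s = G j (knots s j, knots s (j + 1))) :
    Integrable F (sortedLaw n) ∧ ∫ s, F s ∂(sortedLaw n)
      = ∑ j ∈ Finset.range (n + 1),
          n.choose j * ∫ z, G j z ∂((lowLaw τ j).prod (highLaw τ (n - j))) := by
  have hpair : ∀ j, Measurable fun s : Fin n → ℝ => (knots s j, knots s (j + 1)) := fun j =>
    (measurable_knots j).prodMk (measurable_knots (j + 1))
  -- The straddle events cover the space, and they are disjoint wherever the knots are monotone,
  -- hence almost surely.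
  have hsum : F =ᵐ[sortedLaw n] fun s => ∑ j ∈ Finset.range (n + 1),
      (straddle n τ j).indicator (fun s => G j (knots s j, knots s (j + 1))) s := by
    filter_upwards [hF, ae_knots] with s h1 h2
    obtain ⟨j, hj, hs⟩ := exists_mem_straddle hτ s
    rw [Finset.sum_eq_single j, indicator_of_mem hs, h1 j hj hs]
    · intro k _ hk
      refine indicator_of_notMem (fun hsk => ?_) _
      rcases lt_or_gt_of_ne hk with h | h
      · exact absurd (hsk.2.trans_le ((h2.1 (by omega : k + 1 ≤ j)).trans hs.1)) (lt_irrefl _)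
      · exact absurd (hs.2.trans_le ((h2.1 (by omega : j + 1 ≤ k)).trans hsk.1)) (lt_irrefl _)
    · intro h
      exact absurd (Finset.mem_range.2 (by omega)) h
  have hint : ∀ j ∈ Finset.range (n + 1), Integrable ((straddle n τ j).indicator
      (fun s => G j (knots s j, knots s (j + 1)))) (sortedLaw n) := by
    intro j hj
    have hj' : j ≤ n := by simpa [Nat.lt_succ_iff] using hj
    refine Integrable.of_bound
      (((hG j hj').comp (hpair j)).indicator (measurableSet_straddle τ j)).aestronglyMeasurable C ?_
    filter_upwards [ae_knots] with s hs
    by_cases h : s ∈ straddle n τ j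
    · rw [indicator_of_mem h]
      exact hC j hj' _ ⟨(hs.2 j).1, h.1⟩ _ ⟨h.2, (hs.2 _).2⟩
    · rw [indicator_of_notMem h, norm_zero]
      -- The bound at the pair `(0, 1)` serves only to show that `C` is nonnegative.
      exact (abs_nonneg _).trans (hC j hj' 0 ⟨le_rfl, hτ.1.le⟩ 1 ⟨hτ.2, le_rfl⟩)
  refine ⟨(integrable_finsetSum _ hint).congr (by simpa [Finset.sum_fn] using hsum.symm), ?_⟩
  rw [integral_congr_ae hsum, integral_finsetSum _ hint]
  refine Finset.sum_congr rfl fun j hj => ?_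
  have hj' : j ≤ n := by simpa [Nat.lt_succ_iff] using hj
  rw [integral_indicator (measurableSet_straddle τ j),
    ← integral_map (φ := fun s : Fin n → ℝ => (knots s j, knots s (j + 1)))
      (hpair j).aemeasurable (hG j hj').aestronglyMeasurable,
    map_knots_restrict_straddle hτ hj', integral_smul_measure]
  simp

/-! ### Linear functionals of Dirichlet weights -/

lemma measurable_interpolate {α : Type*} [MeasurableSpace α] (n : ℕ) {x c : α → ℕ → ℝ}
    (hx : ∀ j, Measurable fun a => x a j) (hc : ∀ j, Measurable fun a => c a j) (t : ℝ) :
    Measurable fun a => interpolate n (x a) (c a) t := by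
  unfold interpolate
  split_ifs
  · exact measurable_const
  · simp only [indicator, mem_Ico]
    refine Finset.measurable_fun_sum _ fun j _ => Measurable.ite ?_ ?_ measurable_const
    · exact (measurableSet_le (hx j) measurable_const).inter
        (measurableSet_lt measurable_const (hx (j + 1)))
    · have := Finset.measurable_fun_sum (Finset.range (j + 1)) fun i _ => hc i
      exact this.add ((hc _).mul ((measurable_const.sub (hx j)).div ((hx _).sub (hx j))))

lemma interpolate_eq {n : ℕ} {x c : ℕ → ℝ} {t : ℝ} (ht : t ≠ 1) {j : ℕ} (hj : j ≤ n)
    (hxj : x j ≤ t) (htx : t < x (j + 1)) (hmono : ∀ i k, i ≤ k → k ≤ n + 1 → x i ≤ x k) :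
    interpolate n x c t
      = ∑ i ∈ Finset.range (j + 1), c i + c (j + 1) * ((t - x j) / (x (j + 1) - x j)) := by
  rw [interpolate, if_neg ht, Finset.sum_eq_single j, indicator_of_mem (mem_Ico.2 ⟨hxj, htx⟩)]
  · intro k hk hkj
    have hk' := Finset.mem_range.1 hk
    refine indicator_of_notMem (fun h => ?_) _
    rcases lt_or_gt_of_ne hkj with h1 | h1
    · exact absurd (h.2.trans_le ((hmono (k + 1) j h1 (by omega)).trans hxj)) (lt_irrefl _)
    · exact absurd (htx.trans_le ((hmono (j + 1) k h1 (by omega)).trans h.1)) (lt_irrefl _)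
  · intro h
    exact absurd (Finset.mem_range.2 (by omega)) h

variable {n m : ℕ}

/-- The first two moments of a functional of the sorted sample and of Dirichlet weights which is
linear in the weights, the coefficients depending only on the two knots around `τ`. -/
theorem moments_of_dirichlet {Ω : Type*} [MeasurableSpace Ω] {P : Measure Ω}
    [IsProbabilityMeasure P] {S : Ω → Fin n → ℝ} {a : Ω → Fin m → ℝ} (hS : Measurable S)
    (ha : Measurable a) {κ : Kernel (Fin n → ℝ) (Fin m → ℝ)} [IsMarkovKernel κ]
    (hlaw : P.map (fun ω => (S ω, a ω)) = sortedLaw n ⊗ₘ κ) {θ τ : ℝ} (hθ : 0 < θ)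
    (hτ : τ ∈ Ioo (0 : ℝ) 1) {μ : (Fin n → ℝ) → Fin m → ℝ}
    (hκ : ∀ᵐ s ∂(sortedLaw n), κ s = dirichlet fun i => θ * μ s i)
    (hμ : ∀ᵐ s ∂(sortedLaw n), (∀ i, 0 < μ s i) ∧ ∑ i, μ s i = 1)
    {H : (Fin n → ℝ) × (Fin m → ℝ) → ℝ} (hH : Measurable H)
    {w : ℕ → ℝ × ℝ → Fin m → ℝ}
    (hw : ∀ j ≤ n, ∀ u ∈ Icc 0 τ, ∀ v ∈ Ioc τ 1, ∀ i, w j (u, v) i ∈ Icc (0 : ℝ) 1)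
    (hHw : ∀ᵐ s ∂(sortedLaw n), ∀ j ≤ n, s ∈ straddle n τ j →
      ∀ x, H (s, x) = ∑ i, w j (knots s j, knots s (j + 1)) i * x i)
    {M N : ℕ → ℝ × ℝ → ℝ} (hM : ∀ j ≤ n, Measurable (M j)) (hN : ∀ j ≤ n, Measurable (N j))
    (hMb : ∀ j ≤ n, ∀ u ∈ Icc 0 τ, ∀ v ∈ Ioc τ 1, |M j (u, v)| ≤ 1)
    (hNb : ∀ j ≤ n, ∀ u ∈ Icc 0 τ, ∀ v ∈ Ioc τ 1, |N j (u, v)| ≤ 1)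
    (hMw : ∀ᵐ s ∂(sortedLaw n), ∀ j ≤ n, s ∈ straddle n τ j →
      ∑ i, w j (knots s j, knots s (j + 1)) i * μ s i = M j (knots s j, knots s (j + 1)))
    (hNw : ∀ᵐ s ∂(sortedLaw n), ∀ j ≤ n, s ∈ straddle n τ j →
      ∑ i, w j (knots s j, knots s (j + 1)) i ^ 2 * μ s i
        = N j (knots s j, knots s (j + 1))) :
    MemLp (fun ω => H (S ω, a ω)) 2 P ∧
    ∫ ω, H (S ω, a ω) ∂P = ∑ j ∈ Finset.range (n + 1),
      (n.choose j : ℝ) * ∫ z, M j z ∂((lowLaw τ j).prod (highLaw τ (n - j))) ∧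
    ∫ ω, H (S ω, a ω) ^ 2 ∂P = ∑ j ∈ Finset.range (n + 1),
      (n.choose j : ℝ) * ∫ z, (1 / (1 + θ) * N j z + (1 - 1 / (1 + θ)) * M j z ^ 2)
        ∂((lowLaw τ j).prod (highLaw τ (n - j))) := by
  have hSa : Measurable fun ω => (S ω, a ω) := hS.prodMk ha
  -- A combination of simplex weights with coefficients in `[0, 1]` stays in `[0, 1]`. This gives
  -- square integrability at once.
  have hbound : ∀ᵐ z ∂(sortedLaw n ⊗ₘ κ), |H z| ≤ 1 := by
    refine Measure.ae_compProd_of_ae_ae (measurableSet_le hH.abs measurable_const) ?_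
    filter_upwards [hκ, hμ, hHw, ae_knots] with s h1 h2 h3 h4
    obtain ⟨j, hj, hs⟩ := exists_mem_straddle hτ s
    have hne : Nonempty (Fin m) := by
      by_contra h
      rw [not_nonempty_iff] at h
      simp at h2
    rw [h1]
    filter_upwards [ae_mem_stdSimplex_dirichlet fun i => mul_pos hθ (h2.1 i)] with x hx
    rw [h3 j hj hs]
    have hw' := hw j hj _ ⟨(h4.2 j).1, hs.1⟩ _ ⟨hs.2, (h4.2 _).2⟩
    rw [abs_of_nonneg (Finset.sum_nonneg fun i _ => mul_nonneg (hw' i).1 (hx.1 i)), ← hx.2]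
    exact Finset.sum_le_sum fun i _ => mul_le_of_le_one_left (hx.1 i) (hw' i).2
  have hLp : MemLp H 2 (sortedLaw n ⊗ₘ κ) :=
    MemLp.of_bound hH.aestronglyMeasurable 1 (by simpa using hbound)
  have hI1 : Integrable H (sortedLaw n ⊗ₘ κ) := hLp.integrable one_le_two
  have hI2 : Integrable (fun z => H z ^ 2) (sortedLaw n ⊗ₘ κ) := hLp.integrable_sq
  refine ⟨?_, ?_, ?_⟩
  · rw [← hlaw] at hLp
    exact hLp.comp_of_map hSa.aemeasurable
  · rw [← integral_map (φ := fun ω => (S ω, a ω)) (f := H) hSa.aemeasurable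
      hH.aestronglyMeasurable, hlaw, Measure.integral_compProd hI1]
    refine (integral_sortedLaw_eq hτ hM hMb ?_).2
    filter_upwards [hκ, hμ, hHw, hMw] with s h1 h2 h3 h4 j hj hs
    simp_rw [h3 j hj hs]
    rw [h1, integral_linear_dirichlet hθ h2.1 h2.2, h4 j hj hs]
  · rw [← integral_map (φ := fun ω => (S ω, a ω)) (f := fun z => H z ^ 2) hSa.aemeasurable
      (hH.pow_const 2).aestronglyMeasurable, hlaw, Measure.integral_compProd hI2]
    have hc0 : 0 ≤ 1 / (1 + θ) := by positivity
    have hc1 : 1 / (1 + θ) ≤ 1 := by rw [div_le_one (by linarith)]; linarith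
    refine (integral_sortedLaw_eq hτ (C := 1)
      (G := fun j z => 1 / (1 + θ) * N j z + (1 - 1 / (1 + θ)) * M j z ^ 2)
      (fun j hj => ((hN j hj).const_mul _).add (((hM j hj).pow_const 2).const_mul _)) ?_ ?_).2
    · intro j hj u hu v hv
      have h1 := hNb j hj u hu v hv
      have h2 : |M j (u, v) ^ 2| ≤ 1 := by
        rw [abs_pow]
        exact pow_le_one₀ (abs_nonneg _) (hMb j hj u hu v hv)
      rw [abs_le] at h1 h2 ⊢
      constructor <;> nlinarith
    · filter_upwards [hκ, hμ, hHw, hMw, hNw] with s h1 h2 h3 h4 h5 j hj hs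
      simp_rw [h3 j hj hs]
      rw [h1, integral_linear_sq_dirichlet hθ h2.1 h2.2, h4 j hj hs, h5 j hj hs]

/-! ### Expectations of functions of the knots around a fixed time -/

/-- The joint law of the knots around `τ` on the event that there are `j` sample points up to `τ`
and `k` sample points beyond, up to the number of choices of these. -/
def pairLaw (τ : ℝ) (j k : ℕ) : Measure (ℝ × ℝ) := (lowLaw τ j).prod (highLaw τ k)

/-- The expectation of `G j (U*_j, U*_{j+1})`, where `j` is the number of sample points up to
`τ`. -/
def knotMean (n : ℕ) (τ : ℝ) (G : ℕ → ℝ × ℝ → ℝ) : ℝ :=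
  ∑ j ∈ Finset.range (n + 1), (n.choose j : ℝ) * ∫ z, G j z ∂(pairLaw τ j (n - j))

variable {τ : ℝ}

lemma isFiniteMeasure_pairLaw (hτ : τ ∈ Ioo (0 : ℝ) 1) (j k : ℕ) :
    IsFiniteMeasure (pairLaw τ j k) := by
  have := isFiniteMeasure_lowLaw hτ.1.le j
  have := isFiniteMeasure_highLaw hτ.2 k
  unfold pairLaw
  infer_instance

lemma ae_pairLaw (hτ : τ ∈ Ioo (0 : ℝ) 1) (j k : ℕ) :
    ∀ᵐ z ∂(pairLaw τ j k), z.1 ∈ Icc 0 τ ∧ z.2 ∈ Ioc τ 1 := by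
  have := isFiniteMeasure_lowLaw hτ.1.le j
  have := isFiniteMeasure_highLaw hτ.2 k
  exact (Measure.quasiMeasurePreserving_fst.ae (ae_lowLaw hτ.1.le j)).and
    (Measure.quasiMeasurePreserving_snd.ae (ae_highLaw hτ.2 k))

lemma integrable_pairLaw (hτ : τ ∈ Ioo (0 : ℝ) 1) {g : ℝ × ℝ → ℝ} (hg : Measurable g) {C : ℝ}
    (hC : ∀ u ∈ Icc 0 τ, ∀ v ∈ Ioc τ 1, |g (u, v)| ≤ C) (j k : ℕ) :
    Integrable g (pairLaw τ j k) := by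
  have := isFiniteMeasure_pairLaw hτ j k
  refine Integrable.of_bound hg.aestronglyMeasurable C ?_
  filter_upwards [ae_pairLaw hτ j k] with z hz using hC _ hz.1 _ hz.2

lemma pairLaw_real_univ (hτ : τ ∈ Ioo (0 : ℝ) 1) (j k : ℕ) :
    (pairLaw τ j k).real univ = τ ^ j * (1 - τ) ^ k := by
  have := isFiniteMeasure_lowLaw hτ.1.le j
  have := isFiniteMeasure_highLaw hτ.2 k
  have h1 := hτ.1.le
  have h2 : 0 ≤ 1 - τ := sub_nonneg.2 hτ.2.le
  rw [pairLaw, Measure.real, ← univ_prod_univ, Measure.prod_prod, lowLaw_univ h1,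
    highLaw_univ hτ.2, ← ENNReal.ofReal_mul (by positivity), ENNReal.toReal_ofReal (by positivity)]

lemma integral_highLaw_sub (hτ : τ < 1) (k : ℕ) :
    ∫ v, (v - τ) ∂(highLaw τ k) = (1 - τ) ^ (k + 1) / (k + 1) := by
  rcases eq_or_ne k 0 with rfl | hk
  · simp [highLaw_zero]
  rw [integral_highLaw hτ.le hk, intervalIntegral.integral_eq_sub_of_hasDerivAt
    (f := fun v => -(v - τ) * (1 - v) ^ k - (1 - v) ^ (k + 1) / (k + 1)) _
    (Continuous.intervalIntegrable (by fun_prop) _ _)]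
  · simp [hk]
  · intro v _
    have h1 : HasDerivAt (fun v : ℝ => 1 - v) (-1) v := by
      simpa using (hasDerivAt_id v).const_sub 1
    have h2 : HasDerivAt (fun v : ℝ => -(v - τ)) (-1) v := by
      exact ((hasDerivAt_id v).sub_const τ).neg
    have h3 := (h2.mul (h1.pow k)).sub ((h1.pow (k + 1)).div_const ((k : ℝ) + 1))
    refine h3.congr_deriv ?_
    push_cast [Pi.pow_apply]
    field_simp
    ring

lemma integral_lowLaw_sub (hτ : 0 ≤ τ) (j : ℕ) :
    ∫ u, (τ - u) ∂(lowLaw τ j) = τ ^ (j + 1) / (j + 1) := by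
  rcases eq_or_ne j 0 with rfl | hj
  · simp [lowLaw_zero]
  rw [integral_lowLaw hτ hj, intervalIntegral.integral_eq_sub_of_hasDerivAt
    (f := fun u => (τ - u) * u ^ j + u ^ (j + 1) / (j + 1)) _
    (Continuous.intervalIntegrable (by fun_prop) _ _)]
  · simp [hj]
  · intro u _
    have h2 : HasDerivAt (fun u : ℝ => τ - u) (-1) u := by
      simpa using (hasDerivAt_id u).const_sub τ
    have h3 := (h2.mul (hasDerivAt_pow j u)).add
      ((hasDerivAt_pow (j + 1) u).div_const ((j : ℝ) + 1))
    refine h3.congr_deriv ?_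
    push_cast
    field_simp
    ring

/-- The gap is cut at `τ`: each piece depends on one knot only, so its integral against the product
measure factors. -/
lemma integral_pairLaw_gap (hτ : τ ∈ Ioo (0 : ℝ) 1) (j k : ℕ) :
    ∫ z, (z.2 - z.1) ∂(pairLaw τ j k)
      = τ ^ j * ((1 - τ) ^ (k + 1) / (k + 1)) + τ ^ (j + 1) / (j + 1) * (1 - τ) ^ k := by
  have := isFiniteMeasure_lowLaw hτ.1.le j
  have := isFiniteMeasure_highLaw hτ.2 k
  have h1 := hτ.1.le
  have h2 : 0 ≤ 1 - τ := sub_nonneg.2 hτ.2.le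
  have hsplit : ∀ z : ℝ × ℝ, z.2 - z.1 = 1 * (z.2 - τ) + (τ - z.1) * 1 := fun z => by ring
  have hA : Integrable (fun z : ℝ × ℝ => 1 * (z.2 - τ)) (pairLaw τ j k) := by
    refine integrable_pairLaw hτ (by fun_prop) (C := 1) (fun u hu v hv => ?_) j k
    rw [abs_le]
    constructor <;> linarith [hu.1, hu.2, hv.1, hv.2]
  have hB : Integrable (fun z : ℝ × ℝ => (τ - z.1) * 1) (pairLaw τ j k) := by
    refine integrable_pairLaw hτ (by fun_prop) (C := 1) (fun u hu v hv => ?_) j k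
    rw [abs_le]
    constructor <;> linarith [hu.1, hu.2, hv.1, hv.2]
  simp_rw [hsplit]
  rw [integral_add hA hB, pairLaw,
    integral_prod_mul (μ := lowLaw τ j) (ν := highLaw τ k) (fun _ => (1 : ℝ)) (fun v => v - τ),
    integral_prod_mul (μ := lowLaw τ j) (ν := highLaw τ k) (fun u => τ - u) (fun _ => (1 : ℝ)),
    integral_highLaw_sub hτ.2, integral_lowLaw_sub hτ.1.le]
  simp only [integral_const, smul_eq_mul, mul_one, Measure.real]
  rw [lowLaw_univ h1, highLaw_univ hτ.2, ENNReal.toReal_ofReal (by positivity),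
    ENNReal.toReal_ofReal (by positivity)]

/-- The expected length of the interval between the knots around `τ`. -/
lemma knotMean_gap_le (hτ : τ ∈ Ioo (0 : ℝ) 1) (n : ℕ) :
    knotMean n τ (fun _ z => z.2 - z.1) ≤ 2 / (n + 1) := by
  have h1 := hτ.1.le
  have h2 : 0 ≤ 1 - τ := sub_nonneg.2 hτ.2.le
  have hbin : ∑ j ∈ Finset.range (n + 1 + 1),
      τ ^ j * (1 - τ) ^ (n + 1 - j) * ((n + 1).choose j : ℝ) = 1 := by
    rw [← add_pow]
    simp
  -- The part of the gap above `τ`. Since `n.choose j / (n - j + 1) = (n + 1).choose j / (n + 1)`,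
  -- the sum is a binomial expansion of order `n + 1` without its last term, divided by `n + 1`.
  have hA : ∑ j ∈ Finset.range (n + 1),
      (n.choose j : ℝ) * (τ ^ j * ((1 - τ) ^ (n - j + 1) / ((n - j : ℕ) + 1))) ≤ 1 / (n + 1) := by
    have : ∀ j ∈ Finset.range (n + 1),
        (n.choose j : ℝ) * (τ ^ j * ((1 - τ) ^ (n - j + 1) / ((n - j : ℕ) + 1)))
          = τ ^ j * (1 - τ) ^ (n + 1 - j) * ((n + 1).choose j : ℝ) / (n + 1) := by
      intro j hj
      have hj' : j ≤ n := by simpa [Nat.lt_succ_iff] using hj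
      have h := Nat.choose_mul_succ_eq n j
      rw [Nat.succ_sub hj'] at h ⊢
      have h' : (n.choose j : ℝ) * (n + 1) = (n + 1).choose j * ((n - j : ℕ) + 1) := by
        exact_mod_cast h
      field_simp
      linear_combination (τ ^ j * (1 - τ) ^ (n - j + 1)) * h'
    rw [Finset.sum_congr rfl this, ← Finset.sum_div]
    refine div_le_div_of_nonneg_right ?_ (by positivity)
    have hbin := hbin
    rw [Finset.sum_range_succ _ (n + 1)] at hbin
    have : 0 ≤ τ ^ (n + 1) * (1 - τ) ^ (n + 1 - (n + 1)) * ((n + 1).choose (n + 1) : ℝ) := by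
      positivity
    linarith
  -- The part below `τ`. Here `n.choose j / (j + 1) = (n + 1).choose (j + 1) / (n + 1)`, and the
  -- term of index `0` is the missing one.
  have hB : ∑ j ∈ Finset.range (n + 1),
      (n.choose j : ℝ) * (τ ^ (j + 1) / (j + 1) * (1 - τ) ^ (n - j)) ≤ 1 / (n + 1) := by
    have : ∀ j ∈ Finset.range (n + 1),
        (n.choose j : ℝ) * (τ ^ (j + 1) / (j + 1) * (1 - τ) ^ (n - j))
          = τ ^ (j + 1) * (1 - τ) ^ (n + 1 - (j + 1)) * ((n + 1).choose (j + 1) : ℝ)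
            / (n + 1) := by
      intro j hj
      have h := Nat.add_one_mul_choose_eq n j
      have h' : ((n : ℝ) + 1) * n.choose j = (n + 1).choose (j + 1) * (j + 1) := by
        exact_mod_cast h
      rw [Nat.add_sub_add_right]
      field_simp
      linear_combination (τ ^ (j + 1) * (1 - τ) ^ (n - j)) * h'
    rw [Finset.sum_congr rfl this, ← Finset.sum_div]
    refine div_le_div_of_nonneg_right ?_ (by positivity)
    have hbin := hbin
    rw [Finset.sum_range_succ' _ (n + 1)] at hbin
    have : 0 ≤ τ ^ 0 * (1 - τ) ^ (n + 1 - 0) * ((n + 1).choose 0 : ℝ) := by positivity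
    linarith
  unfold knotMean
  simp_rw [integral_pairLaw_gap hτ, mul_add, Finset.sum_add_distrib]
  calc _ ≤ 1 / ((n : ℝ) + 1) + 1 / (n + 1) := add_le_add hA hB
    _ = 2 / (n + 1) := by ring

/-- The expectation of `c j`, where `j` is the number of sample points up to `τ`. -/
def countMean (n : ℕ) (τ : ℝ) (c : ℕ → ℝ) : ℝ :=
  ∑ j ∈ Finset.range (n + 1), (n.choose j : ℝ) * (τ ^ j * (1 - τ) ^ (n - j) * c j)

lemma knotMean_const (hτ : τ ∈ Ioo (0 : ℝ) 1) (n : ℕ) (c : ℕ → ℝ) :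
    knotMean n τ (fun j _ => c j) = countMean n τ c := by
  unfold knotMean countMean
  simp_rw [integral_const, pairLaw_real_univ hτ, smul_eq_mul]

lemma countMean_one (τ : ℝ) (n : ℕ) : countMean n τ (fun _ => 1) = 1 := by
  unfold countMean
  have : ∑ j ∈ Finset.range (n + 1), τ ^ j * (1 - τ) ^ (n - j) * (n.choose j : ℝ) = 1 := by
    rw [← add_pow]
    simp
  refine Eq.trans (Finset.sum_congr rfl fun j _ => ?_) this
  ring

/-- The weights are Bernstein polynomials evaluated at `τ`, whose first two factorial moments are
known identities. -/
lemma countMean_id (τ : ℝ) (n : ℕ) : countMean n τ (fun j => j) = n * τ := by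
  have h := congrArg (Polynomial.eval τ) (bernsteinPolynomial.sum_smul ℝ n)
  simp only [bernsteinPolynomial, Polynomial.eval_finsetSum,
    Polynomial.eval_mul, Polynomial.eval_pow, Polynomial.eval_X, Polynomial.eval_sub,
    Polynomial.eval_one, Polynomial.eval_natCast, nsmul_eq_mul] at h
  rw [← h]
  exact Finset.sum_congr rfl fun j _ => by ring

lemma countMean_sq (τ : ℝ) (n : ℕ) :
    countMean n τ (fun j => (j : ℝ) ^ 2) = n * (n - 1) * τ ^ 2 + n * τ := by
  have h := congrArg (Polynomial.eval τ) (bernsteinPolynomial.sum_mul_smul ℝ n)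
  simp only [bernsteinPolynomial, Polynomial.eval_finsetSum,
    Polynomial.eval_mul, Polynomial.eval_pow, Polynomial.eval_X, Polynomial.eval_sub,
    Polynomial.eval_one, Polynomial.eval_natCast, nsmul_eq_mul] at h
  -- The truncated subtraction at `j = 0` is harmless because of the factor `j`.
  have hc : ∀ j : ℕ, ((j * (j - 1) : ℕ) : ℝ) = (j : ℝ) * (j - 1) := fun j => by
    rcases j with _ | j <;> simp
  simp_rw [hc] at h
  rw [← h, ← countMean_id τ n, countMean, countMean, ← Finset.sum_add_distrib]
  exact Finset.sum_congr rfl fun j _ => by ring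

lemma countMean_add (n : ℕ) (c d : ℕ → ℝ) :
    countMean n τ (fun j => c j + d j) = countMean n τ c + countMean n τ d := by
  unfold countMean
  rw [← Finset.sum_add_distrib]
  exact Finset.sum_congr rfl fun j _ => by ring

lemma countMean_mul (n : ℕ) (r : ℝ) (c : ℕ → ℝ) :
    countMean n τ (fun j => r * c j) = r * countMean n τ c := by
  unfold countMean
  rw [Finset.mul_sum]
  exact Finset.sum_congr rfl fun j _ => by ring

/-- A function of the knots that is close to a function of the number of sample points up to
`τ`. -/
theorem abs_knotMean_sub_countMean_le (hτ : τ ∈ Ioo (0 : ℝ) 1) {n : ℕ} {G : ℕ → ℝ × ℝ → ℝ}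
    (hG : ∀ j ≤ n, Measurable (G j)) {C : ℝ}
    (hC : ∀ j ≤ n, ∀ u ∈ Icc 0 τ, ∀ v ∈ Ioc τ 1, |G j (u, v)| ≤ C) {c : ℕ → ℝ} {δ K : ℝ}
    (hK : 0 ≤ K)
    (hGc : ∀ j ≤ n, ∀ u ∈ Icc 0 τ, ∀ v ∈ Ioc τ 1, |G j (u, v) - c j| ≤ δ + K * (v - u)) :
    |knotMean n τ G - countMean n τ c| ≤ δ + K * (2 / (n + 1)) := by
  have h0 : δ + K * (2 / (n + 1)) ≥ δ + K * knotMean n τ (fun _ z => z.2 - z.1) := by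
    have := mul_le_mul_of_nonneg_left (knotMean_gap_le hτ n) hK
    linarith
  refine le_trans ?_ h0
  have hδ : δ = ∑ j ∈ Finset.range (n + 1), (n.choose j : ℝ) * (τ ^ j * (1 - τ) ^ (n - j) * δ) := by
    have := countMean_mul (τ := τ) n δ (fun _ => 1)
    rw [countMean_one, mul_one] at this
    simpa [countMean] using this.symm
  rw [← knotMean_const hτ, knotMean, knotMean, knotMean, ← Finset.sum_sub_distrib]
  refine (Finset.abs_sum_le_sum_abs _ _).trans ?_
  -- With `δ` written as a binomial average of itself, the two sums can be compared term by term.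
  conv_rhs => rw [hδ]
  rw [Finset.mul_sum, ← Finset.sum_add_distrib]
  refine Finset.sum_le_sum fun j hj => ?_
  have hj' : j ≤ n := by simpa [Nat.lt_succ_iff] using hj
  have := isFiniteMeasure_pairLaw hτ j (n - j)
  have hI := integrable_pairLaw hτ (hG j hj') (hC j hj') j (n - j)
  have hgap : Integrable (fun z : ℝ × ℝ => z.2 - z.1) (pairLaw τ j (n - j)) := by
    refine integrable_pairLaw hτ (by fun_prop) (C := 1) (fun u hu v hv => ?_) j (n - j)
    rw [abs_le]
    constructor <;> linarith [hu.1, hu.2, hv.1, hv.2]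
  rw [← mul_sub, abs_mul, abs_of_nonneg (Nat.cast_nonneg _), ← integral_sub hI (integrable_const _)]
  have hle : |∫ z, (G j z - c j) ∂(pairLaw τ j (n - j))|
      ≤ ∫ z, (δ + K * (z.2 - z.1)) ∂(pairLaw τ j (n - j)) := by
    refine (abs_integral_le_integral_abs).trans (integral_mono_ae
      (hI.sub (integrable_const _)).abs ((integrable_const _).add (hgap.const_mul K)) ?_)
    filter_upwards [ae_pairLaw hτ j (n - j)] with z hz using hGc j hj' _ hz.1 _ hz.2
  rw [integral_add (integrable_const _) (hgap.const_mul K), integral_const, integral_const_mul,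
    pairLaw_real_univ hτ, smul_eq_mul] at hle
  calc _ ≤ (n.choose j : ℝ) * _ := mul_le_mul_of_nonneg_left hle (Nat.cast_nonneg _)
    _ = _ := by ring

/-! ### From the product laws to iterated integrals. -/

/-- The binomial factor and the constants of the two marginal densities combine to the constant of
`pairDensity`. -/
lemma choose_mul_mul_eq {n j : ℕ} (hj : 1 ≤ j) (hjn : j + 1 ≤ n) :
    (n.choose j : ℝ) * (j * (n - j : ℕ))
      = (n.factorial : ℝ) / ((j - 1).factorial * (n - j - 1).factorial) := by
  obtain ⟨i, rfl⟩ := Nat.exists_eq_add_of_le' hj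
  obtain ⟨k, rfl⟩ := Nat.exists_eq_add_of_le' hjn
  have h1 : k + (i + 1 + 1) - (i + 1) = k + 1 := by omega
  have h := Nat.choose_mul_factorial_mul_factorial (by omega : i + 1 ≤ k + (i + 1 + 1))
  rw [h1] at h ⊢
  simp only [add_tsub_cancel_right]
  rw [eq_div_iff (by positivity), ← h]
  simp only [Nat.factorial_succ]
  push_cast
  ring

lemma integral_pairLaw_eq (hτ : τ ∈ Ioo (0 : ℝ) 1) {n j : ℕ} (hj : 1 ≤ j) (hjn : j + 1 ≤ n)
    {g : ℝ × ℝ → ℝ} (hg : Integrable g (pairLaw τ j (n - j))) :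
    (n.choose j : ℝ) * ∫ z, g z ∂(pairLaw τ j (n - j))
      = ∫ u in (0 : ℝ)..τ, ∫ v in τ..1, g (u, v) * pairDensity n j u v := by
  have := isFiniteMeasure_lowLaw hτ.1.le j
  have := isFiniteMeasure_highLaw hτ.2 (n - j)
  rw [pairLaw] at hg ⊢
  rw [integral_prod _ hg, integral_lowLaw hτ.1.le (by omega), ← intervalIntegral.integral_const_mul]
  congr 1
  ext u
  rw [integral_highLaw hτ.2.le (by omega), ← intervalIntegral.integral_mul_const,
    ← intervalIntegral.integral_const_mul]
  congr 1
  ext v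
  rw [pairDensity, ← choose_mul_mul_eq hj hjn]
  ring

/-- Both orders of integration are needed: the BK closed forms have `v` as outer variable, the CDF
ones have `u`. -/
lemma integral_pairLaw_eq_swap (hτ : τ ∈ Ioo (0 : ℝ) 1) {n j : ℕ} (hj : 1 ≤ j) (hjn : j + 1 ≤ n)
    {g : ℝ × ℝ → ℝ} (hg : Integrable g (pairLaw τ j (n - j))) :
    (n.choose j : ℝ) * ∫ z, g z ∂(pairLaw τ j (n - j))
      = ∫ v in τ..1, ∫ u in (0 : ℝ)..τ, g (u, v) * pairDensity n j u v := by
  have := isFiniteMeasure_lowLaw hτ.1.le j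
  have := isFiniteMeasure_highLaw hτ.2 (n - j)
  rw [pairLaw] at hg ⊢
  rw [integral_prod_symm _ hg, integral_highLaw hτ.2.le (by omega),
    ← intervalIntegral.integral_const_mul]
  congr 1
  ext v
  rw [integral_lowLaw hτ.1.le (by omega), ← intervalIntegral.integral_mul_const,
    ← intervalIntegral.integral_const_mul]
  congr 1
  ext u
  rw [pairDensity, ← choose_mul_mul_eq hj hjn]
  ring

lemma integral_pairLaw_zero (hτ : τ ∈ Ioo (0 : ℝ) 1) {n : ℕ} (hn : 1 ≤ n) {g : ℝ × ℝ → ℝ}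
    (hg : Integrable g (pairLaw τ 0 n)) :
    ∫ z, g z ∂(pairLaw τ 0 n) = ∫ v in τ..1, g (0, v) * (n * (1 - v) ^ (n - 1)) := by
  have := isFiniteMeasure_highLaw hτ.2 n
  rw [pairLaw, lowLaw_zero] at hg ⊢
  rw [integral_prod _ hg, integral_dirac, integral_highLaw hτ.2.le (by omega)]

lemma integral_pairLaw_last (hτ : τ ∈ Ioo (0 : ℝ) 1) {n : ℕ} (hn : 1 ≤ n) {g : ℝ × ℝ → ℝ}
    (hg : Integrable g (pairLaw τ n 0)) :
    ∫ z, g z ∂(pairLaw τ n 0) = ∫ u in (0 : ℝ)..τ, g (u, 1) * (n * u ^ (n - 1)) := by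
  have := isFiniteMeasure_lowLaw hτ.1.le n
  rw [pairLaw, highLaw_zero] at hg ⊢
  rw [integral_prod_symm _ hg, integral_dirac, integral_lowLaw hτ.1.le (by omega)]

lemma sum_range_succ_eq_Icc {n : ℕ} (hn : 1 ≤ n) (f : ℕ → ℝ) :
    ∑ j ∈ Finset.range (n + 1), f j = f 0 + ∑ j ∈ Finset.Icc 1 (n - 1), f j + f n := by
  obtain ⟨k, rfl⟩ := Nat.exists_eq_add_of_le' hn
  rw [Finset.sum_range_succ, Finset.sum_range_succ', Nat.add_sub_cancel, add_comm (f 0),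
    Finset.range_eq_Ico, Finset.sum_Ico_add' f 0 k 1]
  rfl

lemma knotMean_eq (hτ : τ ∈ Ioo (0 : ℝ) 1) {n : ℕ} (hn : 1 ≤ n) {G : ℕ → ℝ × ℝ → ℝ}
    (hG : ∀ j ≤ n, Integrable (G j) (pairLaw τ j (n - j))) :
    knotMean n τ G = (∫ v in τ..1, G 0 (0, v) * (n * (1 - v) ^ (n - 1)))
      + (∑ j ∈ Finset.Icc 1 (n - 1), (n.choose j : ℝ) * ∫ z, G j z ∂(pairLaw τ j (n - j)))
      + ∫ u in (0 : ℝ)..τ, G n (u, 1) * (n * u ^ (n - 1)) := by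
  have h0 := hG 0 (Nat.zero_le n)
  have hl := hG n le_rfl
  rw [Nat.sub_zero] at h0
  rw [Nat.sub_self] at hl
  rw [knotMean, sum_range_succ_eq_Icc hn, Nat.sub_zero, Nat.sub_self, Nat.choose_zero_right,
    Nat.choose_self, integral_pairLaw_zero hτ hn h0, integral_pairLaw_last hτ hn hl]
  simp

/-! ### The BK process -/

/-- The extension of a function on `[0,1]` that is constant on both sides. -/
def clampExtend (φ : ℝ → ℝ) (x : ℝ) : ℝ := φ (max 0 (min x 1))

lemma clamp_mem (x : ℝ) : max 0 (min x 1) ∈ Icc (0 : ℝ) 1 :=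
  ⟨le_max_left _ _, max_le zero_le_one (min_le_right _ _)⟩

lemma clampExtend_eq (φ : ℝ → ℝ) {x : ℝ} (hx : x ∈ Icc (0 : ℝ) 1) : clampExtend φ x = φ x := by
  rw [clampExtend, min_eq_left hx.2, max_eq_right hx.1]

/-- Off `[0, 1]` the function `φ` is arbitrary, possibly not measurable. Its clamped version is
continuous and monotone on the line and may replace `φ` because all knots lie in `[0, 1]`. -/
lemma IsACWarping.continuous_clampExtend {φ : ℝ → ℝ} (hφ : IsACWarping φ) :
    Continuous (clampExtend φ) :=
  hφ.continuousOn.comp_continuous (by fun_prop) clamp_mem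

lemma IsACWarping.monotone_clampExtend {φ : ℝ → ℝ} (hφ : IsACWarping φ) :
    Monotone (clampExtend φ) := fun x y hxy =>
  hφ.strictMonoOn.monotoneOn (clamp_mem x) (clamp_mem y)
    (max_le_max le_rfl (min_le_min_right 1 hxy))

lemma IsACWarping.mem_Icc {φ : ℝ → ℝ} (hφ : IsACWarping φ) {x : ℝ} (hx : x ∈ Icc (0 : ℝ) 1) :
    φ x ∈ Icc (0 : ℝ) 1 := by
  have h0 := hφ.strictMonoOn.monotoneOn ⟨le_rfl, zero_le_one⟩ hx hx.1
  have h1 := hφ.strictMonoOn.monotoneOn hx ⟨zero_le_one, le_rfl⟩ hx.2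
  rw [hφ.map_zero] at h0
  rw [hφ.map_one] at h1
  exact ⟨h0, h1⟩

lemma IsACWarping.clampExtend_mem {φ : ℝ → ℝ} (hφ : IsACWarping φ) (x : ℝ) :
    clampExtend φ x ∈ Icc (0 : ℝ) 1 := hφ.mem_Icc (clamp_mem x)

/-- Absolute continuity supplies the fundamental theorem of calculus, which turns an almost
everywhere bound on the derivative into a Lipschitz bound. -/
lemma IsACWarping.exists_sub_le {φ : ℝ → ℝ} (hφ : IsACWarping φ) (hd : HasBoundedDeriv φ) :
    ∃ L : ℝ, 0 ≤ L ∧ ∀ u ∈ Icc (0 : ℝ) 1, ∀ v ∈ Icc (0 : ℝ) 1, u ≤ v →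
      φ v - φ u ≤ L * (v - u) := by
  obtain ⟨L, hL⟩ := hd
  refine ⟨max L 0, le_max_right _ _, fun u hu v hv huv => ?_⟩
  have hac : AbsolutelyContinuousOnInterval φ u v :=
    hφ.absolutelyContinuous.mono (by
      rw [uIcc_of_le huv, uIcc_of_le zero_le_one]
      exact Icc_subset_Icc hu.1 hv.2)
  have hle : ∫ x in u..v, deriv φ x ≤ ∫ _ in u..v, max L 0 := by
    refine intervalIntegral.integral_mono_ae_restrict huv hac.intervalIntegrable_deriv
      intervalIntegrable_const ?_
    -- The end points are dropped because the derivative is controlled only inside `(0, 1)`.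
    rw [← restrict_Ioo_eq_restrict_Icc]
    have := hac.ae_differentiableAt
    filter_upwards [ae_restrict_of_ae this, ae_restrict_mem measurableSet_Ioo] with x h1 h2
    have h3 := h1 (by rw [uIcc_of_le huv]; exact Ioo_subset_Icc_self h2)
    exact (hL ⟨x, ⟨⟨hu.1.trans_lt h2.1, h2.2.trans_le hv.2⟩, h3⟩, rfl⟩).trans (le_max_left _ _)
  rw [hac.integral_deriv_eq_sub, intervalIntegral.integral_const, smul_eq_mul] at hle
  linarith

lemma ratio_mem_Icc {t u v : ℝ} (hu : u ≤ t) (hv : t < v) : (t - u) / (v - u) ∈ Icc (0 : ℝ) 1 :=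
  ⟨div_nonneg (by linarith) (by linarith), (div_le_one (by linarith)).2 (by linarith)⟩

/-- The coefficients of the Dirichlet weights in the BK process. -/
def bkCoeff (n : ℕ) (t : ℝ) (j : ℕ) (z : ℝ × ℝ) (i : Fin (n + 1)) : ℝ :=
  if (i : ℕ) < j then 1 else if (i : ℕ) = j then (t - z.1) / (z.2 - z.1) else 0

/-- The conditional mean of the BK process, given the two knots around `t`. -/
def bkCondMean (φ : ℝ → ℝ) (t : ℝ) (z : ℝ × ℝ) : ℝ :=
  clampExtend φ z.1
    + (t - z.1) / (z.2 - z.1) * (clampExtend φ z.2 - clampExtend φ z.1)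

/-- The mean of the squared coefficients of the BK process, given the two knots around `t`. -/
def bkCondSq (φ : ℝ → ℝ) (t : ℝ) (z : ℝ × ℝ) : ℝ :=
  clampExtend φ z.1
    + ((t - z.1) / (z.2 - z.1)) ^ 2 * (clampExtend φ z.2 - clampExtend φ z.1)

/-- Entry `i` of the weights is the increment over `[U*_i, U*_{i+1}]`: it counts fully for `i < j`,
in proportion `r` for `i = j`, and not at all beyond. -/
lemma sum_ite_lt_mul {n j : ℕ} (hj : j ≤ n) (r : ℝ) (b : ℕ → ℝ) :
    ∑ i : Fin (n + 1), (if (i : ℕ) < j then 1 else if (i : ℕ) = j then r else 0) * b i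
      = ∑ i ∈ Finset.range j, b i + r * b j := by
  rw [Fin.sum_univ_eq_sum_range
    (fun i => (if i < j then 1 else if i = j then r else 0) * b i) (n + 1),
    ← Finset.sum_subset (Finset.range_subset_range.2 (by omega : j + 1 ≤ n + 1)),
    Finset.sum_range_succ]
  · congr 1
    · exact Finset.sum_congr rfl fun i hi => by simp [Finset.mem_range.1 hi]
    · simp
  · intro i _ hi
    rw [Finset.mem_range, not_lt] at hi
    rw [if_neg (by omega), if_neg (by omega), zero_mul]

lemma extendZero_zero {m : ℕ} (a : Fin m → ℝ) : extendZero a 0 = 0 := if_pos rfl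

lemma extendZero_succ {m : ℕ} (a : Fin m → ℝ) (i : Fin m) : extendZero a (i + 1) = a i := by
  simp [extendZero]

lemma extendZero_of_lt {m : ℕ} (a : Fin m → ℝ) {j : ℕ} (hj : m < j) : extendZero a j = 0 := by
  unfold extendZero
  split_ifs <;> first | rfl | omega

lemma measurable_extendZero {m : ℕ} (j : ℕ) : Measurable fun a : Fin m → ℝ => extendZero a j := by
  unfold extendZero
  split_ifs <;> fun_prop

section BK

variable {φ : ℝ → ℝ} {t : ℝ}

lemma measurable_bkCondMean (hφ : IsACWarping φ) : Measurable (bkCondMean φ t) := by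
  have := hφ.continuous_clampExtend.measurable
  unfold bkCondMean
  fun_prop

lemma measurable_bkCondSq (hφ : IsACWarping φ) : Measurable (bkCondSq φ t) := by
  have := hφ.continuous_clampExtend.measurable
  unfold bkCondSq
  fun_prop

/-- The conditional mean is a convex combination of the two end values. This enclosure gives both
the uniform bound and the rate; the next lemma has the squared ratio as weight. -/
lemma bkCondMean_mem (hφ : IsACWarping φ) {u v : ℝ} (hu : u ≤ t) (hv : t < v) :
    bkCondMean φ t (u, v) ∈ Icc (clampExtend φ u) (clampExtend φ v) := by
  have hm := hφ.monotone_clampExtend (hu.trans hv.le)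
  have hr := ratio_mem_Icc hu hv
  constructor <;> dsimp only [bkCondMean] <;> nlinarith [hr.1, hr.2]

lemma bkCondSq_mem (hφ : IsACWarping φ) {u v : ℝ} (hu : u ≤ t) (hv : t < v) :
    bkCondSq φ t (u, v) ∈ Icc (clampExtend φ u) (clampExtend φ v) := by
  have hm := hφ.monotone_clampExtend (hu.trans hv.le)
  have hr := ratio_mem_Icc hu hv
  have h1 := pow_le_one₀ (n := 2) hr.1 hr.2
  have h0 := sq_nonneg ((t - u) / (v - u))
  constructor <;> dsimp only [bkCondSq] <;> nlinarith

theorem bk_moments (hφ : IsACWarping φ) (ht : t ∈ Ioo (0 : ℝ) 1) {θ : ℝ} (hθ : 0 < θ)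
    {Ω : Type*} [MeasurableSpace Ω] {P : Measure Ω} [IsProbabilityMeasure P] {n : ℕ}
    {U : Ω → Fin n → ℝ} {α : Ω → Fin (n + 1) → ℝ} (h : IsBKSample n θ φ U α P) :
    MemLp (fun ω => bkPath (U ω) (α ω) t) 2 P ∧
    ∫ ω, bkPath (U ω) (α ω) t ∂P = knotMean n t (fun _ => bkCondMean φ t) ∧
    ∫ ω, bkPath (U ω) (α ω) t ^ 2 ∂P = knotMean n t fun _ z =>
      1 / (1 + θ) * bkCondSq φ t z + (1 - 1 / (1 + θ)) * bkCondMean φ t z ^ 2 := by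
  have hS : Measurable fun ω => sorted (U ω) := measurable_sorted.comp h.measurable_U
  have hmap := map_sorted_eq h.measurable_U h.iIndep h.uniform
  have hlaw := compProd_map_condDistrib (mβ := MeasurableSpace.pi)
    (X := fun ω => sorted (U ω)) (μ := P)
    h.measurable_weights.aemeasurable
  have hcond := h.condLaw
  rw [hmap] at hlaw hcond
  have hψ0 : clampExtend φ 0 = 0 := by
    rw [clampExtend_eq φ ⟨le_rfl, zero_le_one⟩, hφ.map_zero]
  have hψ1 : clampExtend φ 1 = 1 := by
    rw [clampExtend_eq φ ⟨zero_le_one, le_rfl⟩, hφ.map_one]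
  -- The means `μ s i` are increments of `φ`, so the full coefficients telescope. Taking for `r` the
  -- ratio gives `M`, taking its square gives `N`.
  have hsum : ∀ (s : Fin n → ℝ) (r : ℝ) (j : ℕ), j ≤ n →
      ∑ i : Fin (n + 1), (if (i : ℕ) < j then 1 else if (i : ℕ) = j then r else 0)
        * (clampExtend φ (knots s (i + 1)) - clampExtend φ (knots s i))
      = clampExtend φ (knots s j)
        + r * (clampExtend φ (knots s (j + 1)) - clampExtend φ (knots s j)) := by
    intro s r j hj
    rw [sum_ite_lt_mul hj r
      fun i => clampExtend φ (knots s (i + 1)) - clampExtend φ (knots s i),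
      Finset.sum_range_sub (fun i => clampExtend φ (knots s i)), knots_zero, hψ0, sub_zero]
  refine moments_of_dirichlet (m := n + 1) hS h.measurable_weights hlaw.symm hθ ht
    (μ := fun s i => clampExtend φ (knots s (i + 1)) - clampExtend φ (knots s i))
    (H := fun z => interpolate n (knots z.1) (extendZero z.2) t) (w := bkCoeff n t)
    (M := fun _ => bkCondMean φ t) (N := fun _ => bkCondSq φ t) ?_ ?_ ?_ ?_ ?_
    (fun _ _ => measurable_bkCondMean hφ) (fun _ _ => measurable_bkCondSq hφ) ?_ ?_ ?_ ?_
  · filter_upwards [hcond, ae_knots] with s h1 h2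
    rw [h1]
    congr 1
    ext i
    rw [bkParam, clampExtend_eq φ (h2.2 _), clampExtend_eq φ (h2.2 _)]
  · filter_upwards [ae_sortedLaw, ae_knots] with s h1 h2
    constructor
    · intro i
      rw [clampExtend_eq φ (h2.2 _), clampExtend_eq φ (h2.2 _), sub_pos]
      refine hφ.strictMonoOn (h2.2 _) (h2.2 _) ?_
      rcases i with ⟨i, hi⟩
      simp only
      rcases i with _ | i
      · rw [knots_zero]
        rcases n.eq_zero_or_pos with rfl | hn
        · rw [knots_last]
          exact zero_lt_one
        · rw [knots_succ s ⟨0, hn⟩]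
          exact (h1.2 _).1
      · have hi' : i < n := by omega
        rw [knots_succ s ⟨i, hi'⟩]
        rcases (show i + 1 ≤ n from hi').lt_or_eq with h3 | h3
        · rw [knots_succ s ⟨i + 1, h3⟩]
          exact h1.1 (by simp)
        · rw [h3, knots_last]
          exact (h1.2 _).2
    · rw [Fin.sum_univ_eq_sum_range
        (fun i => clampExtend φ (knots s (i + 1)) - clampExtend φ (knots s i)) (n + 1),
        Finset.sum_range_sub (fun i => clampExtend φ (knots s i)), knots_zero, knots_last,
        hψ0, hψ1, sub_zero]
  · exact measurable_interpolate n (fun j => (measurable_knots j).comp measurable_fst)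
      (fun j => (measurable_extendZero j).comp measurable_snd) t
  · intro j _ u hu v hv i
    unfold bkCoeff
    split_ifs
    · simp
    · exact ratio_mem_Icc hu.2 hv.1
    · simp
  · filter_upwards [ae_knots] with s hs j hj hsj x
    rw [interpolate_eq ht.2.ne hj hsj.1 hsj.2 (fun i k hik _ => hs.1 hik)]
    have : ∀ i : Fin (n + 1), x i = extendZero x ((i : ℕ) + 1) := fun i =>
      (extendZero_succ x i).symm
    simp_rw [this, bkCoeff]
    rw [sum_ite_lt_mul hj _ (fun i => extendZero x (i + 1)), Finset.sum_range_succ',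
      extendZero_zero, add_zero, mul_comm]
  · intro j _ u hu v hv
    have := bkCondMean_mem hφ hu.2 hv.1
    rw [abs_le]
    constructor <;> linarith [this.1, this.2, (hφ.clampExtend_mem u).1, (hφ.clampExtend_mem v).2]
  · intro j _ u hu v hv
    have := bkCondSq_mem hφ hu.2 hv.1
    rw [abs_le]
    constructor <;> linarith [this.1, this.2, (hφ.clampExtend_mem u).1, (hφ.clampExtend_mem v).2]
  · filter_upwards with s j hj hsj using hsum s _ j hj
  · filter_upwards with s j hj hsj
    rw [bkCondSq, ← hsum s _ j hj]
    refine Finset.sum_congr rfl fun i _ => ?_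
    congr 1
    unfold bkCoeff
    split_ifs <;> simp

end BK

/-! ### The closed forms for the BK process -/

lemma integral_pairLaw_eq_swap_of_eqOn {τ : ℝ} (hτ : τ ∈ Ioo (0 : ℝ) 1) {n j : ℕ} (hj : 1 ≤ j)
    (hjn : j + 1 ≤ n) {g : ℝ × ℝ → ℝ} (hg : Integrable g (pairLaw τ j (n - j)))
    {f : ℝ → ℝ → ℝ} (hf : ∀ u ∈ Icc 0 τ, ∀ v ∈ Icc τ 1, f u v = g (u, v)) :
    (n.choose j : ℝ) * ∫ z, g z ∂(pairLaw τ j (n - j))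
      = ∫ v in τ..1, ∫ u in (0 : ℝ)..τ, f u v * pairDensity n j u v := by
  rw [integral_pairLaw_eq_swap hτ hj hjn hg]
  refine intervalIntegral.integral_congr fun v hv => ?_
  refine intervalIntegral.integral_congr fun u hu => ?_
  rw [uIcc_of_le hτ.1.le] at hu
  rw [uIcc_of_le hτ.2.le] at hv
  simp only [hf u hu v hv]

section BK

variable {φ : ℝ → ℝ} {t : ℝ}

lemma IsACWarping.clampExtend_zero (hφ : IsACWarping φ) : clampExtend φ 0 = 0 := by
  rw [clampExtend_eq φ ⟨le_rfl, zero_le_one⟩, hφ.map_zero]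

lemma IsACWarping.clampExtend_one (hφ : IsACWarping φ) : clampExtend φ 1 = 1 := by
  rw [clampExtend_eq φ ⟨zero_le_one, le_rfl⟩, hφ.map_one]

lemma mem_Icc_of_mem_left (ht : t ∈ Ioo (0 : ℝ) 1) {u : ℝ} (hu : u ∈ Icc 0 t) :
    u ∈ Icc (0 : ℝ) 1 := ⟨hu.1, hu.2.trans ht.2.le⟩

lemma mem_Icc_of_mem_right (ht : t ∈ Ioo (0 : ℝ) 1) {v : ℝ} (hv : v ∈ Icc t 1) :
    v ∈ Icc (0 : ℝ) 1 := ⟨ht.1.le.trans hv.1, hv.2⟩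

lemma integrable_bkCondMean (hφ : IsACWarping φ) (ht : t ∈ Ioo (0 : ℝ) 1) (j k : ℕ) :
    Integrable (bkCondMean φ t) (pairLaw t j k) :=
  integrable_pairLaw ht (measurable_bkCondMean hφ) (C := 1) (fun u hu v hv => by
    have := bkCondMean_mem hφ hu.2 hv.1
    rw [abs_le]
    constructor <;> linarith [this.1, this.2, (hφ.clampExtend_mem u).1,
      (hφ.clampExtend_mem v).2]) j k

lemma bkCondMean_zero (hφ : IsACWarping φ) {v : ℝ} (hv : v ∈ Icc (0 : ℝ) 1) :
    bkCondMean φ t (0, v) = t / v * φ v := by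
  simp only [bkCondMean, hφ.clampExtend_zero, clampExtend_eq φ hv]
  ring

lemma bkCondSq_zero (hφ : IsACWarping φ) {v : ℝ} (hv : v ∈ Icc (0 : ℝ) 1) :
    bkCondSq φ t (0, v) = (t / v) ^ 2 * φ v := by
  simp only [bkCondSq, hφ.clampExtend_zero, clampExtend_eq φ hv]
  ring

lemma bkCondMean_last (hφ : IsACWarping φ) {u : ℝ} (hu : u ∈ Ico (0 : ℝ) 1) :
    bkCondMean φ t (u, 1) = 1 - (1 - φ u) * ((1 - t) / (1 - u)) := by
  have : 1 - u ≠ 0 := (sub_pos.2 hu.2).ne'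
  simp only [bkCondMean, hφ.clampExtend_one, clampExtend_eq φ (Ico_subset_Icc_self hu)]
  field_simp
  ring

lemma bkCondSq_last (hφ : IsACWarping φ) {u : ℝ} (hu : u ∈ Ico (0 : ℝ) 1) :
    bkCondSq φ t (u, 1) = 1 - 2 * ((1 - φ u) * ((1 - t) / (1 - u)))
      + ((1 - t) / (1 - u)) ^ 2 * (1 - φ u) := by
  have : 1 - u ≠ 0 := (sub_pos.2 hu.2).ne'
  simp only [bkCondSq, hφ.clampExtend_one, clampExtend_eq φ (Ico_subset_Icc_self hu)]
  field_simp
  ring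

theorem knotMean_bkCondMean (hφ : IsACWarping φ) (ht : t ∈ Ioo (0 : ℝ) 1) {n : ℕ} (hn : 1 ≤ n) :
    knotMean n t (fun _ => bkCondMean φ t) = bkMean n φ t := by
  rw [knotMean_eq ht hn fun j _ => integrable_bkCondMean hφ ht j (n - j), bkMean]
  congr 1
  · congr 1
    · refine intervalIntegral.integral_congr fun v hv => ?_
      rw [uIcc_of_le ht.2.le] at hv
      simp only [bkCondMean_zero hφ (mem_Icc_of_mem_right ht hv)]
    · refine Finset.sum_congr rfl fun j hj => ?_
      rw [Finset.mem_Icc] at hj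
      refine integral_pairLaw_eq_swap_of_eqOn ht hj.1 (by omega)
        (integrable_bkCondMean hφ ht j (n - j))
        (f := fun u v => φ u + (t - u) / (v - u) * (φ v - φ u)) fun u hu v hv => ?_
      simp only [bkCondMean, clampExtend_eq φ (mem_Icc_of_mem_left ht hu),
        clampExtend_eq φ (mem_Icc_of_mem_right ht hv)]
  · refine intervalIntegral.integral_congr fun u hu => ?_
    rw [uIcc_of_le ht.1.le] at hu
    simp only [bkCondMean_last hφ ⟨hu.1, hu.2.trans_lt ht.2⟩]

/-- The conditional second moment of the BK process, given the two knots around `t`. -/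
def bkCondSecond (φ : ℝ → ℝ) (t c : ℝ) (z : ℝ × ℝ) : ℝ :=
  c * bkCondSq φ t z + (1 - c) * bkCondMean φ t z ^ 2

lemma measurable_bkCondSecond (hφ : IsACWarping φ) (c : ℝ) :
    Measurable (bkCondSecond φ t c) :=
  ((measurable_bkCondSq hφ).const_mul c).add (((measurable_bkCondMean hφ).pow_const 2).const_mul _)

lemma abs_bkCondSecond_le (hφ : IsACWarping φ) {c : ℝ} (hc : c ∈ Icc (0 : ℝ) 1) {u v : ℝ}
    (hu : u ≤ t) (hv : t < v) : |bkCondSecond φ t c (u, v)| ≤ 1 := by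
  have h1 := bkCondMean_mem hφ hu hv
  have h2 := bkCondSq_mem hφ hu hv
  have h3 := (hφ.clampExtend_mem u).1
  have h4 := (hφ.clampExtend_mem v).2
  have h5 : bkCondMean φ t (u, v) ^ 2 ≤ 1 := pow_le_one₀ (h3.trans h1.1) (h1.2.trans h4)
  have h6 := sq_nonneg (bkCondMean φ t (u, v))
  rw [abs_le, bkCondSecond]
  constructor <;> nlinarith [hc.1, hc.2, h2.1, h2.2]

theorem knotMean_bkCondSecond (hφ : IsACWarping φ) (ht : t ∈ Ioo (0 : ℝ) 1) {θ : ℝ}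
    (hθ : 0 < θ) {n : ℕ} (hn : 1 ≤ n) :
    knotMean n t (fun _ => bkCondSecond φ t (1 / (1 + θ)))
      = bkVar n φ θ t + bkMean n φ t ^ 2 := by
  have hc : 1 / (1 + θ) ∈ Icc (0 : ℝ) 1 :=
    ⟨by positivity, by rw [div_le_one (by linarith)]; linarith⟩
  rw [bkVar]
  -- From here on only `c ∈ [0, 1]` matters, and the identities are polynomial in `c`.
  generalize 1 / (1 + θ) = c at hc ⊢
  rw [knotMean_eq ht hn fun j _ => integrable_pairLaw ht (measurable_bkCondSecond hφ c)
    (fun u hu v hv => abs_bkCondSecond_le hφ hc hu.2 hv.1) j (n - j)]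
  have hcontR : ContinuousOn φ (uIcc t 1) := by
    rw [uIcc_of_le ht.2.le]
    exact hφ.continuousOn.mono fun v hv => mem_Icc_of_mem_right ht hv
  have hcontL : ContinuousOn φ (uIcc 0 t) := by
    rw [uIcc_of_le ht.1.le]
    exact hφ.continuousOn.mono fun u hu => mem_Icc_of_mem_left ht hu
  have hneR : ∀ v ∈ uIcc t 1, v ≠ 0 := fun v hv => by
    rw [uIcc_of_le ht.2.le] at hv
    exact (ht.1.trans_le hv.1).ne'
  have hneL : ∀ u ∈ uIcc 0 t, 1 - u ≠ 0 := fun u hu => by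
    rw [uIcc_of_le ht.1.le] at hu
    exact (sub_pos.2 (hu.2.trans_lt ht.2)).ne'
  have hfirst : ∫ v in t..1, bkCondSecond φ t c (0, v) * (n * (1 - v) ^ (n - 1))
      = c * (∫ u in t..1, (t / u) ^ 2 * φ u * (n * (1 - u) ^ (n - 1)))
        + (1 - c) * (∫ u in t..1, (t / u) ^ 2 * φ u ^ 2 * (n * (1 - u) ^ (n - 1))) := by
    rw [← intervalIntegral.integral_const_mul, ← intervalIntegral.integral_const_mul,
      ← intervalIntegral.integral_add]
    · refine intervalIntegral.integral_congr fun v hv => ?_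
      rw [uIcc_of_le ht.2.le] at hv
      simp only [bkCondSecond, bkCondMean_zero hφ (mem_Icc_of_mem_right ht hv),
        bkCondSq_zero hφ (mem_Icc_of_mem_right ht hv)]
      ring
    · exact ContinuousOn.intervalIntegrable (by fun_prop (disch := assumption))
    · exact ContinuousOn.intervalIntegrable (by fun_prop (disch := assumption))
  have hlast : ∫ u in (0 : ℝ)..t, bkCondSecond φ t c (u, 1) * (n * u ^ (n - 1))
      = t ^ n - 2 * (∫ v in (0 : ℝ)..t, (1 - t) / (1 - v) * (1 - φ v) * (n * v ^ (n - 1)))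
        + c * (∫ v in (0 : ℝ)..t, ((1 - t) / (1 - v)) ^ 2 * (1 - φ v) * (n * v ^ (n - 1)))
        + (1 - c)
          * (∫ v in (0 : ℝ)..t, ((1 - t) / (1 - v)) ^ 2 * (1 - φ v) ^ 2 * (n * v ^ (n - 1))) := by
    rw [← integral_mul_pow_pred (by omega : n ≠ 0) t, ← intervalIntegral.integral_const_mul,
      ← intervalIntegral.integral_const_mul, ← intervalIntegral.integral_const_mul,
      ← intervalIntegral.integral_sub, ← intervalIntegral.integral_add,
      ← intervalIntegral.integral_add]
    · refine intervalIntegral.integral_congr fun u hu => ?_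
      rw [uIcc_of_le ht.1.le] at hu
      have hu' : u ∈ Ico (0 : ℝ) 1 := ⟨hu.1, hu.2.trans_lt ht.2⟩
      simp only [bkCondSecond, bkCondMean_last hφ hu', bkCondSq_last hφ hu']
      ring
    all_goals exact ContinuousOn.intervalIntegrable (by fun_prop (disch := assumption))
  have hmid : ∀ j ∈ Finset.Icc 1 (n - 1),
      (n.choose j : ℝ) * ∫ z, bkCondSecond φ t c z ∂(pairLaw t j (n - j))
      = c * (∫ v in t..1, ∫ u in (0 : ℝ)..t, φ u * pairDensity n j u v)
        + (1 - c) * (∫ v in t..1, ∫ u in (0 : ℝ)..t, φ u ^ 2 * pairDensity n j u v)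
        + 2 * (1 - c) * (∫ v in t..1, ∫ u in (0 : ℝ)..t,
            (t - u) / (v - u) * (φ v - φ u) * φ u * pairDensity n j u v)
        + c * (∫ v in t..1, ∫ u in (0 : ℝ)..t,
            (φ v - φ u) * ((t - u) / (v - u)) ^ 2 * pairDensity n j u v)
        + (1 - c) * (∫ v in t..1, ∫ u in (0 : ℝ)..t,
            (φ v - φ u) ^ 2 * ((t - u) / (v - u)) ^ 2 * pairDensity n j u v) := by
    intro j hj
    rw [Finset.mem_Icc] at hj
    have hjn : j + 1 ≤ n := by omega
    have hψ := hφ.continuous_clampExtend.measurable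
    have hL : ∀ u ∈ Icc 0 t, clampExtend φ u = φ u := fun u hu =>
      clampExtend_eq φ (mem_Icc_of_mem_left ht hu)
    have hR : ∀ v ∈ Icc t 1, clampExtend φ v = φ v := fun v hv =>
      clampExtend_eq φ (mem_Icc_of_mem_right ht hv)
    -- Every factor of the five integrands lies in `[0, 1]`, hence so do the products; the
    -- singularity of the ratio at `u = v = t` lies outside this region.
    have hb : ∀ u ∈ Icc 0 t, ∀ v ∈ Ioc t 1,
        clampExtend φ u ∈ Icc (0 : ℝ) 1 ∧ (t - u) / (v - u) ∈ Icc (0 : ℝ) 1 ∧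
        clampExtend φ v - clampExtend φ u ∈ Icc (0 : ℝ) 1 := fun u hu v hv => by
      refine ⟨hφ.clampExtend_mem u, ratio_mem_Icc hu.2 hv.1,
        sub_nonneg.2 (hφ.monotone_clampExtend (hu.2.trans hv.1.le)), ?_⟩
      linarith [(hφ.clampExtend_mem u).1, (hφ.clampExtend_mem v).2]
    have i1 : Integrable (fun z : ℝ × ℝ => clampExtend φ z.1) (pairLaw t j (n - j)) := by
      refine integrable_pairLaw ht (by fun_prop) (C := 1) (fun u hu v hv => ?_) j (n - j)
      obtain ⟨⟨h1, h2⟩, -⟩ := hb u hu v hv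
      rwa [abs_of_nonneg h1]
    have i2 : Integrable (fun z : ℝ × ℝ => clampExtend φ z.1 ^ 2) (pairLaw t j (n - j)) := by
      refine integrable_pairLaw ht (by fun_prop) (C := 1) (fun u hu v hv => ?_) j (n - j)
      obtain ⟨⟨h1, h2⟩, -⟩ := hb u hu v hv
      rw [abs_of_nonneg (by positivity)]
      exact pow_le_one₀ h1 h2
    have i3 : Integrable (fun z : ℝ × ℝ => (t - z.1) / (z.2 - z.1)
        * (clampExtend φ z.2 - clampExtend φ z.1) * clampExtend φ z.1) (pairLaw t j (n - j)) := by
      refine integrable_pairLaw ht (by fun_prop) (C := 1) (fun u hu v hv => ?_) j (n - j)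
      obtain ⟨⟨h1, h2⟩, ⟨h3, h4⟩, h5, h6⟩ := hb u hu v hv
      rw [abs_of_nonneg (mul_nonneg (mul_nonneg h3 h5) h1)]
      exact mul_le_one₀ (mul_le_one₀ h4 h5 h6) h1 h2
    have i4 : Integrable (fun z : ℝ × ℝ => (clampExtend φ z.2 - clampExtend φ z.1)
        * ((t - z.1) / (z.2 - z.1)) ^ 2) (pairLaw t j (n - j)) := by
      refine integrable_pairLaw ht (by fun_prop) (C := 1) (fun u hu v hv => ?_) j (n - j)
      obtain ⟨-, ⟨h3, h4⟩, h5, h6⟩ := hb u hu v hv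
      rw [abs_of_nonneg (mul_nonneg h5 (sq_nonneg _))]
      exact mul_le_one₀ h6 (sq_nonneg _) (pow_le_one₀ h3 h4)
    have i5 : Integrable (fun z : ℝ × ℝ => (clampExtend φ z.2 - clampExtend φ z.1) ^ 2
        * ((t - z.1) / (z.2 - z.1)) ^ 2) (pairLaw t j (n - j)) := by
      refine integrable_pairLaw ht (by fun_prop) (C := 1) (fun u hu v hv => ?_) j (n - j)
      obtain ⟨-, ⟨h3, h4⟩, h5, h6⟩ := hb u hu v hv
      rw [abs_of_nonneg (mul_nonneg (sq_nonneg _) (sq_nonneg _))]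
      exact mul_le_one₀ (pow_le_one₀ h5 h6) (sq_nonneg _) (pow_le_one₀ h3 h4)
    rw [← integral_pairLaw_eq_swap_of_eqOn ht hj.1 hjn i1 (f := fun u v => φ u)
        fun u hu v hv => (hL u hu).symm,
      ← integral_pairLaw_eq_swap_of_eqOn ht hj.1 hjn i2 (f := fun u v => φ u ^ 2)
        fun u hu v hv => by simp only [hL u hu],
      ← integral_pairLaw_eq_swap_of_eqOn ht hj.1 hjn i3
        (f := fun u v => (t - u) / (v - u) * (φ v - φ u) * φ u)
        fun u hu v hv => by simp only [hL u hu, hR v hv],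
      ← integral_pairLaw_eq_swap_of_eqOn ht hj.1 hjn i4
        (f := fun u v => (φ v - φ u) * ((t - u) / (v - u)) ^ 2)
        fun u hu v hv => by simp only [hL u hu, hR v hv],
      ← integral_pairLaw_eq_swap_of_eqOn ht hj.1 hjn i5
        (f := fun u v => (φ v - φ u) ^ 2 * ((t - u) / (v - u)) ^ 2)
        fun u hu v hv => by simp only [hL u hu, hR v hv]]
    have hexp : ∀ z : ℝ × ℝ, bkCondSecond φ t c z = c * clampExtend φ z.1
        + (1 - c) * clampExtend φ z.1 ^ 2
        + 2 * (1 - c) * ((t - z.1) / (z.2 - z.1)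
          * (clampExtend φ z.2 - clampExtend φ z.1) * clampExtend φ z.1)
        + c * ((clampExtend φ z.2 - clampExtend φ z.1) * ((t - z.1) / (z.2 - z.1)) ^ 2)
        + (1 - c) * ((clampExtend φ z.2 - clampExtend φ z.1) ^ 2
          * ((t - z.1) / (z.2 - z.1)) ^ 2) := fun z => by
      rw [bkCondSecond, bkCondSq, bkCondMean]
      ring
    simp_rw [hexp]
    rw [integral_add (by fun_prop) (by fun_prop), integral_add (by fun_prop) (by fun_prop),
      integral_add (by fun_prop) (by fun_prop), integral_add (by fun_prop) (by fun_prop)]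
    simp_rw [integral_const_mul]
    ring
  rw [hfirst, hlast, Finset.sum_congr rfl hmid]
  simp_rw [Finset.sum_add_distrib, ← Finset.mul_sum]
  ring

end BK

/-! ### The inverse of a warping function -/

section WarpInv

variable {φ : ℝ → ℝ} {t : ℝ}

lemma IsACWarping.exists_eq (hφ : IsACWarping φ) {y : ℝ} (hy : y ∈ Icc (0 : ℝ) 1) :
    ∃ x ∈ Icc (0 : ℝ) 1, φ x = y := by
  have := intermediate_value_Icc zero_le_one hφ.continuousOn
  rw [hφ.map_zero, hφ.map_one] at this
  exact this hy

lemma IsACWarping.warpInv_mem (hφ : IsACWarping φ) {y : ℝ} (hy : y ∈ Icc (0 : ℝ) 1) :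
    warpInv φ y ∈ Icc (0 : ℝ) 1 := Function.invFunOn_mem (hφ.exists_eq hy)

lemma IsACWarping.map_warpInv (hφ : IsACWarping φ) {y : ℝ} (hy : y ∈ Icc (0 : ℝ) 1) :
    φ (warpInv φ y) = y := Function.invFunOn_eq (hφ.exists_eq hy)

lemma IsACWarping.warpInv_map (hφ : IsACWarping φ) {x : ℝ} (hx : x ∈ Icc (0 : ℝ) 1) :
    warpInv φ (φ x) = x :=
  hφ.strictMonoOn.injOn (hφ.warpInv_mem (hφ.mem_Icc hx)) hx (hφ.map_warpInv (hφ.mem_Icc hx))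

lemma IsACWarping.warpInv_zero (hφ : IsACWarping φ) : warpInv φ 0 = 0 := by
  conv_lhs => rw [← hφ.map_zero]
  exact hφ.warpInv_map ⟨le_rfl, zero_le_one⟩

lemma IsACWarping.warpInv_one (hφ : IsACWarping φ) : warpInv φ 1 = 1 := by
  conv_lhs => rw [← hφ.map_one]
  exact hφ.warpInv_map ⟨zero_le_one, le_rfl⟩

lemma IsACWarping.warpInv_le_iff (hφ : IsACWarping φ) {y x : ℝ} (hy : y ∈ Icc (0 : ℝ) 1)
    (hx : x ∈ Icc (0 : ℝ) 1) : warpInv φ y ≤ x ↔ y ≤ φ x := by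
  rw [← hφ.strictMonoOn.le_iff_le (hφ.warpInv_mem hy) hx, hφ.map_warpInv hy]

lemma IsACWarping.monotoneOn_warpInv (hφ : IsACWarping φ) :
    MonotoneOn (warpInv φ) (Icc 0 1) := fun x hx y hy hxy => by
  rw [hφ.warpInv_le_iff hx (hφ.warpInv_mem hy), hφ.map_warpInv hy]
  exact hxy

lemma IsACWarping.measurable_warpInv (hφ : IsACWarping φ) : Measurable (warpInv φ) := by
  have hmono : Monotone (clampExtend (warpInv φ)) := fun x y hxy =>
    hφ.monotoneOn_warpInv (clamp_mem x) (clamp_mem y) (max_le_max le_rfl (min_le_min_right 1 hxy))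
  -- Off `[0, 1]` the inverse takes the default value of `Function.invFunOn`, one and the same
  -- constant. So `warpInv φ` is monotone on `[0, 1]` and constant elsewhere.
  obtain ⟨d, hd⟩ : ∃ d, ∀ y, y ∉ Icc (0 : ℝ) 1 → warpInv φ y = d := by
    refine ⟨_, fun y hy => Function.invFunOn_neg ?_⟩
    rintro ⟨x, hx, rfl⟩
    exact hy (hφ.mem_Icc hx)
  have : warpInv φ = (Icc (0 : ℝ) 1).piecewise (clampExtend (warpInv φ)) fun _ => d := by
    ext y
    by_cases hy : y ∈ Icc (0 : ℝ) 1
    · rw [piecewise_eq_of_mem _ _ _ hy, clampExtend_eq _ hy]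
    · rw [piecewise_eq_of_notMem _ _ _ hy, hd y hy]
  rw [this]
  exact hmono.measurable.piecewise measurableSet_Icc measurable_const

lemma IsACWarping.map_mem_Ioo (hφ : IsACWarping φ) (ht : t ∈ Ioo (0 : ℝ) 1) :
    φ t ∈ Ioo (0 : ℝ) 1 := by
  have h0 := hφ.strictMonoOn ⟨le_rfl, zero_le_one⟩ (Ioo_subset_Icc_self ht) ht.1
  have h1 := hφ.strictMonoOn (Ioo_subset_Icc_self ht) ⟨zero_le_one, le_rfl⟩ ht.2
  rw [hφ.map_zero] at h0
  rw [hφ.map_one] at h1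
  exact ⟨h0, h1⟩

/-- With `lt_warpInv` this transports the straddling event from `φ t` and the sample points to `t`
and their preimages. -/
lemma IsACWarping.warpInv_le (hφ : IsACWarping φ) (ht : t ∈ Ioo (0 : ℝ) 1) {u : ℝ}
    (hu : u ∈ Icc 0 (φ t)) : warpInv φ u ∈ Icc 0 t :=
  ⟨(hφ.warpInv_mem (mem_Icc_of_mem_left (hφ.map_mem_Ioo ht) hu)).1,
    (hφ.warpInv_le_iff (mem_Icc_of_mem_left (hφ.map_mem_Ioo ht) hu)
      (Ioo_subset_Icc_self ht)).2 hu.2⟩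

lemma IsACWarping.lt_warpInv (hφ : IsACWarping φ) (ht : t ∈ Ioo (0 : ℝ) 1) {v : ℝ}
    (hv : v ∈ Ioc (φ t) 1) : t < warpInv φ v := by
  refine lt_of_not_ge fun h => ?_
  rw [hφ.warpInv_le_iff (mem_Icc_of_mem_right (hφ.map_mem_Ioo ht) (Ioc_subset_Icc_self hv))
    (Ioo_subset_Icc_self ht)] at h
  exact absurd hv.1 (not_lt.2 h)

end WarpInv

/-! ### The CDF process -/

/-- The interpolation ratio of the CDF process. -/
def warpRatio (φ : ℝ → ℝ) (t : ℝ) (z : ℝ × ℝ) : ℝ :=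
  (t - warpInv φ z.1) / (warpInv φ z.2 - warpInv φ z.1)

/-- The coefficients of the Dirichlet weights in the CDF process. -/
def cdfCoeff (n : ℕ) (φ : ℝ → ℝ) (p t : ℝ) (j : ℕ) (z : ℝ × ℝ) (i : Fin n) : ℝ :=
  if (i : ℕ) + 1 < j then 1 else if (i : ℕ) + 1 = j then 1 - p + p * warpRatio φ t z else
    if (i : ℕ) = j then (1 - p) * warpRatio φ t z else 0

/-- The conditional mean of the CDF process, given the two knots around `t`. -/
def cdfCondMean (n : ℕ) (φ : ℝ → ℝ) (p t : ℝ) (j : ℕ) (z : ℝ × ℝ) : ℝ :=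
  ∑ i, cdfCoeff n φ p t j z i * (1 / n)

/-- The mean of the squared coefficients of the CDF process, given the two knots around `t`. -/
def cdfCondSq (n : ℕ) (φ : ℝ → ℝ) (p t : ℝ) (j : ℕ) (z : ℝ × ℝ) : ℝ :=
  ∑ i, cdfCoeff n φ p t j z i ^ 2 * (1 / n)

/-- The conditional second moment of the CDF process, given the two knots around `t`. -/
def cdfCondSecond (n : ℕ) (φ : ℝ → ℝ) (p t c : ℝ) (j : ℕ) (z : ℝ × ℝ) : ℝ :=
  c * cdfCondSq n φ p t j z + (1 - c) * cdfCondMean n φ p t j z ^ 2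

/-- Passing to the zero-padded sequence, where `β_k` has place `k`, removes the boundary cases: for
`j = 0` the factor of `A` is zero, for `j = n` that of `B`. -/
lemma sum_ite_mul_extendZero {n j : ℕ} (hj : j ≤ n) (A B : ℝ) (b : Fin n → ℝ) :
    ∑ i : Fin n, (if (i : ℕ) + 1 < j then 1 else if (i : ℕ) + 1 = j then A else
        if (i : ℕ) = j then B else 0) * b i
      = ∑ k ∈ Finset.range j, extendZero b k + A * extendZero b j + B * extendZero b (j + 1) := by
  let W : ℕ → ℝ := fun k => if k < j then 1 else if k = j then A else if k = j + 1 then B else 0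
  have h1 : ∀ i : Fin n, (if (i : ℕ) + 1 < j then 1 else if (i : ℕ) + 1 = j then A else
      if (i : ℕ) = j then B else 0) * b i = W (i + 1) * extendZero b (i + 1) := fun i => by
    simp only [W, extendZero_succ, Nat.add_right_cancel_iff]
  simp_rw [h1]
  rw [Fin.sum_univ_eq_sum_range (fun i => W (i + 1) * extendZero b (i + 1)) n]
  have h2 : ∑ i ∈ Finset.range n, W (i + 1) * extendZero b (i + 1)
      = ∑ k ∈ Finset.range (n + 2), W k * extendZero b k := by
    rw [Finset.sum_range_succ, extendZero_of_lt b (Nat.lt_succ_self n), mul_zero, add_zero,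
      Finset.sum_range_succ' _ n, extendZero_zero, mul_zero, add_zero]
  rw [h2, ← Finset.sum_subset (Finset.range_subset_range.2 (by omega : j + 1 + 1 ≤ n + 2)),
    Finset.sum_range_succ, Finset.sum_range_succ]
  · congr 1
    · congr 1
      · exact Finset.sum_congr rfl fun i hi => by simp [W, Finset.mem_range.1 hi]
      · simp [W]
    · simp [W]
  · intro k _ hk
    rw [Finset.mem_range, not_lt] at hk
    simp only [W]
    rw [if_neg (by omega), if_neg (by omega), if_neg (by omega), zero_mul]

/-- Each `β_k` is split between `γ_k` and `γ_{k+1}`, so only the last one is incomplete. Adding the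
fraction `r` of `γ_{j+1}` gives `β_j` the coefficient `1 - p + p * r` and `β_{j+1}` the coefficient
`(1 - p) * r`, as in `cdfCoeff`. -/
lemma sum_cdfIncrement {n : ℕ} (p : ℝ) (b : Fin n → ℝ) (j : ℕ) :
    ∑ i ∈ Finset.range (j + 1), cdfIncrement p b i
      = ∑ k ∈ Finset.range j, extendZero b k + (1 - p) * extendZero b j := by
  induction j with
  | zero => simp [cdfIncrement, extendZero_zero]
  | succ j ih =>
    rw [Finset.sum_range_succ, ih, Finset.sum_range_succ _ j, cdfIncrement,
      if_neg (Nat.succ_ne_zero j), Nat.add_sub_cancel]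
    ring

lemma extendZero_const {n k : ℕ} (c : ℝ) (hk : 1 ≤ k) (hkn : k ≤ n) :
    extendZero (fun _ : Fin n => c) k = c := by
  obtain ⟨i, rfl⟩ := Nat.exists_eq_add_of_le' hk
  exact extendZero_succ (fun _ : Fin n => c) ⟨i, hkn⟩

lemma sum_extendZero_const {n j : ℕ} (c : ℝ) (hj : j ≤ n) :
    ∑ k ∈ Finset.range (j + 1), extendZero (fun _ : Fin n => c) k = j * c := by
  induction j with
  | zero => simp [extendZero_zero]
  | succ j ih =>
    rw [Finset.sum_range_succ, ih (by omega), extendZero_const c (by omega) hj]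
    push_cast
    ring

section CDF

variable {φ : ℝ → ℝ} {t p : ℝ} {n : ℕ}

lemma cdfCoeff_sq (j : ℕ) (z : ℝ × ℝ) (i : Fin n) :
    cdfCoeff n φ p t j z i ^ 2 = if (i : ℕ) + 1 < j then 1 else
      if (i : ℕ) + 1 = j then (1 - p + p * warpRatio φ t z) ^ 2 else
      if (i : ℕ) = j then ((1 - p) * warpRatio φ t z) ^ 2 else 0 := by
  unfold cdfCoeff
  split_ifs <;> simp

/-- Three regimes are separated here and below: in the first interval `β_j` is missing, in the last
one `β_{j+1}`, and in between both are present. -/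
lemma cdfCondMean_zero (hn : 1 ≤ n) (z : ℝ × ℝ) :
    cdfCondMean n φ p t 0 z = (1 - p) * warpRatio φ t z * (1 / n) := by
  unfold cdfCondMean cdfCoeff
  rw [sum_ite_mul_extendZero (Nat.zero_le n), extendZero_zero, extendZero_const _ le_rfl hn]
  simp

lemma cdfCondSq_zero (hn : 1 ≤ n) (z : ℝ × ℝ) :
    cdfCondSq n φ p t 0 z = ((1 - p) * warpRatio φ t z) ^ 2 * (1 / n) := by
  unfold cdfCondSq
  simp_rw [cdfCoeff_sq]
  rw [sum_ite_mul_extendZero (Nat.zero_le n), extendZero_zero, extendZero_const _ le_rfl hn]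
  simp

lemma cdfCondMean_mid {j : ℕ} (hj : 1 ≤ j) (hjn : j + 1 ≤ n) (z : ℝ × ℝ) :
    cdfCondMean n φ p t j z = (j - p + warpRatio φ t z) * (1 / n) := by
  obtain ⟨i, rfl⟩ := Nat.exists_eq_add_of_le' hj
  unfold cdfCondMean cdfCoeff
  rw [sum_ite_mul_extendZero (by omega), sum_extendZero_const _ (by omega),
    extendZero_const _ (by omega) (by omega), extendZero_const _ (by omega) (by omega)]
  push_cast
  ring

lemma cdfCondSq_mid {j : ℕ} (hj : 1 ≤ j) (hjn : j + 1 ≤ n) (z : ℝ × ℝ) :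
    cdfCondSq n φ p t j z = (j - 1 + (1 - p + p * warpRatio φ t z) ^ 2
      + ((1 - p) * warpRatio φ t z) ^ 2) * (1 / n) := by
  obtain ⟨i, rfl⟩ := Nat.exists_eq_add_of_le' hj
  unfold cdfCondSq
  simp_rw [cdfCoeff_sq]
  rw [sum_ite_mul_extendZero (by omega), sum_extendZero_const _ (by omega),
    extendZero_const _ (by omega) (by omega), extendZero_const _ (by omega) (by omega)]
  push_cast
  ring

lemma cdfCondMean_last (hn : 1 ≤ n) (z : ℝ × ℝ) :
    cdfCondMean n φ p t n z = (n - p * (1 - warpRatio φ t z)) * (1 / n) := by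
  obtain ⟨i, rfl⟩ := Nat.exists_eq_add_of_le' hn
  unfold cdfCondMean cdfCoeff
  rw [sum_ite_mul_extendZero le_rfl, sum_extendZero_const _ (by omega),
    extendZero_const _ (by omega) (by omega), extendZero_of_lt _ (by omega)]
  push_cast
  ring

lemma cdfCondSq_last (hn : 1 ≤ n) (z : ℝ × ℝ) :
    cdfCondSq n φ p t n z = (n - 1 + (1 - p * (1 - warpRatio φ t z)) ^ 2) * (1 / n) := by
  obtain ⟨i, rfl⟩ := Nat.exists_eq_add_of_le' hn
  unfold cdfCondSq
  simp_rw [cdfCoeff_sq]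
  rw [sum_ite_mul_extendZero le_rfl, sum_extendZero_const _ (by omega),
    extendZero_const _ (by omega) (by omega), extendZero_of_lt _ (by omega)]
  push_cast
  ring

lemma measurable_warpRatio (hφ : IsACWarping φ) : Measurable (warpRatio φ t) := by
  have := hφ.measurable_warpInv
  unfold warpRatio
  fun_prop

lemma measurable_cdfCoeff (hφ : IsACWarping φ) (j : ℕ) (i : Fin n) :
    Measurable fun z => cdfCoeff n φ p t j z i := by
  have := measurable_warpRatio (t := t) hφ
  unfold cdfCoeff
  split_ifs <;> fun_prop

lemma measurable_cdfCondMean (hφ : IsACWarping φ) (j : ℕ) :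
    Measurable (cdfCondMean n φ p t j) :=
  Finset.measurable_fun_sum _ fun i _ => (measurable_cdfCoeff hφ j i).mul_const _

lemma measurable_cdfCondSq (hφ : IsACWarping φ) (j : ℕ) :
    Measurable (cdfCondSq n φ p t j) :=
  Finset.measurable_fun_sum _ fun i _ => ((measurable_cdfCoeff hφ j i).pow_const 2).mul_const _

lemma measurable_cdfCondSecond (hφ : IsACWarping φ) (c : ℝ) (j : ℕ) :
    Measurable (cdfCondSecond n φ p t c j) :=
  ((measurable_cdfCondSq hφ j).const_mul c).add
    (((measurable_cdfCondMean hφ j).pow_const 2).const_mul _)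

lemma warpRatio_mem (hφ : IsACWarping φ) (ht : t ∈ Ioo (0 : ℝ) 1) {u v : ℝ}
    (hu : u ∈ Icc 0 (φ t)) (hv : v ∈ Ioc (φ t) 1) : warpRatio φ t (u, v) ∈ Icc (0 : ℝ) 1 :=
  ratio_mem_Icc (hφ.warpInv_le ht hu).2 (hφ.lt_warpInv ht hv)

lemma cdfCoeff_mem (hp : p ∈ Ioo (0 : ℝ) 1) {z : ℝ × ℝ} (hz : warpRatio φ t z ∈ Icc (0 : ℝ) 1)
    (j : ℕ) (i : Fin n) : cdfCoeff n φ p t j z i ∈ Icc (0 : ℝ) 1 := by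
  obtain ⟨h0, h1⟩ := hz
  obtain ⟨p0, p1⟩ := hp
  unfold cdfCoeff
  split_ifs
  · simp
  · constructor <;> nlinarith
  · constructor <;> nlinarith
  · simp

lemma cdfCondMean_mem (hn : 1 ≤ n) (hp : p ∈ Ioo (0 : ℝ) 1) {z : ℝ × ℝ}
    (hz : warpRatio φ t z ∈ Icc (0 : ℝ) 1) (j : ℕ) :
    cdfCondMean n φ p t j z ∈ Icc (0 : ℝ) 1 := by
  have hn' : (0 : ℝ) < n := by exact_mod_cast hn
  refine ⟨Finset.sum_nonneg fun i _ => mul_nonneg (cdfCoeff_mem hp hz j i).1 (by positivity), ?_⟩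
  calc cdfCondMean n φ p t j z ≤ ∑ _i : Fin n, 1 * (1 / (n : ℝ)) :=
        Finset.sum_le_sum fun i _ =>
          mul_le_mul_of_nonneg_right (cdfCoeff_mem hp hz j i).2 (by positivity)
    _ = 1 := by
        rw [Finset.sum_const, Finset.card_univ, Fintype.card_fin, nsmul_eq_mul]
        field_simp

lemma cdfCondSq_mem (hn : 1 ≤ n) (hp : p ∈ Ioo (0 : ℝ) 1) {z : ℝ × ℝ}
    (hz : warpRatio φ t z ∈ Icc (0 : ℝ) 1) (j : ℕ) :
    cdfCondSq n φ p t j z ∈ Icc (0 : ℝ) 1 := by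
  refine ⟨Finset.sum_nonneg fun i _ => by positivity,
    le_trans ?_ (cdfCondMean_mem hn hp hz j).2⟩
  -- Coefficients in `[0, 1]` dominate their squares, so the bound for the mean carries over.
  refine Finset.sum_le_sum fun i _ => mul_le_mul_of_nonneg_right ?_ (by positivity)
  have := cdfCoeff_mem hp hz j i
  exact pow_le_of_le_one this.1 this.2 two_ne_zero

lemma cdfCondSecond_mem (hn : 1 ≤ n) (hp : p ∈ Ioo (0 : ℝ) 1) {z : ℝ × ℝ}
    (hz : warpRatio φ t z ∈ Icc (0 : ℝ) 1) {c : ℝ} (hc : c ∈ Icc (0 : ℝ) 1) (j : ℕ) :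
    cdfCondSecond n φ p t c j z ∈ Icc (0 : ℝ) 1 := by
  have h1 := cdfCondMean_mem hn hp hz j
  have h2 := cdfCondSq_mem hn hp hz j
  have h3 := pow_le_one₀ (n := 2) h1.1 h1.2
  have h4 := sq_nonneg (cdfCondMean n φ p t j z)
  rw [cdfCondSecond]
  constructor <;> nlinarith [hc.1, hc.2, h2.1, h2.2]

theorem cdf_moments (hφ : IsACWarping φ) (ht : t ∈ Ioo (0 : ℝ) 1) (hp : p ∈ Ioo (0 : ℝ) 1)
    {θ : ℝ} (hθ : 0 < θ) {Ω : Type*} [MeasurableSpace Ω] {P : Measure Ω} [IsProbabilityMeasure P]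
    (hn : 1 ≤ n) {U β : Ω → Fin n → ℝ} (h : IsCDFSample n θ U β P) :
    MemLp (fun ω => cdfPath φ p (U ω) (β ω) t) 2 P ∧
    ∫ ω, cdfPath φ p (U ω) (β ω) t ∂P = knotMean n (φ t) (cdfCondMean n φ p t) ∧
    ∫ ω, cdfPath φ p (U ω) (β ω) t ^ 2 ∂P
      = knotMean n (φ t) (cdfCondSecond n φ p t (1 / (1 + θ))) := by
  have hn' : (0 : ℝ) < n := by exact_mod_cast hn
  have hS : Measurable fun ω => sorted (U ω) := measurable_sorted.comp h.measurable_U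
  have hmap := map_sorted_eq h.measurable_U h.iIndep h.uniform
  have hprob : IsProbabilityMeasure (dirichlet fun _ : Fin n => θ / n) :=
    isProbabilityMeasure_dirichlet fun _ => by positivity
  -- By independence the conditional law of the weights is a constant kernel; all the dependence on
  -- the sample is in the coefficients.
  have hlaw : P.map (fun ω => (sorted (U ω), β ω))
      = sortedLaw n ⊗ₘ Kernel.const (Fin n → ℝ) (dirichlet fun _ : Fin n => θ / n) := by
    rw [(indepFun_iff_map_prod_eq_prod_map_map hS.aemeasurable
      h.measurable_weights.aemeasurable).1 h.indep, hmap, h.law, Measure.compProd_const]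
  have hτ := hφ.map_mem_Ioo ht
  refine moments_of_dirichlet (m := n) hS h.measurable_weights hlaw hθ hτ
    (μ := fun _ _ => 1 / n)
    (H := fun z => interpolate n (fun j => warpInv φ (knots z.1 j)) (cdfIncrement p z.2) t)
    (w := cdfCoeff n φ p t) (M := cdfCondMean n φ p t) (N := cdfCondSq n φ p t) ?_ ?_ ?_ ?_ ?_
    (fun j _ => measurable_cdfCondMean hφ j) (fun j _ => measurable_cdfCondSq hφ j) ?_ ?_ ?_ ?_
  · filter_upwards with s
    simp [div_eq_mul_inv]
  · filter_upwards with s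
    refine ⟨fun i => by positivity, ?_⟩
    rw [Finset.sum_const, Finset.card_univ, Fintype.card_fin, nsmul_eq_mul]
    field_simp
  · refine measurable_interpolate n
      (fun j => hφ.measurable_warpInv.comp ((measurable_knots j).comp measurable_fst))
      (fun j => ?_) t
    unfold cdfIncrement
    split_ifs
    · exact measurable_const
    · exact (((measurable_extendZero j).comp measurable_snd).const_mul _).add
        (((measurable_extendZero (j - 1)).comp measurable_snd).const_mul _)
  · intro j _ u hu v hv i
    exact cdfCoeff_mem hp (warpRatio_mem hφ ht hu hv) j i
  · filter_upwards [ae_knots] with s hs j hj hsj x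
    rw [interpolate_eq ht.2.ne hj (hφ.warpInv_le ht ⟨(hs.2 j).1, hsj.1⟩).2
      (hφ.lt_warpInv ht ⟨hsj.2, (hs.2 _).2⟩)
      (fun i k hik _ => hφ.monotoneOn_warpInv (hs.2 i) (hs.2 k) (hs.1 hik)),
      sum_cdfIncrement, cdfIncrement, if_neg (Nat.succ_ne_zero j), Nat.add_sub_cancel]
    unfold cdfCoeff
    rw [sum_ite_mul_extendZero hj]
    simp only [warpRatio]
    ring
  · intro j _ u hu v hv
    have := cdfCondMean_mem hn hp (warpRatio_mem hφ ht hu hv) j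
    rw [abs_of_nonneg this.1]
    exact this.2
  · intro j _ u hu v hv
    have := cdfCondSq_mem hn hp (warpRatio_mem hφ ht hu hv) j
    rw [abs_of_nonneg this.1]
    exact this.2
  · filter_upwards with s j hj hsj using rfl
  · filter_upwards with s j hj hsj using rfl

end CDF

/-! ### The closed forms for the CDF process -/

/-- Meant for integrands containing `warpInv φ`, for which measurability and a bound are at hand. -/
lemma intervalIntegrable_mul_of_bound {f g : ℝ → ℝ} {a b C : ℝ} (hab : a ≤ b)
    (hf : Measurable f) (hC : ∀ x ∈ Icc a b, |f x| ≤ C) (hg : Continuous g) :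
    IntervalIntegrable (fun x => f x * g x) volume a b := by
  rw [intervalIntegrable_iff_integrableOn_Ioc_of_le hab]
  refine Integrable.bdd_mul (c := C) (hg.integrableOn_Ioc) hf.aestronglyMeasurable ?_
  filter_upwards [ae_restrict_mem measurableSet_Ioc] with x hx using hC x (Ioc_subset_Icc_self hx)

/-- The powers `φ t ^ n` and `(1 - φ t) ^ n` in the bracketed CDF terms come from here: the inner
indices give a binomial mean minus its two end terms. -/
lemma sum_Icc_eq_countMean_sub {n : ℕ} (hn : 1 ≤ n) (τ : ℝ) (d : ℕ → ℝ) :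
    ∑ j ∈ Finset.Icc 1 (n - 1), (n.choose j : ℝ) * (τ ^ j * (1 - τ) ^ (n - j) * d j)
      = countMean n τ d - (1 - τ) ^ n * d 0 - τ ^ n * d n := by
  rw [countMean, sum_range_succ_eq_Icc hn]
  simp only [Nat.choose_zero_right, Nat.choose_self, Nat.cast_one, pow_zero, Nat.sub_zero,
    Nat.sub_self]
  ring

section CDF

variable {φ : ℝ → ℝ} {t p : ℝ} {n : ℕ}

lemma integrable_cdfCondMean (hφ : IsACWarping φ) (ht : t ∈ Ioo (0 : ℝ) 1)
    (hp : p ∈ Ioo (0 : ℝ) 1) (hn : 1 ≤ n) (i j k : ℕ) :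
    Integrable (cdfCondMean n φ p t i) (pairLaw (φ t) j k) :=
  integrable_pairLaw (hφ.map_mem_Ioo ht) (measurable_cdfCondMean hφ i) (C := 1)
    (fun u hu v hv => by
      have := cdfCondMean_mem hn hp (warpRatio_mem hφ ht hu hv) i
      rw [abs_of_nonneg this.1]
      exact this.2) j k

lemma integrable_cdfCondSecond (hφ : IsACWarping φ) (ht : t ∈ Ioo (0 : ℝ) 1)
    (hp : p ∈ Ioo (0 : ℝ) 1) (hn : 1 ≤ n) {c : ℝ} (hc : c ∈ Icc (0 : ℝ) 1) (i j k : ℕ) :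
    Integrable (cdfCondSecond n φ p t c i) (pairLaw (φ t) j k) :=
  integrable_pairLaw (hφ.map_mem_Ioo ht) (measurable_cdfCondSecond hφ c i) (C := 1)
    (fun u hu v hv => by
      have := cdfCondSecond_mem hn hp (warpRatio_mem hφ ht hu hv) hc i
      rw [abs_of_nonneg this.1]
      exact this.2) j k

lemma integrable_warpRatio_pow (hφ : IsACWarping φ) (ht : t ∈ Ioo (0 : ℝ) 1) (m j k : ℕ) :
    Integrable (fun z => warpRatio φ t z ^ m) (pairLaw (φ t) j k) :=
  integrable_pairLaw (hφ.map_mem_Ioo ht) ((measurable_warpRatio hφ).pow_const m) (C := 1)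
    (fun u hu v hv => by
      have := warpRatio_mem hφ ht hu hv
      rw [abs_of_nonneg (pow_nonneg this.1 m)]
      exact pow_le_one₀ this.1 this.2) j k

lemma choose_mul_integral_warpRatio_pow (hφ : IsACWarping φ) (ht : t ∈ Ioo (0 : ℝ) 1)
    (m : ℕ) {j : ℕ} (hj : 1 ≤ j) (hjn : j + 1 ≤ n) :
    (n.choose j : ℝ) * ∫ z, warpRatio φ t z ^ m ∂(pairLaw (φ t) j (n - j))
      = cdfRatio n φ t j m :=
  integral_pairLaw_eq (hφ.map_mem_Ioo ht) hj hjn (integrable_warpRatio_pow hφ ht m j (n - j))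

lemma warpRatio_zero (hφ : IsACWarping φ) (v : ℝ) : warpRatio φ t (0, v) = t / warpInv φ v := by
  simp [warpRatio, hφ.warpInv_zero]

lemma one_sub_warpRatio_last (hφ : IsACWarping φ) (ht : t ∈ Ioo (0 : ℝ) 1) {u : ℝ}
    (hu : u ∈ Icc 0 (φ t)) : 1 - warpRatio φ t (u, 1) = (1 - t) / (1 - warpInv φ u) := by
  have h1 := (hφ.warpInv_le ht hu).2
  have : 1 - warpInv φ u ≠ 0 := by linarith [ht.2]
  rw [warpRatio, hφ.warpInv_one]
  field_simp
  ring

lemma warpRatio_last_mem (hφ : IsACWarping φ) (ht : t ∈ Ioo (0 : ℝ) 1) {u : ℝ}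
    (hu : u ∈ Icc 0 (φ t)) : (1 - t) / (1 - warpInv φ u) ∈ Icc (0 : ℝ) 1 := by
  have h1 := (hφ.warpInv_le ht hu).2
  exact ⟨div_nonneg (by linarith [ht.2]) (by linarith [ht.2]),
    (div_le_one (by linarith [ht.2])).2 (by linarith)⟩

theorem knotMean_cdfCondMean (hφ : IsACWarping φ) (ht : t ∈ Ioo (0 : ℝ) 1)
    (hp : p ∈ Ioo (0 : ℝ) 1) (hn : 1 ≤ n) :
    knotMean n (φ t) (cdfCondMean n φ p t) = cdfMean n φ p t := by
  have hτ := hφ.map_mem_Ioo ht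
  have hn' : (n : ℝ) ≠ 0 := by positivity
  rw [knotMean_eq hτ hn fun j _ => integrable_cdfCondMean hφ ht hp hn j j (n - j), cdfMean]
  have hfirst : ∫ v in φ t..1, cdfCondMean n φ p t 0 (0, v) * (n * (1 - v) ^ (n - 1))
      = (1 - p) / n * (∫ u in φ t..1, t / warpInv φ u * (n * (1 - u) ^ (n - 1))) := by
    rw [← intervalIntegral.integral_const_mul]
    refine intervalIntegral.integral_congr fun v _ => ?_
    simp only [cdfCondMean_zero hn, warpRatio_zero hφ]
    ring
  have hlast : ∫ u in (0 : ℝ)..φ t, cdfCondMean n φ p t n (u, 1) * (n * u ^ (n - 1))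
      = ∫ v in (0 : ℝ)..φ t,
          (1 - p / n * ((1 - t) / (1 - warpInv φ v))) * (n * v ^ (n - 1)) := by
    refine intervalIntegral.integral_congr fun u hu => ?_
    rw [uIcc_of_le hτ.1.le] at hu
    simp only [cdfCondMean_last hn, one_sub_warpRatio_last hφ ht hu]
    field_simp
  have hmid : ∀ j ∈ Finset.Icc 1 (n - 1),
      (n.choose j : ℝ) * ∫ z, cdfCondMean n φ p t j z ∂(pairLaw (φ t) j (n - j))
        = 1 / n * ((n.choose j : ℝ) * (φ t ^ j * (1 - φ t) ^ (n - j) * (j - p)))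
          + 1 / n * cdfRatio n φ t j 1 := by
    intro j hj
    rw [Finset.mem_Icc] at hj
    have := isFiniteMeasure_pairLaw hτ j (n - j)
    have i1 := integrable_warpRatio_pow hφ ht 1 j (n - j)
    rw [← choose_mul_integral_warpRatio_pow hφ ht 1 hj.1 (by omega)]
    have hexp : ∀ z, cdfCondMean n φ p t j z
        = (j - p) * (1 / n) + 1 / n * warpRatio φ t z ^ 1 := fun z => by
      rw [cdfCondMean_mid hj.1 (by omega)]
      ring
    simp_rw [hexp]
    rw [integral_add (integrable_const _) (i1.const_mul _), integral_const, integral_const_mul,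
      pairLaw_real_univ hτ, smul_eq_mul]
    ring
  have hcount : countMean n (φ t) (fun j => (j : ℝ) - p) = n * φ t - p := by
    have := countMean_add (τ := φ t) n (fun j => (j : ℝ)) (fun _ => -p * 1)
    rw [countMean_mul, countMean_one, countMean_id] at this
    simp only [sub_eq_add_neg]
    simpa using this
  rw [hfirst, hlast, Finset.sum_congr rfl hmid, Finset.sum_add_distrib, ← Finset.mul_sum,
    ← Finset.mul_sum, sum_Icc_eq_countMean_sub hn, hcount]
  push_cast
  ring

theorem knotMean_cdfCondSecond (hφ : IsACWarping φ) (ht : t ∈ Ioo (0 : ℝ) 1)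
    (hp : p ∈ Ioo (0 : ℝ) 1) (hn : 1 ≤ n) {θ : ℝ} (hθ : 0 < θ) :
    knotMean n (φ t) (cdfCondSecond n φ p t (1 / (1 + θ)))
      = cdfVar n φ θ p t + cdfMean n φ p t ^ 2 := by
  have hc : 1 / (1 + θ) ∈ Icc (0 : ℝ) 1 :=
    ⟨by positivity, by rw [div_le_one (by linarith)]; linarith⟩
  rw [cdfVar]
  generalize 1 / (1 + θ) = c at hc ⊢
  have hτ := hφ.map_mem_Ioo ht
  have hn' : (n : ℝ) ≠ 0 := by positivity
  rw [knotMean_eq hτ hn fun j _ => integrable_cdfCondSecond hφ ht hp hn hc j j (n - j)]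
  have hfirst : ∫ v in φ t..1, cdfCondSecond n φ p t c 0 (0, v) * (n * (1 - v) ^ (n - 1))
      = ((1 - p) ^ 2 * (1 / n) * c + ((1 - p) / n) ^ 2 * (1 - c))
        * ∫ u in φ t..1, t ^ 2 / warpInv φ u ^ 2 * (n * (1 - u) ^ (n - 1)) := by
    rw [← intervalIntegral.integral_const_mul]
    refine intervalIntegral.integral_congr fun v _ => ?_
    simp only [cdfCondSecond, cdfCondMean_zero hn, cdfCondSq_zero hn, warpRatio_zero hφ]
    ring
  have hκ : Measurable fun u => (1 - t) / (1 - warpInv φ u) := by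
    have := hφ.measurable_warpInv
    fun_prop
  have hlast : ∫ u in (0 : ℝ)..φ t, cdfCondSecond n φ p t c n (u, 1) * (n * u ^ (n - 1))
      = φ t ^ n - 2 * p * (1 / n)
          * (∫ v in (0 : ℝ)..φ t, (1 - t) / (1 - warpInv φ v) * (n * v ^ (n - 1)))
        + p ^ 2 * (1 / n * c + 1 / n ^ 2 * (1 - c))
          * (∫ v in (0 : ℝ)..φ t, ((1 - t) / (1 - warpInv φ v)) ^ 2 * (n * v ^ (n - 1))) := by
    have i1 : IntervalIntegrable
        (fun v => (1 - t) / (1 - warpInv φ v) * (n * v ^ (n - 1))) volume 0 (φ t) := by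
      refine intervalIntegrable_mul_of_bound hτ.1.le hκ (C := 1) (fun u hu => ?_) (by fun_prop)
      have := warpRatio_last_mem hφ ht hu
      rw [abs_of_nonneg this.1]
      exact this.2
    have i2 : IntervalIntegrable
        (fun v => ((1 - t) / (1 - warpInv φ v)) ^ 2 * (n * v ^ (n - 1))) volume 0 (φ t) := by
      refine intervalIntegrable_mul_of_bound hτ.1.le (hκ.pow_const 2) (C := 1) (fun u hu => ?_)
        (by fun_prop)
      have := warpRatio_last_mem hφ ht hu
      rw [abs_of_nonneg (sq_nonneg _)]
      exact pow_le_one₀ this.1 this.2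
    have i0 : IntervalIntegrable (fun v : ℝ => (n : ℝ) * v ^ (n - 1)) volume 0 (φ t) :=
      Continuous.intervalIntegrable (by fun_prop) _ _
    rw [← integral_mul_pow_pred (by omega : n ≠ 0) (φ t), ← intervalIntegral.integral_const_mul,
      ← intervalIntegral.integral_const_mul, ← intervalIntegral.integral_sub i0 (i1.const_mul _),
      ← intervalIntegral.integral_add (i0.sub (i1.const_mul _)) (i2.const_mul _)]
    refine intervalIntegral.integral_congr fun u hu => ?_
    rw [uIcc_of_le hτ.1.le] at hu
    simp only [cdfCondSecond, cdfCondMean_last hn, cdfCondSq_last hn,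
      one_sub_warpRatio_last hφ ht hu]
    generalize (1 - t) / (1 - warpInv φ u) = κ
    field_simp
    ring
  -- The conditional second moment is quadratic in the ratio. Its constant coefficient is a
  -- quadratic polynomial in `j`, summed below by binomial moments. The linear one still contains `j
  -- - p`, which therefore stays inside the sum.
  have hmid : ∀ j ∈ Finset.Icc 1 (n - 1),
      (n.choose j : ℝ) * ∫ z, cdfCondSecond n φ p t c j z ∂(pairLaw (φ t) j (n - j))
        = (n.choose j : ℝ) * (φ t ^ j * (1 - φ t) ^ (n - j)
            * (c / n * (j - (2 * p - p ^ 2)) + (1 - c) / n ^ 2 * (j - p) ^ 2))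
          + 2 * (1 / n) * c * (p - p ^ 2) * cdfRatio n φ t j 1
          + 2 * (1 / n ^ 2) * (1 - c) * ((j - p) * cdfRatio n φ t j 1)
          + (1 / n * c * (1 - 2 * p + 2 * p ^ 2) + 1 / n ^ 2 * (1 - c))
            * cdfRatio n φ t j 2 := by
    intro j hj
    rw [Finset.mem_Icc] at hj
    have := isFiniteMeasure_pairLaw hτ j (n - j)
    have i1 := integrable_warpRatio_pow hφ ht 1 j (n - j)
    have i2 := integrable_warpRatio_pow hφ ht 2 j (n - j)
    rw [← choose_mul_integral_warpRatio_pow hφ ht 1 hj.1 (by omega),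
      ← choose_mul_integral_warpRatio_pow hφ ht 2 hj.1 (by omega)]
    have hexp : ∀ z, cdfCondSecond n φ p t c j z
        = (c / n * (j - (2 * p - p ^ 2)) + (1 - c) / n ^ 2 * (j - p) ^ 2)
          + (2 * (1 / n) * c * (p - p ^ 2) + 2 * (1 / n ^ 2) * (1 - c) * (j - p))
            * warpRatio φ t z ^ 1
          + (1 / n * c * (1 - 2 * p + 2 * p ^ 2) + 1 / n ^ 2 * (1 - c))
            * warpRatio φ t z ^ 2 := fun z => by
      rw [cdfCondSecond, cdfCondMean_mid hj.1 (by omega), cdfCondSq_mid hj.1 (by omega)]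
      field_simp
      ring
    simp_rw [hexp]
    rw [integral_add (by fun_prop) (by fun_prop), integral_add (by fun_prop) (by fun_prop),
      integral_const, integral_const_mul, integral_const_mul, pairLaw_real_univ hτ, smul_eq_mul]
    ring
  have hcount : countMean n (φ t)
      (fun j => c / n * (j - (2 * p - p ^ 2)) + (1 - c) / n ^ 2 * (j - p) ^ 2)
      = c / n * (n * φ t - (2 * p - p ^ 2))
        + (1 - c) / n ^ 2 * (n * (n - 1) * φ t ^ 2 + n * φ t - 2 * p * (n * φ t) + p ^ 2) := by
    have hexp : (fun j : ℕ => c / n * (j - (2 * p - p ^ 2)) + (1 - c) / n ^ 2 * ((j : ℝ) - p) ^ 2)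
        = fun j : ℕ => (1 - c) / n ^ 2 * (j : ℝ) ^ 2
          + ((c / n - (1 - c) / n ^ 2 * (2 * p)) * j
            + ((1 - c) / n ^ 2 * p ^ 2 - c / n * (2 * p - p ^ 2)) * 1) := by
      ext j
      ring
    rw [hexp, countMean_add n (fun j : ℕ => (1 - c) / n ^ 2 * (j : ℝ) ^ 2),
      countMean_add n (fun j : ℕ => (c / n - (1 - c) / n ^ 2 * (2 * p)) * (j : ℝ)),
      countMean_mul, countMean_mul, countMean_mul, countMean_one, countMean_id, countMean_sq]
    ring
  rw [hfirst, hlast, Finset.sum_congr rfl hmid]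
  simp_rw [Finset.sum_add_distrib, ← Finset.mul_sum]
  rw [sum_Icc_eq_countMean_sub hn, hcount]
  push_cast
  field_simp
  ring

end CDF

/-! ### Rates of convergence -/

lemma isBigO_one_div_of_le {f : ℕ → ℝ} {C : ℝ} (h : ∀ n : ℕ, 1 ≤ n → |f n| ≤ C / n) :
    f =O[Filter.atTop] fun n : ℕ => 1 / (n : ℝ) := by
  refine Asymptotics.IsBigO.of_bound C ?_
  filter_upwards [Filter.eventually_ge_atTop 1] with n hn
  rw [Real.norm_eq_abs, Real.norm_of_nonneg (by positivity), mul_one_div]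
  exact h n hn

/-- The difference `E n ^ 2 - a ^ 2` factors as `(E n - a) * (E n - a + 2 * a)`, and the second
factor is bounded. -/
lemma isBigO_sub_sq {E V : ℕ → ℝ} {a b : ℝ}
    (hE : (fun n => E n - a) =O[Filter.atTop] fun n : ℕ => 1 / (n : ℝ))
    (hV : (fun n => V n + E n ^ 2 - b) =O[Filter.atTop] fun n : ℕ => 1 / (n : ℝ)) :
    (fun n => V n - (b - a ^ 2)) =O[Filter.atTop] fun n : ℕ => 1 / (n : ℝ) := by
  have h1 : (fun n : ℕ => 1 / (n : ℝ)) =O[Filter.atTop] fun _ : ℕ => (1 : ℝ) :=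
    tendsto_one_div_atTop_nhds_zero_nat.isBigO_one ℝ
  have h2 : (fun n => E n - a + 2 * a) =O[Filter.atTop] fun _ : ℕ => (1 : ℝ) :=
    (hE.trans h1).add (Asymptotics.isBigO_const_const _ one_ne_zero _)
  have h3 := hV.sub ((hE.mul h2).congr_right fun n => mul_one _)
  refine h3.congr_left fun n => ?_
  ring

section Rates

variable {φ : ℝ → ℝ} {t p θ : ℝ}

lemma countMean_const (τ : ℝ) (n : ℕ) (a : ℝ) : countMean n τ (fun _ => a) = a := by
  have := countMean_mul (τ := τ) n a (fun _ => 1)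
  rwa [countMean_one, mul_one] at this

lemma mul_two_div_le {K : ℝ} (hK : 0 ≤ K) {n : ℕ} (hn : 1 ≤ n) :
    K * (2 / ((n : ℝ) + 1)) ≤ 2 * K / n := by
  have hn' : (0 : ℝ) < n := by exact_mod_cast hn
  rw [← mul_div_assoc, mul_comm K 2]
  exact div_le_div_of_nonneg_left (by positivity) hn' (by linarith)

/-- The conditional mean and `φ t` lie in the same interval `[φ u, φ v]`, whose length is controlled
by `hL`. -/
lemma abs_bkCondMean_sub_le (hφ : IsACWarping φ) (ht : t ∈ Ioo (0 : ℝ) 1) {L : ℝ}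
    (hL : ∀ u ∈ Icc (0 : ℝ) 1, ∀ v ∈ Icc (0 : ℝ) 1, u ≤ v → φ v - φ u ≤ L * (v - u)) {u v : ℝ}
    (hu : u ∈ Icc 0 t) (hv : v ∈ Ioc t 1) : |bkCondMean φ t (u, v) - φ t| ≤ L * (v - u) := by
  have hu' := mem_Icc_of_mem_left ht hu
  have hv' := mem_Icc_of_mem_right ht (Ioc_subset_Icc_self hv)
  have h1 := bkCondMean_mem hφ hu.2 hv.1
  have h2 := hL u hu' v hv' (hu.2.trans hv.1.le)
  have h3 := hφ.strictMonoOn.monotoneOn hu' (Ioo_subset_Icc_self ht) hu.2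
  have h4 := hφ.strictMonoOn.monotoneOn (Ioo_subset_Icc_self ht) hv' hv.1.le
  rw [clampExtend_eq φ hu', clampExtend_eq φ hv'] at h1
  rw [abs_le]
  constructor <;> linarith [h1.1, h1.2]

lemma abs_bkCondSq_sub_le (hφ : IsACWarping φ) (ht : t ∈ Ioo (0 : ℝ) 1) {L : ℝ}
    (hL : ∀ u ∈ Icc (0 : ℝ) 1, ∀ v ∈ Icc (0 : ℝ) 1, u ≤ v → φ v - φ u ≤ L * (v - u)) {u v : ℝ}
    (hu : u ∈ Icc 0 t) (hv : v ∈ Ioc t 1) : |bkCondSq φ t (u, v) - φ t| ≤ L * (v - u) := by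
  have hu' := mem_Icc_of_mem_left ht hu
  have hv' := mem_Icc_of_mem_right ht (Ioc_subset_Icc_self hv)
  have h1 := bkCondSq_mem hφ hu.2 hv.1
  have h2 := hL u hu' v hv' (hu.2.trans hv.1.le)
  have h3 := hφ.strictMonoOn.monotoneOn hu' (Ioo_subset_Icc_self ht) hu.2
  have h4 := hφ.strictMonoOn.monotoneOn (Ioo_subset_Icc_self ht) hv' hv.1.le
  rw [clampExtend_eq φ hu', clampExtend_eq φ hv'] at h1
  rw [abs_le]
  constructor <;> linarith [h1.1, h1.2]

lemma abs_add_mul_sq_sub_le {c N M a δ ε : ℝ} (hc : c ∈ Icc (0 : ℝ) 1) (hM : M ∈ Icc (0 : ℝ) 1)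
    (ha : a ∈ Icc (0 : ℝ) 1) (hN : |N - a| ≤ δ) (hMa : |M - a| ≤ ε) :
    |c * N + (1 - c) * M ^ 2 - (c * a + (1 - c) * a ^ 2)| ≤ δ + 2 * ε := by
  have hε : 0 ≤ ε := (abs_nonneg _).trans hMa
  have hδ : 0 ≤ δ := (abs_nonneg _).trans hN
  have h1 : |M + a| ≤ 2 := by
    rw [abs_of_nonneg (add_nonneg hM.1 ha.1)]
    linarith [hM.2, ha.2]
  calc |c * N + (1 - c) * M ^ 2 - (c * a + (1 - c) * a ^ 2)|
      = |c * (N - a) + (1 - c) * ((M - a) * (M + a))| := by congr 1; ring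
    _ ≤ |c * (N - a)| + |(1 - c) * ((M - a) * (M + a))| := abs_add_le _ _
    _ = c * |N - a| + (1 - c) * (|M - a| * |M + a|) := by
        rw [abs_mul, abs_mul, abs_mul, abs_of_nonneg hc.1, abs_of_nonneg (sub_nonneg.2 hc.2)]
    _ ≤ 1 * δ + 1 * (ε * 2) := by
        refine add_le_add (mul_le_mul hc.2 hN (abs_nonneg _) zero_le_one)
          (mul_le_mul (by linarith [hc.1]) ?_ (by positivity) zero_le_one)
        exact mul_le_mul hMa h1 (abs_nonneg _) hε
    _ = δ + 2 * ε := by ring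

theorem isBigO_bkMean_sub (hφ : IsACWarping φ) (ht : t ∈ Ioo (0 : ℝ) 1)
    (hd : HasBoundedDeriv φ) :
    (fun n => bkMean n φ t - φ t) =O[Filter.atTop] fun n : ℕ => 1 / (n : ℝ) := by
  obtain ⟨L, hL0, hL⟩ := hφ.exists_sub_le hd
  refine isBigO_one_div_of_le (C := 2 * L) fun n hn => ?_
  have h := abs_knotMean_sub_countMean_le ht (n := n) (G := fun _ => bkCondMean φ t)
    (c := fun _ => φ t) (C := 1) (δ := 0) (K := L) (fun _ _ => measurable_bkCondMean hφ)
    (fun j _ u hu v hv => by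
      have := bkCondMean_mem hφ hu.2 hv.1
      rw [abs_le]
      constructor <;> linarith [this.1, this.2, (hφ.clampExtend_mem u).1,
        (hφ.clampExtend_mem v).2]) hL0
    (fun j _ u hu v hv => by
      rw [zero_add]
      exact abs_bkCondMean_sub_le hφ ht hL hu hv)
  rw [countMean_const, knotMean_bkCondMean hφ ht hn, zero_add] at h
  exact h.trans (mul_two_div_le hL0 hn)

theorem isBigO_bkVar_sub (hφ : IsACWarping φ) (ht : t ∈ Ioo (0 : ℝ) 1) (hθ : 0 < θ)
    (hd : HasBoundedDeriv φ) :
    (fun n => bkVar n φ θ t - 1 / (1 + θ) * (φ t * (1 - φ t)))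
      =O[Filter.atTop] fun n : ℕ => 1 / (n : ℝ) := by
  have hc : 1 / (1 + θ) ∈ Icc (0 : ℝ) 1 :=
    ⟨by positivity, by rw [div_le_one (by linarith)]; linarith⟩
  obtain ⟨L, hL0, hL⟩ := hφ.exists_sub_le hd
  have h2 : (fun n => bkVar n φ θ t + bkMean n φ t ^ 2
      - (1 / (1 + θ) * φ t + (1 - 1 / (1 + θ)) * φ t ^ 2))
      =O[Filter.atTop] fun n : ℕ => 1 / (n : ℝ) := by
    -- The factor `3 * L` is `L` from the mean square plus `2 * L` from the squared mean; the other
    -- `2` is that of the mean gap.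
    refine isBigO_one_div_of_le (C := 2 * (3 * L)) fun n hn => ?_
    have h := abs_knotMean_sub_countMean_le ht (n := n)
      (G := fun _ => bkCondSecond φ t (1 / (1 + θ)))
      (c := fun _ => 1 / (1 + θ) * φ t + (1 - 1 / (1 + θ)) * φ t ^ 2) (C := 1) (δ := 0)
      (K := 3 * L) (fun _ _ => measurable_bkCondSecond hφ _)
      (fun j _ u hu v hv => abs_bkCondSecond_le hφ hc hu.2 hv.1) (by positivity)
      (fun j _ u hu v hv => by
        have hm := bkCondMean_mem hφ hu.2 hv.1
        have := abs_add_mul_sq_sub_le hc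
          ⟨(hφ.clampExtend_mem u).1.trans hm.1, hm.2.trans (hφ.clampExtend_mem v).2⟩
          (hφ.mem_Icc (Ioo_subset_Icc_self ht)) (abs_bkCondSq_sub_le hφ ht hL hu hv)
          (abs_bkCondMean_sub_le hφ ht hL hu hv)
        exact this.trans (by linarith))
    rw [countMean_const, knotMean_bkCondSecond hφ ht hθ hn, zero_add] at h
    exact h.trans (mul_two_div_le (by positivity) hn)
  refine (isBigO_sub_sq (isBigO_bkMean_sub hφ ht hd) h2).congr_left fun n => ?_
  ring

/-- Apart from at most two interpolated coefficients, there are about `j` ones and otherwise zeros.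
In each regime the witness `x` is the deviation of the sum of the coefficients from `j`. -/
lemma abs_cdfCondMean_sub_le {n : ℕ} (hn : 1 ≤ n) (hp : p ∈ Ioo (0 : ℝ) 1) {z : ℝ × ℝ}
    (hz : warpRatio φ t z ∈ Icc (0 : ℝ) 1) {j : ℕ} (hj : j ≤ n) :
    |cdfCondMean n φ p t j z - j / n| ≤ 1 / n := by
  have hn' : (0 : ℝ) < n := by exact_mod_cast hn
  obtain ⟨h0, h1⟩ := hz
  obtain ⟨p0, p1⟩ := hp
  suffices ∃ x : ℝ, |x| ≤ 1 ∧ cdfCondMean n φ p t j z - j / n = x * (1 / n) by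
    obtain ⟨x, hx, h⟩ := this
    rw [h, abs_mul, abs_of_nonneg (by positivity : (0 : ℝ) ≤ 1 / n)]
    exact mul_le_of_le_one_left (by positivity) hx
  rcases Nat.eq_zero_or_pos j with rfl | hj0
  · refine ⟨(1 - p) * warpRatio φ t z, ?_, by rw [cdfCondMean_zero hn]; simp⟩
    rw [abs_le]
    constructor <;> nlinarith
  rcases hj.eq_or_lt with rfl | hjn
  · refine ⟨-(p * (1 - warpRatio φ t z)), ?_, by rw [cdfCondMean_last hn]; ring⟩
    rw [abs_le]
    constructor <;> nlinarith
  · refine ⟨warpRatio φ t z - p, ?_, by rw [cdfCondMean_mid hj0 hjn]; ring⟩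
    rw [abs_le]
    constructor <;> linarith

lemma abs_cdfCondSq_sub_le {n : ℕ} (hn : 1 ≤ n) (hp : p ∈ Ioo (0 : ℝ) 1) {z : ℝ × ℝ}
    (hz : warpRatio φ t z ∈ Icc (0 : ℝ) 1) {j : ℕ} (hj : j ≤ n) :
    |cdfCondSq n φ p t j z - j / n| ≤ 1 / n := by
  have hn' : (0 : ℝ) < n := by exact_mod_cast hn
  obtain ⟨h0, h1⟩ := hz
  obtain ⟨p0, p1⟩ := hp
  have hB0 : 0 ≤ (1 - p) * warpRatio φ t z := mul_nonneg (by linarith) h0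
  have hB1 : (1 - p) * warpRatio φ t z ≤ 1 := mul_le_one₀ (by linarith) h0 h1
  have hA0 : 0 ≤ 1 - p + p * warpRatio φ t z := by nlinarith
  have hA1 : 1 - p + p * warpRatio φ t z ≤ 1 := by nlinarith
  have hA2 := pow_le_one₀ (n := 2) hA0 hA1
  have hB2 := pow_le_one₀ (n := 2) hB0 hB1
  suffices ∃ x : ℝ, |x| ≤ 1 ∧ cdfCondSq n φ p t j z - j / n = x * (1 / n) by
    obtain ⟨x, hx, h⟩ := this
    rw [h, abs_mul, abs_of_nonneg (by positivity : (0 : ℝ) ≤ 1 / n)]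
    exact mul_le_of_le_one_left (by positivity) hx
  rcases Nat.eq_zero_or_pos j with rfl | hj0
  · refine ⟨((1 - p) * warpRatio φ t z) ^ 2, ?_, by rw [cdfCondSq_zero hn]; simp⟩
    rwa [abs_of_nonneg (sq_nonneg _)]
  rcases hj.eq_or_lt with rfl | hjn
  · refine ⟨(1 - p + p * warpRatio φ t z) ^ 2 - 1, ?_, by rw [cdfCondSq_last hn]; ring⟩
    rw [abs_le]
    constructor <;> linarith [sq_nonneg (1 - p + p * warpRatio φ t z)]
  · refine ⟨(1 - p + p * warpRatio φ t z) ^ 2 + ((1 - p) * warpRatio φ t z) ^ 2 - 1, ?_,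
      by rw [cdfCondSq_mid hj0 hjn]; ring⟩
    rw [abs_le]
    constructor <;> linarith [sq_nonneg (1 - p + p * warpRatio φ t z),
      sq_nonneg ((1 - p) * warpRatio φ t z)]

theorem isBigO_cdfMean_sub (hφ : IsACWarping φ) (ht : t ∈ Ioo (0 : ℝ) 1)
    (hp : p ∈ Ioo (0 : ℝ) 1) :
    (fun n => cdfMean n φ p t - φ t) =O[Filter.atTop] fun n : ℕ => 1 / (n : ℝ) := by
  refine isBigO_one_div_of_le (C := 1) fun n hn => ?_
  have hn' : (n : ℝ) ≠ 0 := by positivity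
  have h := abs_knotMean_sub_countMean_le (hφ.map_mem_Ioo ht) (n := n)
    (G := cdfCondMean n φ p t) (c := fun j => (j : ℝ) / n) (C := 1) (δ := 1 / n) (K := 0)
    (fun j _ => measurable_cdfCondMean hφ j)
    (fun j _ u hu v hv => by
      have := cdfCondMean_mem hn hp (warpRatio_mem hφ ht hu hv) j
      rw [abs_of_nonneg this.1]
      exact this.2) le_rfl
    (fun j hj u hu v hv => by
      rw [zero_mul, add_zero]
      exact abs_cdfCondMean_sub_le hn hp (warpRatio_mem hφ ht hu hv) hj)
  have hcount : countMean n (φ t) (fun j => (j : ℝ) / n) = φ t := by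
    have := countMean_mul (τ := φ t) n (1 / n) (fun j => (j : ℝ))
    rw [countMean_id] at this
    rw [show (fun j : ℕ => (j : ℝ) / n) = fun j : ℕ => 1 / (n : ℝ) * j by ext; ring, this]
    field_simp
  rwa [hcount, knotMean_cdfCondMean hφ ht hp hn, zero_mul, add_zero] at h

theorem isBigO_cdfVar_sub (hφ : IsACWarping φ) (ht : t ∈ Ioo (0 : ℝ) 1)
    (hp : p ∈ Ioo (0 : ℝ) 1) (hθ : 0 < θ) :
    (fun n => cdfVar n φ θ p t - 1 / (1 + θ) * (φ t * (1 - φ t)))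
      =O[Filter.atTop] fun n : ℕ => 1 / (n : ℝ) := by
  have hc : 1 / (1 + θ) ∈ Icc (0 : ℝ) 1 :=
    ⟨by positivity, by rw [div_le_one (by linarith)]; linarith⟩
  have hτ := hφ.map_mem_Ioo ht
  have h2 : (fun n => cdfVar n φ θ p t + cdfMean n φ p t ^ 2
      - (1 / (1 + θ) * φ t + (1 - 1 / (1 + θ)) * φ t ^ 2))
      =O[Filter.atTop] fun n : ℕ => 1 / (n : ℝ) := by
    -- Of the four units, three come from replacing the conditional moments by `j / n`, and one from
    -- the variance of `j / n`, which enters through its square.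
    refine isBigO_one_div_of_le (C := 4) fun n hn => ?_
    have hn' : (0 : ℝ) < n := by exact_mod_cast hn
    rw [← knotMean_cdfCondSecond hφ ht hp hn hθ]
    generalize 1 / (1 + θ) = c at hc ⊢
    have h := abs_knotMean_sub_countMean_le hτ (n := n)
      (G := cdfCondSecond n φ p t c) (c := fun j => c * (j / n) + (1 - c) * ((j : ℝ) / n) ^ 2)
      (C := 1) (δ := 1 / n + 2 * (1 / n)) (K := 0)
      (fun j _ => measurable_cdfCondSecond hφ c j)
      (fun j _ u hu v hv => by
        have := cdfCondSecond_mem hn hp (warpRatio_mem hφ ht hu hv) hc j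
        rw [abs_of_nonneg this.1]
        exact this.2) le_rfl
      (fun j hj u hu v hv => by
        rw [zero_mul, add_zero]
        have hz := warpRatio_mem hφ ht hu hv
        exact abs_add_mul_sq_sub_le hc (cdfCondMean_mem hn hp hz j)
          ⟨by positivity, (div_le_one hn').2 (by exact_mod_cast hj)⟩
          (abs_cdfCondSq_sub_le hn hp hz hj) (abs_cdfCondMean_sub_le hn hp hz hj))
    have hcount : countMean n (φ t) (fun j => c * (j / n) + (1 - c) * ((j : ℝ) / n) ^ 2)
        = c * φ t + (1 - c) * φ t ^ 2 + (1 - c) * (φ t * (1 - φ t)) / n := by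
      have hexp : (fun j : ℕ => c * (j / n) + (1 - c) * ((j : ℝ) / n) ^ 2)
          = fun j : ℕ => c / n * (j : ℝ) + (1 - c) / n ^ 2 * (j : ℝ) ^ 2 := by
        ext j
        ring
      rw [hexp, countMean_add n (fun j : ℕ => c / n * (j : ℝ)), countMean_mul, countMean_mul,
        countMean_id, countMean_sq]
      field_simp
      ring
    rw [hcount, zero_mul, add_zero] at h
    have hrest : |(1 - c) * (φ t * (1 - φ t)) / n| ≤ 1 / n := by
      have h0 : 0 ≤ φ t * (1 - φ t) := mul_nonneg hτ.1.le (by linarith [hτ.2])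
      have h1 : φ t * (1 - φ t) ≤ 1 := by nlinarith [hτ.1, hτ.2]
      have hc1 : 0 ≤ 1 - c := by linarith [hc.2]
      rw [abs_of_nonneg (by positivity)]
      exact div_le_div_of_nonneg_right (mul_le_one₀ (by linarith [hc.1]) h0 h1) hn'.le
    calc |knotMean n (φ t) (cdfCondSecond n φ p t c) - (c * φ t + (1 - c) * φ t ^ 2)|
        = |(knotMean n (φ t) (cdfCondSecond n φ p t c) - (c * φ t + (1 - c) * φ t ^ 2
            + (1 - c) * (φ t * (1 - φ t)) / n)) + (1 - c) * (φ t * (1 - φ t)) / n| := by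
          congr 1; ring
      _ ≤ (1 / (n : ℝ) + 2 * (1 / (n : ℝ))) + 1 / (n : ℝ) := (abs_add_le _ _).trans (add_le_add h hrest)
      _ = 4 / (n : ℝ) := by ring
  refine (isBigO_sub_sq (isBigO_cdfMean_sub hφ ht hp) h2).congr_left fun n => ?_
  ring

end Rates

end Warping

end

/-! ### Assembly of closed forms and rates. -/

theorem proposition1
    {φ : ℝ → ℝ} (hφ : Warping.IsACWarping φ)
    {t p θ : ℝ} (ht : t ∈ Set.Ioo (0 : ℝ) 1) (hp : p ∈ Set.Ioo (0 : ℝ) 1) (hθ : 0 < θ)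
    {Ω : ℕ → Type*} [∀ n, MeasurableSpace (Ω n)]
    (P : ∀ n, Measure (Ω n)) [∀ n, IsProbabilityMeasure (P n)]
    (U : ∀ n, Ω n → Fin n → ℝ) (α : ∀ n, Ω n → Fin (n + 1) → ℝ)
    (hBK : ∀ n, 1 ≤ n → Warping.IsBKSample n θ φ (U n) (α n) (P n))
    {Ω' : ℕ → Type*} [∀ n, MeasurableSpace (Ω' n)]
    (P' : ∀ n, Measure (Ω' n)) [∀ n, IsProbabilityMeasure (P' n)]
    (U' : ∀ n, Ω' n → Fin n → ℝ) (β : ∀ n, Ω' n → Fin n → ℝ)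
    (hCDF : ∀ n, 1 ≤ n → Warping.IsCDFSample n θ (U' n) (β n) (P' n)) :
    -- (i) means: closed forms and rates
    ((∀ n, 1 ≤ n →
        Integrable (fun ω => Warping.bkPath (U n ω) (α n ω) t) (P n) ∧
        (∫ ω, Warping.bkPath (U n ω) (α n ω) t ∂(P n)) = Warping.bkMean n φ t) ∧
      (∀ n, 1 ≤ n →
        Integrable (fun ω => Warping.cdfPath φ p (U' n ω) (β n ω) t) (P' n) ∧
        (∫ ω, Warping.cdfPath φ p (U' n ω) (β n ω) t ∂(P' n)) = Warping.cdfMean n φ p t) ∧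
      (Warping.HasBoundedDeriv φ →
        (fun n : ℕ => (∫ ω, Warping.bkPath (U n ω) (α n ω) t ∂(P n)) - φ t)
          =O[Filter.atTop] fun n : ℕ => 1 / (n : ℝ)) ∧
      ((fun n : ℕ => (∫ ω, Warping.cdfPath φ p (U' n ω) (β n ω) t ∂(P' n)) - φ t)
          =O[Filter.atTop] fun n : ℕ => 1 / (n : ℝ))) ∧
    -- (ii) variances: closed forms and rates
    ((∀ n, 1 ≤ n →
        MemLp (fun ω => Warping.bkPath (U n ω) (α n ω) t) 2 (P n) ∧
        variance (fun ω => Warping.bkPath (U n ω) (α n ω) t) (P n)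
          = Warping.bkVar n φ θ t) ∧
      (∀ n, 1 ≤ n →
        MemLp (fun ω => Warping.cdfPath φ p (U' n ω) (β n ω) t) 2 (P' n) ∧
        variance (fun ω => Warping.cdfPath φ p (U' n ω) (β n ω) t) (P' n)
          = Warping.cdfVar n φ θ p t) ∧
      (Warping.HasBoundedDeriv φ →
        (fun n : ℕ => (variance (fun ω => Warping.bkPath (U n ω) (α n ω) t) (P n))
            - 1 / (1 + θ) * (φ t * (1 - φ t)))
          =O[Filter.atTop] fun n : ℕ => 1 / (n : ℝ)) ∧
      ((fun n : ℕ => variance (fun ω => Warping.cdfPath φ p (U' n ω) (β n ω) t) (P' n)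
            - 1 / (1 + θ) * (φ t * (1 - φ t)))
          =O[Filter.atTop] fun n : ℕ => 1 / (n : ℝ))) := by
  have hmomBK := fun n hn => Warping.bk_moments hφ ht hθ (hBK n hn)
  have hmomCDF := fun n hn => Warping.cdf_moments hφ ht hp hθ hn (hCDF n hn)
  have hm1 : ∀ n, 1 ≤ n → ∫ ω, Warping.bkPath (U n ω) (α n ω) t ∂(P n) = Warping.bkMean n φ t :=
    fun n hn => (hmomBK n hn).2.1.trans (Warping.knotMean_bkCondMean hφ ht hn)
  have hm2 : ∀ n, 1 ≤ n → ∫ ω, Warping.cdfPath φ p (U' n ω) (β n ω) t ∂(P' n) = Warping.cdfMean n φ p t :=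
    fun n hn => (hmomCDF n hn).2.1.trans (Warping.knotMean_cdfCondMean hφ ht hp hn)
  have hs1 : ∀ n, 1 ≤ n →
      ∫ ω, Warping.bkPath (U n ω) (α n ω) t ^ 2 ∂(P n) = Warping.bkVar n φ θ t + Warping.bkMean n φ t ^ 2 :=
    fun n hn => (hmomBK n hn).2.2.trans (Warping.knotMean_bkCondSecond hφ ht hθ hn)
  have hs2 : ∀ n, 1 ≤ n → ∫ ω, Warping.cdfPath φ p (U' n ω) (β n ω) t ^ 2 ∂(P' n)
      = Warping.cdfVar n φ θ p t + Warping.cdfMean n φ p t ^ 2 :=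
    fun n hn => (hmomCDF n hn).2.2.trans (Warping.knotMean_cdfCondSecond hφ ht hp hn hθ)
  have hv1 : ∀ n, 1 ≤ n →
      variance (fun ω => Warping.bkPath (U n ω) (α n ω) t) (P n) = Warping.bkVar n φ θ t := fun n hn => by
    have h := variance_eq_sub (hmomBK n hn).1
    simp only [Pi.pow_apply] at h
    rw [h, hs1 n hn, hm1 n hn, add_sub_cancel_right]
  have hv2 : ∀ n, 1 ≤ n →
      variance (fun ω => Warping.cdfPath φ p (U' n ω) (β n ω) t) (P' n) = Warping.cdfVar n φ θ p t :=
    fun n hn => by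
      have h := variance_eq_sub (hmomCDF n hn).1
      simp only [Pi.pow_apply] at h
      rw [h, hs2 n hn, hm2 n hn, add_sub_cancel_right]
  -- Nothing is assumed about the samples for `n = 0`, so the rates of the closed forms are
  -- transferred for `n ≥ 1` only.
  have hge := Filter.eventually_ge_atTop 1
  refine ⟨⟨fun n hn => ⟨(hmomBK n hn).1.integrable one_le_two, hm1 n hn⟩,
    fun n hn => ⟨(hmomCDF n hn).1.integrable one_le_two, hm2 n hn⟩, fun hd => ?_, ?_⟩,
    fun n hn => ⟨(hmomBK n hn).1, hv1 n hn⟩, fun n hn => ⟨(hmomCDF n hn).1, hv2 n hn⟩,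
    fun hd => ?_, ?_⟩
  · refine (Warping.isBigO_bkMean_sub hφ ht hd).congr' ?_ Filter.EventuallyEq.rfl
    filter_upwards [hge] with n hn
    rw [hm1 n hn]
  · refine (Warping.isBigO_cdfMean_sub hφ ht hp).congr' ?_ Filter.EventuallyEq.rfl
    filter_upwards [hge] with n hn
    rw [hm2 n hn]
  · refine (Warping.isBigO_bkVar_sub hφ ht hθ hd).congr' ?_ Filter.EventuallyEq.rfl
    filter_upwards [hge] with n hn
    rw [hv1 n hn]
  · refine (Warping.isBigO_cdfVar_sub hφ ht hp hθ).congr' ?_ Filter.EventuallyEq.rfl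
    filter_upwards [hge] with n hn
    rw [hv2 n hn]
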